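/- All logarithms are to base $2$. Let $\mathcal X$ be a finite alphabet, $p$ a source (a distribution on $\mathcal X$) and $X^n$ i.i.d. $\sim p$, with entropy $H(p)$. A length-$n$ compression scheme is a pair $\mathrm{enc}:\mathcal X^n\to\{0,1\}^m$, $\mathrm{dec}:\{0,1\}^m\to\mathcal X^n$, of rate $m/n$ and error probability $P_e=\Pr[\mathrm{dec}(\mathrm{enc}(X^n))\ne X^n]$. A local decoder adaptively (possibly with randomness) probes bits of $\mathrm{enc}(x^n)$ to output a fragment $x_i^{i+s-1}$, correctly whenever $\mathrm{dec}(\mathrm{enc}(x^n))=x^n$; $r_{\mathrm{avg}}(s)$ is the maximum over $i$ of the expected number of probed bits. A local updater, given $i$ and new content $\tilde x_i^{i+s-1}$ only, adaptively probes $\mathrm{enc}(x^n)$ and overwrites bits so as to turn it into the codeword of the updated word (when both words are recovered from their codewords); $t_{\mathrm{avg}}(s)$ is the maximum over $i$ of the expected number of bits read plus bits written, the new content being an independent i.i.d. $\sim p$ string. For $\varepsilon>0$ let $r^*_{\mathrm{avg}}(1)=r^*_{\mathrm{avg}}(1;p,\varepsilon)$ be the infimum of $\liminf_n r_{\mathrm{avg}}(1)$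 over all sequences of compression schemes with local decoders, of rate at most $H(p)+\varepsilon$ and with $P_e\to0$. A source is dyadic if all its positive probabilities are of the form $2^{-k}$, $k\in\mathbb N$. There is a universal constant $\alpha_f>0$ such that for every finite nonempty alphabet $\mathcal X$ there is a universal scheme (a family of compression schemes with local decoders and updaters, indexed by $\varepsilon$, the blocklength $n$ and the codeword length $m$, not depending on the source; for the source $p$ it is used with $m=\lfloor n(H(p)+\varepsilon)\rfloor$) with the following two properties. (1) For every source $p$ on $\mathcal X$ there are constants $\alpha_i,\alpha_i',\alpha_i''>0$, $i=1,2$, independent of $n,\varepsilon,s$, such that for every $0<\varepsilon<1/2$ and all sufficiently large $n$: $P_e\le 2^{-2^{c\sqrt{\log n}}}$ for some $c>0$ not depending on $n$, and for all $1\le s\le n$, $r_{\mathrm{avg}}(s)\le\alpha_1\frac1{\varepsilon^2}\log\frac1\varepsilon$ if $s\le\alpha_1''\frac1{\varepsilon^2}\log\frac1\varepsilon$ and $r_{\mathrm{avg}}(s)\le\alpha_1's$ otherwise, and likewise $t_{\mathrm{avg}}(s)\le\alpha_2\frac1{\varepsilon^2}\log\frac1\varepsilon$ if $s\le\alpha_2''\frac1{\varepsilon^2}\log\frac1\varepsilon$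 and $t_{\mathrm{avg}}(s)\le\alpha_2's$ otherwise. (2) For every non-dyadic source $p$ on $\mathcal X$ there is $\varepsilon_0=\varepsilon_0(p)>0$ such that for all $0<\varepsilon<\varepsilon_0$ and all sufficiently large $n$, $$r_{\mathrm{avg}}(s)<s\,r^*_{\mathrm{avg}}(1)\qquad\text{for all } s \text{ with } \alpha_f/\varepsilon^2\le s\le n.$$ -/

import Mathlib

open Filter Topology
open scoped ENNReal BigOperators

namespace LocalCompression

universe u v

/-! ### Sources -/

/-- Shannon entropy, in bits. -/
noncomputable def entropy {X : Type u} [Fintype X] (p : PMF X) : ℝ :=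
  ∑ a, Real.negMulLog (p a).toReal / Real.log 2

/-- A source is dyadic if every symbol of positive probability has probability `2⁻ᵏ`
for some natural number `k`. -/
def IsDyadic {X : Type u} (p : PMF X) : Prop :=
  ∀ a, p a ≠ 0 → ∃ k : ℕ, p a = (2⁻¹ : ℝ≥0∞) ^ k

/-- Probability of the word `x` when its letters are i.i.d. with law `p`. -/
noncomputable def wordProb {X : Type u} (p : PMF X) {n : ℕ} (x : Fin n → X) : ℝ≥0∞ :=
  ∏ i, p (x i)

/-- The fragment of length `s` of `x` that starts at the (0-based) position `i`. -/
def fragment {X : Type u} {n : ℕ} (x : Fin n → X) (i s : ℕ) (h : i + s ≤ n) : Fin s → X :=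
  fun k => x ⟨i + k, by have := k.isLt; omega⟩

/-- The word `x` with its fragment at positions `i, …, i + s - 1` replaced by `y`. -/
def replaceFragment {X : Type u} {n : ℕ} (x : Fin n → X) (i : ℕ) {s : ℕ} (y : Fin s → X) :
    Fin n → X :=
  fun j => if h : i ≤ j.val ∧ j.val < i + s then y ⟨j.val - i, by omega⟩ else x j

/-! ### Adaptive bit probes -/

/-- An adaptive probing algorithm on codewords of `m` bits: either stop with an output, or read
one bit of the codeword and continue in a way that depends on its value. -/
inductive ProbeTree (m : ℕ) (β : Type v) : Type v
  | done (b : β) : ProbeTree m β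
  | probe (j : Fin m) (onFalse onTrue : ProbeTree m β) : ProbeTree m β

/-- The output of the algorithm on the codeword `c`. -/
def ProbeTree.output {m : ℕ} {β : Type v} (c : Fin m → Bool) : ProbeTree m β → β
  | .done b => b
  | .probe j t₀ t₁ => if c j then t₁.output c else t₀.output c

/-- The number of bits that the algorithm reads on the codeword `c`. -/
def ProbeTree.numProbes {m : ℕ} {β : Type v} (c : Fin m → Bool) : ProbeTree m β → ℕ
  | .done _ => 0
  | .probe j t₀ t₁ => 1 + if c j then t₁.numProbes c else t₀.numProbes c

/-! ### Compression schemes with local decoding and local update -/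

/-- A fixed-length compression scheme from words of length `n` to codewords of `m` bits;
its rate is `m / n`. -/
structure Scheme (X : Type u) (n m : ℕ) where
  enc : (Fin n → X) → (Fin m → Bool)
  dec : (Fin m → Bool) → (Fin n → X)

/-- The word `x` is recovered from its codeword. -/
def Scheme.Recovers {X : Type u} {n m : ℕ} (S : Scheme X n m) (x : Fin n → X) : Prop :=
  S.dec (S.enc x) = x

open Classical in
/-- Probability that the global decoder does not recover an i.i.d. source word. -/
noncomputable def Scheme.errorProb {X : Type u} [Fintype X] {n m : ℕ} (S : Scheme X n m)
    (p : PMF X) : ℝ≥0∞ :=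
  ∑ x : Fin n → X, if S.Recovers x then 0 else wordProb p x

/-- A (possibly randomized, adaptive) local decoder: for each fragment it probes the codeword and
outputs that fragment. It is never wrong on words that are recoverable from their codeword. -/
structure LocalDecoder {X : Type u} {n m : ℕ} (S : Scheme X n m) where
  alg : (s i : ℕ) → i + s ≤ n → PMF (ProbeTree m (Fin s → X))
  correct : ∀ (s i : ℕ) (h : i + s ≤ n) (x : Fin n → X), S.Recovers x →
    ∀ t ∈ (alg s i h).support, t.output (S.enc x) = fragment x i s h

/-- Average local decodability: the largest, over the positions of fragments of length `s`,
expected number of probed bits; the expectation is over the i.i.d. source word and the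
randomness of the local decoder. -/
noncomputable def LocalDecoder.rAvg {X : Type u} [Fintype X] {n m : ℕ} {S : Scheme X n m}
    (D : LocalDecoder S) (p : PMF X) (s : ℕ) : ℝ≥0∞ :=
  ⨆ (i : ℕ) (h : i + s ≤ n),
    ∑ x : Fin n → X, wordProb p x *
      ∑' t : ProbeTree m (Fin s → X), D.alg s i h t * (t.numProbes (S.enc x) : ℝ≥0∞)

/-- A set of writes to a codeword: `w j = some b` means that bit `j` is overwritten by `b`. -/
abbrev Writes (m : ℕ) : Type := Fin m → Option Bool

/-- The codeword after the writes. -/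
def Writes.apply {m : ℕ} (w : Writes m) (c : Fin m → Bool) : Fin m → Bool :=
  fun j => (w j).getD (c j)

/-- The number of bits written. -/
def Writes.size {m : ℕ} (w : Writes m) : ℕ :=
  (Finset.univ.filter fun j => (w j).isSome = true).card

/-- An adaptive local updater: given the position and the new content `y` of a fragment, but
neither the word nor its codeword, it probes the codeword and then overwrites bits so as to obtain
the codeword of the updated word (old and new word being recoverable from their codewords). -/
structure LocalUpdater {X : Type u} {n m : ℕ} (S : Scheme X n m) where
  alg : (s i : ℕ) → i + s ≤ n → (Fin s → X) → ProbeTree m (Writes m)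
  correct : ∀ (s i : ℕ) (h : i + s ≤ n) (y : Fin s → X) (x : Fin n → X),
    S.Recovers x → S.Recovers (replaceFragment x i y) →
      ((alg s i h y).output (S.enc x)).apply (S.enc x) = S.enc (replaceFragment x i y)

/-- Average update efficiency: the largest, over the positions of fragments of length `s`,
expected number of bits read plus bits written, where the new content of the fragment is
independent of the source word and i.i.d. with the same law. -/
noncomputable def LocalUpdater.tAvg {X : Type u} [Fintype X] {n m : ℕ} {S : Scheme X n m}
    (U : LocalUpdater S) (p : PMF X) (s : ℕ) : ℝ≥0∞ :=
  ⨆ (i : ℕ) (h : i + s ≤ n),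
    ∑ x : Fin n → X, ∑ y : Fin s → X, wordProb p x * wordProb p y *
      (((U.alg s i h y).numProbes (S.enc x) + ((U.alg s i h y).output (S.enc x)).size : ℕ) : ℝ≥0∞)

/-- A compression scheme together with a local decoder and a local updater. -/
structure LocalScheme (X : Type u) (n m : ℕ) where
  scheme : Scheme X n m
  decoder : LocalDecoder scheme
  updater : LocalUpdater scheme

/-- A universal scheme over the alphabet `X`: one scheme for every redundancy `ε`, blocklength `n`
and codeword length `m`. The source law is not an input. -/
def UniversalScheme (X : Type u) : Type u :=
  (ε : ℝ) → (n m : ℕ) → LocalScheme X n m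

/-- The codeword length used at blocklength `n` for the source `p`: the largest one of rate at most
`H(p) + ε`. -/
noncomputable def codeLength {X : Type u} [Fintype X] (p : PMF X) (ε : ℝ) (n : ℕ) : ℕ :=
  ⌊(n : ℝ) * (entropy p + ε)⌋₊

/-- The member of the universal scheme that is used for the source `p`. -/
noncomputable def UniversalScheme.at {X : Type u} [Fintype X] (𝒮 : UniversalScheme X)
    (p : PMF X) (ε : ℝ) (n : ℕ) : LocalScheme X n (codeLength p ε n) :=
  𝒮 ε n (codeLength p ε n)

/-! ### The optimal single-symbol decodability -/

/-- The smallest asymptotic average single-symbol local decodability among all sequences of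
compression schemes (for `p`, `n = 0, 1, 2, …`) of rate at most `H(p) + ε` and vanishing probability
of error, with any local decoders. -/
noncomputable def rStar {X : Type u} [Fintype X] (p : PMF X) (ε : ℝ) : ℝ≥0∞ :=
  ⨅ (m : ℕ → ℕ) (S : (n : ℕ) → Scheme X n (m n)) (D : (n : ℕ) → LocalDecoder (S n))
    (_ : ∀ n, (m n : ℝ) ≤ (n : ℝ) * (entropy p + ε))
    (_ : Tendsto (fun n => (S n).errorProb p) atTop (𝓝 0)),
    liminf (fun n => (D n).rAvg p 1) atTop

/-! ### The guarantees of the multilevel scheme -/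

/-- The neighbourhood scale `(1 / ε²) log₂ (1 / ε)`. -/
noncomputable def scale (ε : ℝ) : ℝ := 1 / ε ^ 2 * Real.logb 2 (1 / ε)

/-- The bound that is `a · scale ε` for fragments of length `s ≤ a'' · scale ε` and `a' · s` for
longer ones. -/
noncomputable def localityBound (a a' a'' ε : ℝ) (s : ℕ) : ℝ≥0∞ :=
  open Classical in
  ENNReal.ofReal (if (s : ℝ) ≤ a'' * scale ε then a * scale ε else a' * s)

/-- The performance of the universal scheme on the source `p`: at rate at most `H(p) + ε` its
probability of error is `2 ^ (-2 ^ Ω(√log n))`, and its average local decodability and update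
efficiency obey the two-regime bound with constants that depend on `p`, but not on `n`, `ε`, `s`. -/
def UniversalScheme.Performs {X : Type u} [Fintype X] (𝒮 : UniversalScheme X) (p : PMF X) :
    Prop :=
  ∃ a₁ a₁' a₁'' a₂ a₂' a₂'' : ℝ,
    0 < a₁ ∧ 0 < a₁' ∧ 0 < a₁'' ∧ 0 < a₂ ∧ 0 < a₂' ∧ 0 < a₂'' ∧
    ∀ ε : ℝ, 0 < ε → ε < 1 / 2 →
      (∃ c : ℝ, 0 < c ∧ ∀ᶠ n : ℕ in atTop,
        (𝒮.at p ε n).scheme.errorProb p ≤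
          ENNReal.ofReal ((2 : ℝ) ^ (-(2 : ℝ) ^ (c * Real.sqrt (Real.logb 2 n))))) ∧
      (∀ᶠ n : ℕ in atTop, ∀ s : ℕ, 1 ≤ s → s ≤ n →
        (𝒮.at p ε n).decoder.rAvg p s ≤ localityBound a₁ a₁' a₁'' ε s ∧
        (𝒮.at p ε n).updater.tAvg p s ≤ localityBound a₂ a₂' a₂'' ε s)

end LocalCompression

/-! The theorem sets a construction whose cost per letter on long fragments approaches the entropy
`H` against a lower bound that keeps the cost of a single letter away from `H` for non-dyadic
sources.

The construction. Let `d` be the alphabet size and `2 ^ e` equal to `1 / ε` up to a constant.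
Sub-blocks of order `2 ^ e * e` letters get variable-length codes: words are ranked by the size of
their type class, which exceeds the ideal length by logarithmically many bits for every source at
once (`exists_universal_rank`). About `2 ^ e` sub-blocks form a block of level `0`, of order `ε⁻²
log (1 / ε)` letters, with pointers that make each sub-block readable on its own. The block is bad
if its payload overflows; by Chernoff's bound this has probability polynomially small in `ε`
(`Overhead.badProb_zero_le`). The payload size is computed from the rate `m / n`, so the source need
not be known.

Overflow is repaired by a hierarchy. A block of level `k + 1` has spare room for one bad child and
is bad only if two children are. Disjoint blocks are independent, so the probability of a bad block
is squared at each level, up to the factor `arity ^ 2` (`badProb_succ_le`), and decays doubly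
exponentially, while the block lengths are only `2 ^ O(k²)`. Hence the expected extra cost of
climbing above level `0` is at most `1` (`codeParams_cost_le`), the rate overhead is a geometric
series (`codeParams_chunkLen_le`), and of order `√(log n)` levels give the error `2 ^ (-2 ^ Ω(√(log
n)))` (`exists_error_exponent`).

Reading uses the smallest good block around a sub-block; updating rewrites the smallest block that
is good before and after. Updates stay local because the spare area stores only the residue of the
bad child, the part that the child's own chunk does not determine: a change inside a block that is
good before and after leaves all flags and residues above it intact (`Resolved.stable`,
`Resolved.covers`).

The lower bound. An algorithm that outputs a letter is a binary tree. The weights `2 ^ (-l)`, with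
`l` the least depth at which a letter is output, satisfy Kraft's inequality and are `0` or powers of
`1/2`. Gibbs' inequality with a Hellinger remainder (`gibbs_le`) then makes the expected number of
probes exceed `H` by a fixed amount as soon as one positive probability is not a power of `1/2`.
Letting the error probability tend to `0` gives `rStar ≥ H + δ` with `δ` independent of `ε`
(`exists_lt_rStar`).

Comparison. A fragment of length `s` costs at most `(s + O(ε⁻¹ log (1 / ε))) (H + ε)` probes. For `s
≥ ε⁻²` this is `s (H + o(1))` as `ε → 0`, eventually less than `s (H + δ)`; so `αf = 1` serves. -/

namespace LocalCompression

universe u v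

/-! ### Composing probing algorithms -/

namespace ProbeTree

variable {m : ℕ} {β γ : Type*}

/-- Run `t`, then the algorithm that `f` associates with its output. -/
def bind : ProbeTree m β → (β → ProbeTree m γ) → ProbeTree m γ
  | .done b, f => f b
  | .probe j t₀ t₁, f => .probe j (bind t₀ f) (bind t₁ f)

theorem output_bind (c : Fin m → Bool) (t : ProbeTree m β) (f : β → ProbeTree m γ) :
    (t.bind f).output c = (f (t.output c)).output c := by
  induction t with
  | done b => rfl
  | probe j t₀ t₁ h₀ h₁ => by_cases h : c j <;> simp [bind, output, h, h₀, h₁]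

theorem numProbes_bind (c : Fin m → Bool) (t : ProbeTree m β) (f : β → ProbeTree m γ) :
    (t.bind f).numProbes c = t.numProbes c + (f (t.output c)).numProbes c := by
  induction t with
  | done b => simp [bind, numProbes, output]
  | probe j t₀ t₁ h₀ h₁ => by_cases h : c j <;> simp [bind, output, numProbes, h, h₀, h₁, add_assoc]

end ProbeTree

/-- The codeword `c`, continued by `false`. -/
def extendBits {m : ℕ} (c : Fin m → Bool) (j : ℕ) : Bool :=
  if h : j < m then c ⟨j, h⟩ else false

/-- Read the bit at address `j` (`false` if there is none). -/
def readBit (m j : ℕ) : ProbeTree m Bool :=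
  if h : j < m then .probe ⟨j, h⟩ (.done false) (.done true) else .done false

theorem output_readBit {m : ℕ} (c : Fin m → Bool) (j : ℕ) :
    (readBit m j).output c = extendBits c j := by
  unfold readBit extendBits
  split_ifs with h
  · cases hc : c ⟨j, h⟩ <;> simp [ProbeTree.output, hc]
  · rfl

theorem numProbes_readBit_le {m : ℕ} (c : Fin m → Bool) (j : ℕ) :
    (readBit m j).numProbes c ≤ 1 := by
  unfold readBit
  split_ifs with h
  · cases hc : c ⟨j, h⟩ <;> simp [ProbeTree.numProbes, hc]
  · simp [ProbeTree.numProbes]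

/-- Run the algorithms `T a, …, T (a + l - 1)` and collect their outputs
(relative to the address `a`). -/
def gather {m : ℕ} {β : Type*} (b₀ : β) (T : ℕ → ProbeTree m β) (a : ℕ) :
    ℕ → ProbeTree m (ℕ → β)
  | 0 => .done fun _ => b₀
  | l + 1 => (gather b₀ T a l).bind fun f => (T (a + l)).bind fun b =>
      .done (Function.update f l b)

theorem output_gather {m : ℕ} {β : Type*} (c : Fin m → Bool) (b₀ : β) (T : ℕ → ProbeTree m β)
    (a l : ℕ) :
    (gather b₀ T a l).output c = fun j => if j < l then (T (a + j)).output c else b₀ := by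
  induction l with
  | zero => simp [gather, ProbeTree.output]
  | succ l ih =>
    simp only [gather, ProbeTree.output_bind, ih, ProbeTree.output]
    funext j
    rcases lt_trichotomy j l with h | rfl | h
    · rw [Function.update_of_ne h.ne, if_pos h, if_pos (by omega)]
    · rw [Function.update_self, if_pos (by omega)]
    · rw [Function.update_of_ne h.ne', if_neg (by omega), if_neg (by omega)]

theorem numProbes_gather {m : ℕ} {β : Type*} (c : Fin m → Bool) (b₀ : β)
    (T : ℕ → ProbeTree m β) (a l : ℕ) :
    (gather b₀ T a l).numProbes c = ∑ j ∈ Finset.range l, (T (a + j)).numProbes c := by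
  induction l with
  | zero => simp [gather, ProbeTree.numProbes]
  | succ l ih =>
    simp [gather, ProbeTree.numProbes_bind, ih, ProbeTree.numProbes, Finset.sum_range_succ]

/-- Read the `l` bits from address `a` on. -/
def readRange (m a l : ℕ) : ProbeTree m (ℕ → Bool) :=
  gather false (readBit m) a l

theorem output_readRange {m : ℕ} (c : Fin m → Bool) (a l : ℕ) :
    (readRange m a l).output c = fun j => if j < l then extendBits c (a + j) else false := by
  simp [readRange, output_gather, output_readBit]

theorem numProbes_readRange_le {m : ℕ} (c : Fin m → Bool) (a l : ℕ) :
    (readRange m a l).numProbes c ≤ l := by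
  rw [readRange, numProbes_gather]
  calc _ ≤ ∑ _j ∈ Finset.range l, 1 := Finset.sum_le_sum fun j _ => numProbes_readBit_le c _
    _ = l := by simp

/-! ### The multilevel block code -/

/-- The word `w` seen from position `o` on. -/
def shift {X : Type*} (o : ℕ) (w : ℕ → X) : ℕ → X := fun j => w (o + j)

theorem shift_apply {X : Type*} (o : ℕ) (w : ℕ → X) (j : ℕ) : shift o w j = w (o + j) := rfl

theorem shift_shift {X : Type*} (o o' : ℕ) (w : ℕ → X) :
    shift o (shift o' w) = shift (o' + o) w := by
  funext j; simp [shift, add_assoc]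

/-- Two words agree on their first `N` letters. -/
def Agree {X : Type*} (N : ℕ) (w w' : ℕ → X) : Prop := ∀ j < N, w j = w' j

theorem Agree.shift {X : Type*} {N N' o : ℕ} {w w' : ℕ → X} (h : Agree N w w')
    (ho : o + N' ≤ N) : Agree N' (shift o w) (LocalCompression.shift o w') :=
  fun j hj => h (o + j) (by omega)

/-- Parameters of the multilevel code. A block of level `0` consists of `num` sub-blocks of `sub`
letters; it is stored as a flag, `num + 1` pointers of `ptr` bits and `slot` bits of payload, where
a sub-block is stored as the binary expansion of its `rank`. A block of level `k + 1` consists of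
`arity k` blocks of level `k`. -/
structure Params (X : Type u) where
  sub : ℕ
  num : ℕ
  ptr : ℕ
  slot : ℕ
  arity : ℕ → ℕ
  width : ℕ
  rank : (Fin sub → X) → ℕ
  sym : X → ℕ
  blank : X
  sub_pos : 0 < sub
  num_pos : 0 < num
  ptr_pos : 0 < ptr
  width_pos : 0 < width
  arity_pos : ∀ k, 0 < arity k
  slot_lt : slot < 2 ^ ptr
  rank_injective : Function.Injective rank
  sym_injective : Function.Injective sym
  sym_lt : ∀ a, sym a < width

namespace Params

variable {X : Type u} (P : Params X)

/-- The number of letters of a block of level `k`. -/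
def blockLen : ℕ → ℕ
  | 0 => P.num * P.sub
  | k + 1 => P.arity k * blockLen k

/-- The number of bits of the chunk of a block of level `k`. -/
def chunkLen : ℕ → ℕ
  | 0 => 1 + (P.num + 1) * P.ptr + P.slot
  | k + 1 => 1 + P.arity k * chunkLen k + P.width * P.blockLen k

theorem blockLen_pos (k : ℕ) : 0 < P.blockLen k := by
  induction k with
  | zero => exact Nat.mul_pos P.num_pos P.sub_pos
  | succ k ih => exact Nat.mul_pos (P.arity_pos k) ih

theorem chunkLen_pos (k : ℕ) : 0 < P.chunkLen k := by
  cases k <;> simp only [chunkLen] <;> omega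

/-- The rank of the first sub-block of `w`. -/
def subRank (w : ℕ → X) : ℕ := P.rank fun k => w k

/-- The code length of the first sub-block of `w`. -/
def codeLen (w : ℕ → X) : ℕ := Nat.size (P.subRank w)

/-- The position in the payload at which the `i`-th sub-block of `w` starts. -/
def start (w : ℕ → X) (i : ℕ) : ℕ := ∑ j ∈ Finset.range i, P.codeLen (shift (j * P.sub) w)

/-- A block of level `0` is good if its payload fits into the slot; a block of a higher level is
good if at most one of its children is not good. -/
def Good : ℕ → (ℕ → X) → Prop
  | 0, w => P.start w P.num ≤ P.slot
  | k + 1, w => ∀ i < P.arity k, ∀ j < P.arity k,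
      ¬ Good k (shift (i * P.blockLen k) w) → ¬ Good k (shift (j * P.blockLen k) w) → i = j

open Classical in
/-- The part of a block that its chunk does not determine; the other letters are blank. -/
noncomputable def residue : ℕ → (ℕ → X) → (ℕ → X)
  | 0, w => if P.Good 0 w then fun _ => P.blank else w
  | k + 1, w => if P.Good (k + 1) w then fun _ => P.blank else
      fun j => residue k (shift (j / P.blockLen k * P.blockLen k) w) (j % P.blockLen k)

/-- The payload bit `t` of a block of level `0`. -/
def Payload (w : ℕ → X) (t : ℕ) : Prop :=
  ∃ i < P.num, P.start w i ≤ t ∧ t < P.start w (i + 1) ∧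
    (P.subRank (shift (i * P.sub) w)).testBit (t - P.start w i) = true

open Classical in
/-- The chunk of a block. -/
noncomputable def chunk : ℕ → (ℕ → X) → (ℕ → Bool)
  | 0, w => fun j =>
      if j = 0 then decide (P.Good 0 w)
      else if j - 1 < (P.num + 1) * P.ptr then
        decide (P.Good 0 w) && (P.start w ((j - 1) / P.ptr)).testBit ((j - 1) % P.ptr)
      else decide (P.Good 0 w ∧ P.Payload w (j - 1 - (P.num + 1) * P.ptr))
  | k + 1, w => fun j =>
      if j = 0 then decide (P.Good (k + 1) w)
      else if j - 1 < P.arity k * P.chunkLen k then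
        chunk k (shift ((j - 1) / P.chunkLen k * P.blockLen k) w) ((j - 1) % P.chunkLen k)
      -- The spare area of a good block holds the residue of its only bad child in one-hot form:
      -- `width` bits per letter, with bit `sym a` set for the letter `a`. It is zero in a bad block
      -- and when no child is bad. Storing the residue, not the letters, makes it insensitive to
      -- changes inside descendants of the bad child that stay good.
      else decide (P.Good (k + 1) w ∧ ∃ i < P.arity k, ¬ P.Good k (shift (i * P.blockLen k) w) ∧
        P.sym (P.residue k (shift (i * P.blockLen k) w)
          ((j - 1 - P.arity k * P.chunkLen k) / P.width)) =
          (j - 1 - P.arity k * P.chunkLen k) % P.width)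

open Classical in
theorem chunk_flag (k : ℕ) (w : ℕ → X) : P.chunk k w 0 = decide (P.Good k w) := by
  cases k <;> simp [chunk]

theorem chunk_child (k : ℕ) (w : ℕ → X) {i j : ℕ} (hi : i < P.arity k) (hj : j < P.chunkLen k) :
    P.chunk (k + 1) w (1 + i * P.chunkLen k + j) = P.chunk k (shift (i * P.blockLen k) w) j := by
  have h1 : 1 + i * P.chunkLen k + j - 1 = j + i * P.chunkLen k := by omega
  have h2 : (j + i * P.chunkLen k) / P.chunkLen k = i := by
    rw [Nat.add_mul_div_right _ _ (P.chunkLen_pos k), Nat.div_eq_of_lt hj, zero_add]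
  have h3 : (j + i * P.chunkLen k) % P.chunkLen k = j := by
    rw [Nat.add_mul_mod_self_right, Nat.mod_eq_of_lt hj]
  have h4 : j + i * P.chunkLen k < P.arity k * P.chunkLen k := by
    calc j + i * P.chunkLen k < (i + 1) * P.chunkLen k := by rw [add_mul]; omega
      _ ≤ _ := Nat.mul_le_mul_right _ hi
  simp only [chunk]
  rw [if_neg (by omega), h1, if_pos h4, h2, h3]

open Classical in
theorem chunk_area (k : ℕ) (w : ℕ → X) {t r : ℕ} (hr : r < P.width) :
    P.chunk (k + 1) w (1 + P.arity k * P.chunkLen k + (t * P.width + r)) =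
      decide (P.Good (k + 1) w ∧ ∃ i < P.arity k, ¬ P.Good k (shift (i * P.blockLen k) w) ∧
        P.sym (P.residue k (shift (i * P.blockLen k) w) t) = r) := by
  have h1 : 1 + P.arity k * P.chunkLen k + (t * P.width + r) - 1 - P.arity k * P.chunkLen k
      = r + t * P.width := by omega
  have h2 : (r + t * P.width) / P.width = t := by
    rw [Nat.add_mul_div_right _ _ P.width_pos, Nat.div_eq_of_lt hr, zero_add]
  have h3 : (r + t * P.width) % P.width = r := by
    rw [Nat.add_mul_mod_self_right, Nat.mod_eq_of_lt hr]
  simp only [chunk]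
  rw [if_neg (by omega), if_neg (by omega), h1, h2, h3]

/-! #### Dependence on the letters of the block only -/

theorem subRank_congr {w w' : ℕ → X} (h : Agree P.sub w w') : P.subRank w = P.subRank w' := by
  unfold subRank
  congr 1
  funext k
  exact h k k.isLt

theorem start_congr {w w' : ℕ → X} {i : ℕ} (h : Agree (i * P.sub) w w') :
    P.start w i = P.start w' i := by
  unfold start codeLen
  refine Finset.sum_congr rfl fun j hj => ?_
  rw [P.subRank_congr (h.shift ?_)]
  have : j + 1 ≤ i := Finset.mem_range.1 hj
  calc j * P.sub + P.sub = (j + 1) * P.sub := by ring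
    _ ≤ _ := Nat.mul_le_mul_right _ this

theorem _root_.LocalCompression.Agree.child {P : Params X} {k : ℕ} {w w' : ℕ → X}
    (h : Agree (P.blockLen (k + 1)) w w') {i : ℕ} (hi : i < P.arity k) :
    Agree (P.blockLen k) (LocalCompression.shift (i * P.blockLen k) w)
      (LocalCompression.shift (i * P.blockLen k) w') := by
  refine h.shift ?_
  calc i * P.blockLen k + P.blockLen k = (i + 1) * P.blockLen k := by ring
    _ ≤ _ := Nat.mul_le_mul_right _ hi

theorem good_congr (k : ℕ) {w w' : ℕ → X} (h : Agree (P.blockLen k) w w') :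
    P.Good k w ↔ P.Good k w' := by
  induction k generalizing w w' with
  | zero => simp only [Good]; rw [P.start_congr h]
  | succ k ih =>
    simp only [Good]
    refine forall_congr' fun i => forall_congr' fun hi => forall_congr' fun j =>
      forall_congr' fun hj => ?_
    rw [ih (h.child hi), ih (h.child hj)]

theorem residue_congr (k : ℕ) {w w' : ℕ → X} (h : Agree (P.blockLen k) w w') :
    Agree (P.blockLen k) (P.residue k w) (P.residue k w') := by
  induction k generalizing w w' with
  | zero =>
    intro j hj
    have hG := P.good_congr 0 h
    by_cases hg : P.Good 0 w
    · simp [residue, hg, hG.1 hg]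
    · simpa [residue, hg, mt hG.2 hg] using h j hj
  | succ k ih =>
    intro j hj
    have hG := P.good_congr (k + 1) h
    by_cases hg : P.Good (k + 1) w
    · simp [residue, hg, hG.1 hg]
    · have : j / P.blockLen k < P.arity k := by
        rw [Nat.div_lt_iff_lt_mul (P.blockLen_pos k)]; exact hj
      simpa [residue, hg, mt hG.2 hg] using
        ih (h.child this) _ (Nat.mod_lt _ (P.blockLen_pos k))

/-- The raw area depends on the goodness and on the residues of the children. -/
theorem chunk_succ_congr (k : ℕ) {w w' : ℕ → X}
    (hg : ∀ i < P.arity k, (P.Good k (shift (i * P.blockLen k) w) ↔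
      P.Good k (shift (i * P.blockLen k) w')))
    (hr : ∀ i < P.arity k, Agree (P.blockLen k) (P.residue k (shift (i * P.blockLen k) w))
      (P.residue k (shift (i * P.blockLen k) w')))
    {j : ℕ} (hj : j < P.chunkLen (k + 1))
    (hc : ∀ i < P.arity k, ∀ j' < P.chunkLen k, j = 1 + i * P.chunkLen k + j' →
      P.chunk k (shift (i * P.blockLen k) w) j' = P.chunk k (shift (i * P.blockLen k) w') j') :
    P.chunk (k + 1) w j = P.chunk (k + 1) w' j := by
  have hG : P.Good (k + 1) w ↔ P.Good (k + 1) w' := by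
    simp only [Good]
    refine forall_congr' fun i => forall_congr' fun hi => forall_congr' fun j =>
      forall_congr' fun hj => ?_
    rw [hg i hi, hg j hj]
  simp only [chunk]
  split_ifs with h0 h1
  · simp [hG]
  · refine hc _ ?_ _ (Nat.mod_lt _ (P.chunkLen_pos k)) ?_
    · rwa [Nat.div_lt_iff_lt_mul (P.chunkLen_pos k)]
    · have := Nat.div_add_mod (j - 1) (P.chunkLen k)
      rw [mul_comm] at this
      omega
  · simp only [decide_eq_decide]
    refine and_congr hG (exists_congr fun i => and_congr_right fun hi => ?_)
    rw [hg i hi, hr i hi]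
    rw [Nat.div_lt_iff_lt_mul P.width_pos, mul_comm (P.blockLen k)]
    simp only [chunkLen] at hj
    omega

theorem payload_congr {w w' : ℕ → X} (h : Agree (P.blockLen 0) w w') (t : ℕ) :
    P.Payload w t ↔ P.Payload w' t := by
  unfold Payload
  refine exists_congr fun i => and_congr_right fun hi => ?_
  have hle : (i + 1) * P.sub ≤ P.blockLen 0 := Nat.mul_le_mul_right _ hi
  have h1 : P.start w i = P.start w' i :=
    P.start_congr fun j hj => h j (hj.trans_le ((Nat.mul_le_mul_right _ (Nat.le_succ i)).trans hle))
  have h2 : P.start w (i + 1) = P.start w' (i + 1) :=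
    P.start_congr fun j hj => h j (hj.trans_le hle)
  have h3 : P.subRank (shift (i * P.sub) w) = P.subRank (shift (i * P.sub) w') :=
    P.subRank_congr (h.shift (by rw [← Nat.succ_mul]; exact hle))
  rw [h1, h2, h3]

theorem chunk_congr (k : ℕ) {w w' : ℕ → X} (h : Agree (P.blockLen k) w w') :
    Agree (P.chunkLen k) (P.chunk k w) (P.chunk k w') := by
  induction k generalizing w w' with
  | zero =>
    intro j hj
    have hG := P.good_congr 0 h
    simp only [chunk]
    split_ifs with h0 h1
    · simp [hG]
    · have hi : (j - 1) / P.ptr < P.num + 1 := by rwa [Nat.div_lt_iff_lt_mul P.ptr_pos]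
      have ha : Agree ((j - 1) / P.ptr * P.sub) w w' :=
        fun t ht => h t (lt_of_lt_of_le ht (Nat.mul_le_mul_right _ (by omega)))
      rw [P.start_congr ha]
      rw [decide_eq_decide.2 hG]
    · simp [hG, P.payload_congr h]
  | succ k ih =>
    intro j hj
    exact P.chunk_succ_congr k (fun i hi => P.good_congr k (h.child hi))
      (fun i hi => P.residue_congr k (h.child hi)) hj
      (fun i hi j' hj' _ => ih (h.child hi) j' hj')

/-! #### Unique decodability -/

theorem start_mono (w : ℕ → X) : Monotone (P.start w) := by
  intro i j hij
  exact Finset.sum_le_sum_of_subset (Finset.range_mono hij)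

theorem start_succ (w : ℕ → X) (i : ℕ) :
    P.start w (i + 1) = P.start w i + P.codeLen (shift (i * P.sub) w) :=
  Finset.sum_range_succ _ _

theorem payload_start_add (w : ℕ → X) {i t : ℕ} (hi : i < P.num)
    (ht : t < P.codeLen (shift (i * P.sub) w)) :
    P.Payload w (P.start w i + t) ↔ (P.subRank (shift (i * P.sub) w)).testBit t = true := by
  constructor
  · rintro ⟨i', hi', h1, h2, h3⟩
    have : i' = i := by
      by_contra hne
      rcases Nat.lt_or_gt_of_ne hne with hlt | hgt
      · have := P.start_mono w (show i' + 1 ≤ i from hlt); omega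
      · have := P.start_mono w (show i + 1 ≤ i' from hgt)
        rw [start_succ] at this; omega
    subst this
    simpa using h3
  · intro h
    exact ⟨i, hi, by omega, by rw [start_succ]; omega, by simpa using h⟩

theorem testBit_eq_false_of_codeLen_le {w : ℕ → X} {t : ℕ} (ht : P.codeLen w ≤ t) :
    (P.subRank w).testBit t = false :=
  Nat.testBit_lt_two_pow (Nat.size_le.1 ht)

theorem subRank_inj {w w' : ℕ → X} (h : P.subRank w = P.subRank w') : Agree P.sub w w' := by
  intro j hj
  exact congrFun (P.rank_injective h) ⟨j, hj⟩

theorem start_lt_of_good {w : ℕ → X} (h : P.Good 0 w) {i : ℕ} (hi : i ≤ P.num) :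
    P.start w i < 2 ^ P.ptr :=
  ((P.start_mono w hi).trans h).trans_lt P.slot_lt

theorem chunk_zero_pointer {w : ℕ → X} (h : P.Good 0 w) {i t : ℕ} (hi : i ≤ P.num)
    (ht : t < P.ptr) :
    P.chunk 0 w (1 + i * P.ptr + t) = (P.start w i).testBit t := by
  have h1 : 1 + i * P.ptr + t - 1 = t + i * P.ptr := by omega
  have h2 : (t + i * P.ptr) / P.ptr = i := by
    rw [Nat.add_mul_div_right _ _ P.ptr_pos, Nat.div_eq_of_lt ht, zero_add]
  have h3 : (t + i * P.ptr) % P.ptr = t := by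
    rw [Nat.add_mul_mod_self_right, Nat.mod_eq_of_lt ht]
  have h4 : t + i * P.ptr < (P.num + 1) * P.ptr := by
    calc t + i * P.ptr < (i + 1) * P.ptr := by rw [add_mul]; omega
      _ ≤ _ := Nat.mul_le_mul_right _ (by omega)
  simp only [chunk]
  rw [if_neg (by omega), h1, if_pos h4, h2, h3]
  simp [h]

theorem chunk_zero_payload {w : ℕ → X} (h : P.Good 0 w) {i t : ℕ} (hi : i < P.num)
    (ht : t < P.codeLen (shift (i * P.sub) w)) :
    P.chunk 0 w (1 + (P.num + 1) * P.ptr + (P.start w i + t)) =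
      (P.subRank (shift (i * P.sub) w)).testBit t := by
  have h1 : 1 + (P.num + 1) * P.ptr + (P.start w i + t) - 1 - (P.num + 1) * P.ptr
      = P.start w i + t := by omega
  simp only [chunk]
  rw [if_neg (by omega), if_neg (by omega), h1]
  simp only [h, true_and, P.payload_start_add w hi ht]
  simp

theorem pointer_lt_chunkLen {i t : ℕ} (hi : i ≤ P.num) (ht : t < P.ptr) :
    1 + i * P.ptr + t < P.chunkLen 0 := by
  have : i * P.ptr ≤ P.num * P.ptr := Nat.mul_le_mul_right _ hi
  simp only [chunkLen, add_mul]
  omega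

theorem payload_lt_chunkLen {w : ℕ → X} (h : P.Good 0 w) {i t : ℕ} (hi : i < P.num)
    (ht : t < P.codeLen (shift (i * P.sub) w)) :
    1 + (P.num + 1) * P.ptr + (P.start w i + t) < P.chunkLen 0 := by
  have h1 := P.start_mono w (show i + 1 ≤ P.num from hi)
  rw [start_succ] at h1
  simp only [Good] at h
  simp only [chunkLen]
  omega

theorem good_iff_of_chunk {k : ℕ} {w w' : ℕ → X}
    (h : Agree (P.chunkLen k) (P.chunk k w) (P.chunk k w')) : P.Good k w ↔ P.Good k w' := by
  have := h 0 (P.chunkLen_pos k)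
  simpa [chunk_flag] using this

theorem residue_of_good {k : ℕ} {w : ℕ → X} (h : P.Good k w) :
    P.residue k w = fun _ => P.blank := by
  cases k <;> simp [residue, h]

theorem residue_child_of_not_good {k : ℕ} {w : ℕ → X} (h : ¬ P.Good (k + 1) w) {i j : ℕ}
    (hj : j < P.blockLen k) :
    P.residue (k + 1) w (i * P.blockLen k + j) = P.residue k (shift (i * P.blockLen k) w) j := by
  have h2 : (i * P.blockLen k + j) / P.blockLen k = i := by
    rw [add_comm, Nat.add_mul_div_right _ _ (P.blockLen_pos k), Nat.div_eq_of_lt hj, zero_add]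
  have h3 : (i * P.blockLen k + j) % P.blockLen k = j := by
    rw [add_comm, Nat.add_mul_mod_self_right, Nat.mod_eq_of_lt hj]
  simp only [residue]
  rw [if_neg h, h2, h3]

theorem agree_blocks {k : ℕ} {w w' : ℕ → X}
    (h : ∀ i < P.arity k, Agree (P.blockLen k) (shift (i * P.blockLen k) w)
      (shift (i * P.blockLen k) w')) : Agree (P.blockLen (k + 1)) w w' := by
  intro j hj
  have h1 : j / P.blockLen k < P.arity k := by
    rw [Nat.div_lt_iff_lt_mul (P.blockLen_pos k)]; exact hj
  have h2 := h _ h1 _ (Nat.mod_lt j (P.blockLen_pos k))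
  have h3 : j / P.blockLen k * P.blockLen k + j % P.blockLen k = j := by
    rw [mul_comm]; exact Nat.div_add_mod _ _
  simpa [shift, h3] using h2

/-- In a good block of level `0` the pointers give the starts, consecutive starts give the code
lengths, and the payload then gives the ranks. Higher up, the residue of a child is blank if the
child is good, stands in the spare area if the parent is good, and is part of the parent's residue
otherwise; so the induction hypothesis always applies. -/
theorem agree_of_chunk_residue (k : ℕ) {w w' : ℕ → X}
    (hc : Agree (P.chunkLen k) (P.chunk k w) (P.chunk k w'))
    (hr : Agree (P.blockLen k) (P.residue k w) (P.residue k w')) :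
    Agree (P.blockLen k) w w' := by
  induction k generalizing w w' with
  | zero =>
    have hg := P.good_iff_of_chunk hc
    by_cases h : P.Good 0 w
    · have h' := hg.1 h
      have hs : ∀ i ≤ P.num, P.start w i = P.start w' i := by
        intro i hi
        refine Nat.eq_of_testBit_eq fun t => ?_
        by_cases ht : t < P.ptr
        · rw [← P.chunk_zero_pointer h hi ht, ← P.chunk_zero_pointer h' hi ht]
          exact hc _ (P.pointer_lt_chunkLen hi ht)
        · have hp : 2 ^ P.ptr ≤ 2 ^ t := Nat.pow_le_pow_right (by norm_num) (by omega)
          rw [Nat.testBit_lt_two_pow ((P.start_lt_of_good h hi).trans_le hp),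
            Nat.testBit_lt_two_pow ((P.start_lt_of_good h' hi).trans_le hp)]
      have hsub : ∀ i < P.num, Agree P.sub (shift (i * P.sub) w) (shift (i * P.sub) w') := by
        intro i hi
        have h1 := hs (i + 1) hi
        rw [start_succ, start_succ, hs i hi.le, Nat.add_left_cancel_iff] at h1
        refine P.subRank_inj (Nat.eq_of_testBit_eq fun t => ?_)
        by_cases ht : t < P.codeLen (shift (i * P.sub) w)
        · rw [← P.chunk_zero_payload h hi ht, ← P.chunk_zero_payload h' hi (h1 ▸ ht), ← hs i hi.le]
          exact hc _ (P.payload_lt_chunkLen h hi ht)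
        · rw [P.testBit_eq_false_of_codeLen_le (not_lt.1 ht),
            P.testBit_eq_false_of_codeLen_le (h1 ▸ not_lt.1 ht)]
      intro j hj
      have h1 : j / P.sub < P.num := by rwa [Nat.div_lt_iff_lt_mul P.sub_pos]
      have h2 := hsub _ h1 _ (Nat.mod_lt j P.sub_pos)
      have h3 : j / P.sub * P.sub + j % P.sub = j := by rw [mul_comm]; exact Nat.div_add_mod _ _
      simpa [shift, h3] using h2
    · intro j hj
      simpa [residue, h, mt hg.2 h] using hr j hj
  | succ k ih =>
    have hg := P.good_iff_of_chunk hc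
    have hchild : ∀ i < P.arity k, Agree (P.chunkLen k)
        (P.chunk k (shift (i * P.blockLen k) w)) (P.chunk k (shift (i * P.blockLen k) w')) := by
      intro i hi j hj
      rw [← P.chunk_child k w hi hj, ← P.chunk_child k w' hi hj]
      apply hc
      calc 1 + i * P.chunkLen k + j < 1 + (i + 1) * P.chunkLen k := by rw [add_mul]; omega
        _ ≤ 1 + P.arity k * P.chunkLen k := by
          have := Nat.mul_le_mul_right (P.chunkLen k) (show i + 1 ≤ P.arity k from hi); omega
        _ ≤ _ := by simp only [chunkLen]; omega
    refine P.agree_blocks fun i hi => ih (hchild i hi) fun t ht => ?_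
    have hgi := P.good_iff_of_chunk (hchild i hi)
    by_cases h : P.Good (k + 1) w
    · have h' := hg.1 h
      by_cases hb : P.Good k (shift (i * P.blockLen k) w)
      · rw [P.residue_of_good hb, P.residue_of_good (hgi.1 hb)]
      · have hb' := mt hgi.2 hb
        -- The spare bit set by the letter of `w` at `t` is also set for `w'`. As `w'` is good it
        -- has only one bad child, so the child responsible for this bit is the `i`-th.
        have key := hc (1 + P.arity k * P.chunkLen k +
          (t * P.width + P.sym (P.residue k (shift (i * P.blockLen k) w) t))) (by
            have h1 := P.sym_lt (P.residue k (shift (i * P.blockLen k) w) t)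
            have h2 : (t + 1) * P.width ≤ P.blockLen k * P.width := Nat.mul_le_mul_right _ ht
            rw [add_mul, mul_comm (P.blockLen k)] at h2
            simp only [chunkLen]
            omega)
        rw [P.chunk_area k w (P.sym_lt _), P.chunk_area k w' (P.sym_lt _),
          decide_eq_decide] at key
        obtain ⟨-, i', hi', hbi', he⟩ := key.1 ⟨h, i, hi, hb, rfl⟩
        obtain rfl : i' = i := h' i' hi' i hi hbi' hb'
        exact (P.sym_injective he).symm
    · have h' := mt hg.2 h
      rw [← P.residue_child_of_not_good h ht, ← P.residue_child_of_not_good h' ht]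
      apply hr
      calc i * P.blockLen k + t < (i + 1) * P.blockLen k := by rw [add_mul]; omega
        _ ≤ _ := Nat.mul_le_mul_right _ hi

theorem agree_of_chunk {k : ℕ} {w w' : ℕ → X} (hg : P.Good k w)
    (hc : Agree (P.chunkLen k) (P.chunk k w) (P.chunk k w')) : Agree (P.blockLen k) w w' := by
  refine P.agree_of_chunk_residue k hc ?_
  rw [P.residue_of_good hg, P.residue_of_good ((P.good_iff_of_chunk hc).1 hg)]
  exact fun _ _ => rfl

end Params

/-! ### Chunks inside a codeword and the algorithms that read and rewrite them -/

namespace Params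

variable {X : Type u} (P : Params X) {m : ℕ}

theorem sub_dvd_blockLen (k : ℕ) : P.sub ∣ P.blockLen k := by
  induction k with
  | zero => exact dvd_mul_left _ _
  | succ k ih => exact ih.mul_left _

theorem blockLen_zero_dvd (k : ℕ) : P.blockLen 0 ∣ P.blockLen k := by
  induction k with
  | zero => exact dvd_rfl
  | succ k ih => exact ih.mul_left _

/-- The codeword `c` contains, from address `a` on, the chunk of the level `k` block `w`. -/
def Holds (c : Fin m → Bool) (a k : ℕ) (w : ℕ → X) : Prop :=
  ∀ j < P.chunkLen k, extendBits c (a + j) = P.chunk k w j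

variable {P}

theorem Holds.child {c : Fin m → Bool} {a k : ℕ} {w : ℕ → X} (h : P.Holds c a (k + 1) w)
    {i : ℕ} (hi : i < P.arity k) :
    P.Holds c (a + 1 + i * P.chunkLen k) k (shift (i * P.blockLen k) w) := by
  intro j hj
  have := h (1 + i * P.chunkLen k + j) (by
    have h1 : (i + 1) * P.chunkLen k ≤ P.arity k * P.chunkLen k := Nat.mul_le_mul_right _ hi
    rw [add_mul] at h1
    simp only [chunkLen]
    omega)
  rw [P.chunk_child k w hi hj] at this
  rw [← this]
  congr 1
  ring

open Classical in
theorem Holds.flag {c : Fin m → Bool} {a k : ℕ} {w : ℕ → X} (h : P.Holds c a k w) :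
    extendBits c a = decide (P.Good k w) := by
  have := h 0 (P.chunkLen_pos k)
  rwa [add_zero, chunk_flag] at this

theorem Holds.agree_readRange {c : Fin m → Bool} {a k : ℕ} {w : ℕ → X} (h : P.Holds c a k w) :
    Agree (P.chunkLen k) (P.chunk k w) ((readRange m a (P.chunkLen k)).output c) := by
  intro j hj
  simp [output_readRange, hj, h j hj]

variable (P)

/-- The good block with the given chunk. -/
noncomputable def decodeChunk (k : ℕ) (f : ℕ → Bool) : ℕ → X :=
  @Classical.epsilon _ ⟨fun _ => P.blank⟩ fun w => P.Good k w ∧ Agree (P.chunkLen k) (P.chunk k w) f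

theorem agree_decodeChunk {k : ℕ} {w : ℕ → X} {f : ℕ → Bool} (hw : P.Good k w)
    (hf : Agree (P.chunkLen k) (P.chunk k w) f) : Agree (P.blockLen k) (P.decodeChunk k f) w := by
  obtain ⟨h1, h2⟩ := Classical.epsilon_spec (p := fun w => P.Good k w ∧
    Agree (P.chunkLen k) (P.chunk k w) f) ⟨w, hw, hf⟩
  exact P.agree_of_chunk h1 fun j hj => (h2 j hj).trans (hf j hj).symm

/-! #### Reading a sub-block -/

/-- The number with the given bits. -/
noncomputable def decodePointer (f : ℕ → Bool) : ℕ :=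
  Classical.epsilon fun v => v < 2 ^ P.ptr ∧ ∀ t < P.ptr, v.testBit t = f t

theorem decodePointer_eq {f : ℕ → Bool} {v : ℕ} (hv : v < 2 ^ P.ptr)
    (hf : ∀ t < P.ptr, v.testBit t = f t) : P.decodePointer f = v := by
  obtain ⟨h1, h2⟩ : P.decodePointer f < 2 ^ P.ptr ∧
      ∀ t < P.ptr, (P.decodePointer f).testBit t = f t :=
    Classical.epsilon_spec (p := fun v : ℕ => v < 2 ^ P.ptr ∧ ∀ t < P.ptr, v.testBit t = f t)
      ⟨v, hv, hf⟩
  refine Nat.eq_of_testBit_eq fun t => ?_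
  by_cases ht : t < P.ptr
  · exact (h2 t ht).trans (hf t ht).symm
  · have hp : 2 ^ P.ptr ≤ 2 ^ t := Nat.pow_le_pow_right (by norm_num) (by omega)
    rw [Nat.testBit_lt_two_pow (h1.trans_le hp), Nat.testBit_lt_two_pow (hv.trans_le hp)]

/-- A word whose first sub-block has a rank with the given bits. -/
noncomputable def decodeRank (f : ℕ → Bool) : ℕ → X :=
  @Classical.epsilon _ ⟨fun _ => P.blank⟩ fun w => ∀ t, (P.subRank w).testBit t = f t

theorem agree_decodeRank {f : ℕ → Bool} {w : ℕ → X} (hf : ∀ t, (P.subRank w).testBit t = f t) :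
    Agree P.sub (P.decodeRank f) w := by
  have h := Classical.epsilon_spec (p := fun w => ∀ t, (P.subRank w).testBit t = f t) ⟨w, hf⟩
  exact P.subRank_inj (Nat.eq_of_testBit_eq fun t => (h t).trans (hf t).symm)

/-- Read the `i`-th sub-block of the good level `0` block stored at `a`. -/
noncomputable def readPayload (m a i : ℕ) : ProbeTree m (ℕ → X) :=
  (readRange m (a + 1 + i * P.ptr) P.ptr).bind fun f =>
    (readRange m (a + 1 + (i + 1) * P.ptr) P.ptr).bind fun f' =>
      (readRange m (a + (1 + (P.num + 1) * P.ptr) + P.decodePointer f)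
        (P.decodePointer f' - P.decodePointer f)).bind fun g => .done (P.decodeRank g)

theorem decodePointer_readRange {c : Fin m → Bool} {a : ℕ} {w : ℕ → X} (h : P.Holds c a 0 w)
    (hg : P.Good 0 w) {i : ℕ} (hi : i ≤ P.num) :
    P.decodePointer ((readRange m (a + 1 + i * P.ptr) P.ptr).output c) = P.start w i := by
  refine P.decodePointer_eq (P.start_lt_of_good hg hi) fun t ht => ?_
  rw [output_readRange, ← P.chunk_zero_pointer hg hi ht, ← h _ (P.pointer_lt_chunkLen hi ht)]
  simp only [ht, if_true]
  congr 1
  ring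

theorem readPayload_spec {c : Fin m → Bool} {a : ℕ} {w : ℕ → X} (h : P.Holds c a 0 w)
    (hg : P.Good 0 w) {i : ℕ} (hi : i < P.num) :
    Agree P.sub ((P.readPayload m a i).output c) (shift (i * P.sub) w) ∧
    (P.readPayload m a i).numProbes c ≤ 2 * P.ptr + P.codeLen (shift (i * P.sub) w) := by
  have h1 := P.decodePointer_readRange h hg hi.le
  have h2 := P.decodePointer_readRange h hg (show i + 1 ≤ P.num from hi)
  have h3 : P.start w (i + 1) - P.start w i = P.codeLen (shift (i * P.sub) w) := by
    rw [start_succ]; omega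
  constructor
  · simp only [readPayload, ProbeTree.output_bind, h1, h2, h3, ProbeTree.output]
    refine P.agree_decodeRank fun t => ?_
    rw [output_readRange]
    by_cases ht : t < P.codeLen (shift (i * P.sub) w)
    · simp only [ht, if_true]
      rw [← P.chunk_zero_payload hg hi ht, ← h _ (P.payload_lt_chunkLen hg hi ht)]
      congr 1
      ring
    · simp only [ht, if_false]
      exact P.testBit_eq_false_of_codeLen_le (not_lt.1 ht)
  · simp only [readPayload, ProbeTree.numProbes_bind, h1, h2, h3, ProbeTree.numProbes]
    have e1 := numProbes_readRange_le c (a + 1 + i * P.ptr) P.ptr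
    have e2 := numProbes_readRange_le c (a + 1 + (i + 1) * P.ptr) P.ptr
    have e3 := numProbes_readRange_le c (a + (1 + (P.num + 1) * P.ptr) + P.start w i)
      (P.codeLen (shift (i * P.sub) w))
    omega

/-- Read the flag of the level `k` block stored at `a`, and the whole block if it is good. -/
noncomputable def tryRead (m k a : ℕ) : ProbeTree m (Option (ℕ → X)) :=
  (readBit m a).bind fun b =>
    if b then (readRange m a (P.chunkLen k)).bind fun f => .done (some (P.decodeChunk k f))
    else .done none

/-- Read the sub-block at position `o` of the level `k` block stored at `a`: find the smallest good
block around it. -/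
noncomputable def readSub (m : ℕ) : ℕ → ℕ → ℕ → ProbeTree m (Option (ℕ → X))
  | 0, a, o => (readBit m a).bind fun b =>
      if b then (P.readPayload m a (o / P.sub)).bind fun w => .done (some w) else .done none
  | k + 1, a, o =>
      (readSub m k (a + 1 + o / P.blockLen k * P.chunkLen k) (o % P.blockLen k)).bind fun r =>
        match r with
        | some w => .done (some w)
        | none => (P.tryRead m (k + 1) a).bind fun r => .done (r.map (shift o))

open Classical in
/-- A bound for the cost of reading a sub-block. -/
noncomputable def readCost : ℕ → (ℕ → X) → ℕ → ℕ
  | 0, w, o => 1 + 2 * P.ptr + P.codeLen (shift o w)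
  | k + 1, w, o => readCost k (shift (o / P.blockLen k * P.blockLen k) w) (o % P.blockLen k) +
      if P.Good k (shift (o / P.blockLen k * P.blockLen k) w) then 0 else 1 + P.chunkLen (k + 1)

theorem tryRead_spec {c : Fin m → Bool} {k a : ℕ} {w : ℕ → X} (h : P.Holds c a k w) :
    ((P.tryRead m k a).output c = none → ¬ P.Good k w) ∧
    (∀ v, (P.tryRead m k a).output c = some v → Agree (P.blockLen k) v w) ∧
    (P.tryRead m k a).numProbes c ≤ 1 + P.chunkLen k := by
  have e1 := numProbes_readBit_le c a
  by_cases hg : P.Good k w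
  · have hb : extendBits c a = true := by rw [h.flag]; simpa using hg
    simp only [tryRead, ProbeTree.output_bind, ProbeTree.numProbes_bind, output_readBit, hb,
      if_true, ProbeTree.output, ProbeTree.numProbes]
    refine ⟨by simp, ?_, ?_⟩
    · rintro v ⟨⟩
      exact P.agree_decodeChunk hg h.agree_readRange
    · have e2 := numProbes_readRange_le c a (P.chunkLen k)
      omega
  · have hb : extendBits c a = false := by rw [h.flag]; simpa using hg
    simp only [tryRead, ProbeTree.output_bind, ProbeTree.numProbes_bind, output_readBit, hb]
    refine ⟨fun _ => hg, ?_, ?_⟩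
    · simp [ProbeTree.output]
    · simp [ProbeTree.numProbes]; omega

/-- The answer `none` from the recursive call certifies that the child is bad. The attempt at the
present level can therefore be charged to that event alone, which is how `readCost` accounts for it.
-/
theorem readSub_spec (k : ℕ) {c : Fin m → Bool} {a o : ℕ} {w : ℕ → X} (h : P.Holds c a k w)
    (ho : o < P.blockLen k) (hd : P.sub ∣ o) :
    ((P.readSub m k a o).output c = none → ¬ P.Good k w) ∧
    (∀ v, (P.readSub m k a o).output c = some v → Agree P.sub v (shift o w)) ∧
    (P.readSub m k a o).numProbes c ≤ P.readCost k w o := by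
  induction k generalizing a o w with
  | zero =>
    have e1 := numProbes_readBit_le c a
    by_cases hg : P.Good 0 w
    · have hb : extendBits c a = true := by rw [h.flag]; simpa using hg
      have hi : o / P.sub < P.num := by rwa [Nat.div_lt_iff_lt_mul P.sub_pos]
      have := P.readPayload_spec h hg hi
      rw [Nat.div_mul_cancel hd] at this
      simp only [readSub, ProbeTree.output_bind, ProbeTree.numProbes_bind, output_readBit, hb,
        if_true, ProbeTree.output, ProbeTree.numProbes, readCost]
      refine ⟨by simp, ?_, by omega⟩
      rintro v ⟨⟩
      exact this.1
    · have hb : extendBits c a = false := by rw [h.flag]; simpa using hg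
      simp only [readSub, ProbeTree.output_bind, ProbeTree.numProbes_bind, output_readBit, hb,
        readCost]
      refine ⟨fun _ => hg, ?_, ?_⟩
      · simp [ProbeTree.output]
      · simp [ProbeTree.numProbes]; omega
  | succ k ih =>
    have hi : o / P.blockLen k < P.arity k := by
      rw [Nat.div_lt_iff_lt_mul (P.blockLen_pos k)]; exact ho
    obtain ⟨i1, i2, i3⟩ := ih (h.child hi) (Nat.mod_lt o (P.blockLen_pos k))
      ((Nat.dvd_mod_iff (P.sub_dvd_blockLen k)).2 hd)
    obtain ⟨t1, t2, t3⟩ := P.tryRead_spec h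
    simp only [readSub, ProbeTree.output_bind, ProbeTree.numProbes_bind, readCost]
    cases hr : (P.readSub m k (a + 1 + o / P.blockLen k * P.chunkLen k)
      (o % P.blockLen k)).output c with
    | some v =>
      simp only [ProbeTree.output, ProbeTree.numProbes]
      refine ⟨by simp, ?_, by omega⟩
      rintro v' ⟨⟩
      have := i2 v hr
      rwa [shift_shift, Nat.div_add_mod'] at this
    | none =>
      simp only [ProbeTree.output, ProbeTree.numProbes, ProbeTree.output_bind,
        ProbeTree.numProbes_bind]
      rw [if_neg (i1 hr)]
      refine ⟨fun hn => t1 (by simpa using hn), ?_, by omega⟩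
      intro v hv
      rw [Option.map_eq_some_iff] at hv
      obtain ⟨w', hw', rfl⟩ := hv
      -- Since `o` and the block length are multiples of `sub`, the whole sub-block lies inside the
      -- block.
      refine (t2 w' hw').shift ?_
      obtain ⟨x, rfl⟩ := hd
      obtain ⟨y, hy⟩ := P.sub_dvd_blockLen (k + 1)
      rw [hy] at ho ⊢
      have := lt_of_mul_lt_mul_left ho (Nat.zero_le _)
      rw [← Nat.mul_succ]
      exact Nat.mul_le_mul_left _ this

/-! #### Updating -/

/-- The word `w` with the letters prescribed by `π`. -/
def patched (π : ℕ → Option X) (w : ℕ → X) : ℕ → X := fun j => (π j).getD (w j)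

theorem shift_patched (o : ℕ) (π : ℕ → Option X) (w : ℕ → X) :
    shift o (patched π w) = patched (shift o π) (shift o w) := rfl

/-- Overwrite the addresses of the level `k` chunk at `a` with the chunk of `w`. -/
noncomputable def rewrite (k a : ℕ) (w : ℕ → X) (j : ℕ) : Option Bool :=
  if a ≤ j ∧ j < a + P.chunkLen k then some (P.chunk k w (j - a)) else none

open Classical in
/-- Update the level `k` block stored at `a`, if it is good before and after. -/
noncomputable def tryUpdate (m k a : ℕ) (π : ℕ → Option X) :
    ProbeTree m (Option (ℕ → Option Bool)) :=
  (readBit m a).bind fun b =>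
    if b then (readRange m a (P.chunkLen k)).bind fun f =>
      if P.Good k (patched π (P.decodeChunk k f)) then
        .done (some (P.rewrite k a (patched π (P.decodeChunk k f))))
      else .done none
    else .done none

/-- Update the smallest block around position `o` that is good before and after. -/
noncomputable def update (m : ℕ) :
    ℕ → ℕ → ℕ → (ℕ → Option X) → ProbeTree m (Option (ℕ → Option Bool))
  | 0, a, _, π => P.tryUpdate m 0 a π
  | k + 1, a, o, π =>
      (update m k (a + 1 + o / P.blockLen k * P.chunkLen k) (o % P.blockLen k)
        (shift (o / P.blockLen k * P.blockLen k) π)).bind fun r =>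
        match r with
        | some f => .done (some f)
        | none => P.tryUpdate m (k + 1) a π

open Classical in
/-- The outcome of `tryUpdate` when `w` is changed into `w'`. -/
noncomputable def blockWrites (k a : ℕ) (w w' : ℕ → X) : Option (ℕ → Option Bool) :=
  if P.Good k w ∧ P.Good k w' then some (P.rewrite k a w') else none

/-- The outcome of `update` when `w` is changed into `w'`. -/
noncomputable def writes : ℕ → ℕ → (ℕ → X) → (ℕ → X) → ℕ → Option (ℕ → Option Bool)
  | 0, a, w, w', _ => P.blockWrites 0 a w w'
  | k + 1, a, w, w', o =>
      match writes k (a + 1 + o / P.blockLen k * P.chunkLen k)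
        (shift (o / P.blockLen k * P.blockLen k) w) (shift (o / P.blockLen k * P.blockLen k) w')
        (o % P.blockLen k) with
      | some f => some f
      | none => P.blockWrites (k + 1) a w w'

open Classical in
/-- A bound for the cost of `update`, reads and writes. -/
noncomputable def updateCost : ℕ → (ℕ → X) → (ℕ → X) → ℕ → ℕ
  | 0, _, _, _ => 1 + 2 * P.chunkLen 0
  | k + 1, w, w', o =>
      updateCost k (shift (o / P.blockLen k * P.blockLen k) w)
        (shift (o / P.blockLen k * P.blockLen k) w') (o % P.blockLen k) +
      if P.Good k (shift (o / P.blockLen k * P.blockLen k) w) ∧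
        P.Good k (shift (o / P.blockLen k * P.blockLen k) w') then 0
      else 1 + 2 * P.chunkLen (k + 1)

/-- The number of addresses below `m` that are written. -/
def writeCount (m : ℕ) (f : ℕ → Option Bool) : ℕ :=
  (Finset.univ.filter fun j : Fin m => (f j).isSome = true).card

theorem writeCount_none : writeCount m (fun _ => none) = 0 := by
  simp [writeCount]

theorem writeCount_rewrite_le (k a : ℕ) (w : ℕ → X) :
    writeCount m (P.rewrite k a w) ≤ P.chunkLen k := by
  unfold writeCount
  calc _ ≤ (Finset.Ico a (a + P.chunkLen k)).card := by
        refine Finset.card_le_card_of_injOn (fun j : Fin m => (j : ℕ)) ?_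
          (fun i _ j _ h => Fin.ext h)
        intro j hj
        have hj' := (Finset.mem_filter.1 hj).2
        simp only [rewrite] at hj'
        split_ifs at hj' with h
        · simpa using h
        · cases hj'
    _ = _ := by simp

theorem patched_agree {N : ℕ} {π : ℕ → Option X} {w w' : ℕ → X} (h : Agree N w w') :
    Agree N (patched π w) (patched π w') := by
  intro j hj
  simp [patched, h j hj]

theorem rewrite_congr {k a : ℕ} {w w' : ℕ → X} (h : Agree (P.blockLen k) w w') :
    P.rewrite k a w = P.rewrite k a w' := by
  funext j
  simp only [rewrite]
  split_ifs with hj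
  · rw [P.chunk_congr k h _ (by omega)]
  · rfl

theorem tryUpdate_spec {c : Fin m → Bool} {k a : ℕ} {π : ℕ → Option X} {w : ℕ → X}
    (h : P.Holds c a k w) :
    (P.tryUpdate m k a π).output c = P.blockWrites k a w (patched π w) ∧
    (P.tryUpdate m k a π).numProbes c +
      writeCount m ((P.blockWrites k a w (patched π w)).getD fun _ => none) ≤
        1 + 2 * P.chunkLen k := by
  have e1 := numProbes_readBit_le c a
  have e2 := numProbes_readRange_le c a (P.chunkLen k)
  have e3 := P.writeCount_rewrite_le (m := m) k a (patched π w)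
  by_cases hg : P.Good k w
  · have hb : extendBits c a = true := by rw [h.flag]; simpa using hg
    have ha := patched_agree (π := π) (P.agree_decodeChunk hg h.agree_readRange)
    have hgood := P.good_congr k ha
    simp only [tryUpdate, ProbeTree.output_bind, ProbeTree.numProbes_bind, output_readBit, hb,
      if_true, blockWrites, P.rewrite_congr ha]
    by_cases hg' : P.Good k (patched π w)
    · rw [if_pos (hgood.2 hg'), if_pos ⟨hg, hg'⟩]
      refine ⟨rfl, ?_⟩
      simp only [ProbeTree.numProbes, Option.getD]
      omega
    · rw [if_neg (mt hgood.1 hg'), if_neg fun h => hg' h.2]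
      refine ⟨rfl, ?_⟩
      simp only [ProbeTree.numProbes, Option.getD, writeCount_none]
      omega
  · have hb : extendBits c a = false := by rw [h.flag]; simpa using hg
    simp [tryUpdate, ProbeTree.output_bind, ProbeTree.numProbes_bind, output_readBit, hb,
      blockWrites, hg, ProbeTree.output, ProbeTree.numProbes, writeCount_none]
    omega

theorem not_good_of_blockWrites {k a : ℕ} {w w' : ℕ → X} (h : P.blockWrites k a w w' = none) :
    ¬ (P.Good k w ∧ P.Good k w') := by
  intro hg
  simp [blockWrites, hg] at h

theorem not_good_of_writes (k : ℕ) {a o : ℕ} {w w' : ℕ → X} (h : P.writes k a w w' o = none) :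
    ¬ (P.Good k w ∧ P.Good k w') := by
  cases k with
  | zero => exact P.not_good_of_blockWrites h
  | succ k =>
    simp only [writes] at h
    split at h
    · cases h
    · exact P.not_good_of_blockWrites h

/-- The algorithm sees only `π` and the bits it reads, whereas `writes` refers to both words. They
agree because a good block is recovered from its chunk, so that the goodness and the chunk of the
patched block can be computed. -/
theorem update_spec (k : ℕ) {c : Fin m → Bool} {a o : ℕ} {π : ℕ → Option X} {w : ℕ → X}
    (h : P.Holds c a k w) (ho : o < P.blockLen k) :
    (P.update m k a o π).output c = P.writes k a w (patched π w) o ∧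
    (P.update m k a o π).numProbes c +
      writeCount m ((P.writes k a w (patched π w) o).getD fun _ => none) ≤
        P.updateCost k w (patched π w) o := by
  induction k generalizing a o w π with
  | zero => exact P.tryUpdate_spec h
  | succ k ih =>
    have hi : o / P.blockLen k < P.arity k := by
      rw [Nat.div_lt_iff_lt_mul (P.blockLen_pos k)]; exact ho
    obtain ⟨i1, i2⟩ := ih (π := shift (o / P.blockLen k * P.blockLen k) π) (h.child hi)
      (Nat.mod_lt o (P.blockLen_pos k))
    obtain ⟨t1, t2⟩ := P.tryUpdate_spec (π := π) h
    rw [← shift_patched] at i1 i2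
    simp only [update, ProbeTree.output_bind, ProbeTree.numProbes_bind, updateCost, writes, i1]
    cases hr : P.writes k (a + 1 + o / P.blockLen k * P.chunkLen k)
        (shift (o / P.blockLen k * P.blockLen k) w)
        (shift (o / P.blockLen k * P.blockLen k) (patched π w)) (o % P.blockLen k) with
    | some f =>
      rw [hr] at i2
      simp only [ProbeTree.output, ProbeTree.numProbes, true_and]
      omega
    | none =>
      rw [hr] at i2
      simp only [Option.getD_none, writeCount_none] at i2
      rw [if_neg (P.not_good_of_writes k hr)]
      exact ⟨t1, by dsimp only; omega⟩

/-- At whatever level a write is made, its bit is the one of the new chunk at that address, because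
the chunk of a child is a segment of the parent's. Writes caused by different positions thus never
conflict and may be merged arbitrarily. -/
theorem writes_sound (k : ℕ) {a o : ℕ} {w w' : ℕ → X} (ho : o < P.blockLen k)
    {f : ℕ → Option Bool} (h : P.writes k a w w' o = some f) {j : ℕ} {b : Bool}
    (hj : f j = some b) : a ≤ j ∧ j < a + P.chunkLen k ∧ b = P.chunk k w' (j - a) := by
  have key : ∀ k a w w', P.blockWrites k a w w' = some f →
      a ≤ j ∧ j < a + P.chunkLen k ∧ b = P.chunk k w' (j - a) := by
    intro k a w w' h
    simp only [blockWrites] at h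
    split_ifs at h with hg
    cases h
    simp only [rewrite] at hj
    split_ifs at hj with hr
    cases hj
    exact ⟨hr.1, hr.2, rfl⟩
  induction k generalizing a o w w' with
  | zero => exact key _ _ _ _ h
  | succ k ih =>
    simp only [writes] at h
    split at h
    · rename_i f' hf'
      cases h
      have hi : o / P.blockLen k < P.arity k := by
        rw [Nat.div_lt_iff_lt_mul (P.blockLen_pos k)]; exact ho
      obtain ⟨h1, h2, h3⟩ := ih (Nat.mod_lt o (P.blockLen_pos k)) hf'
      have h4 : (o / P.blockLen k + 1) * P.chunkLen k ≤ P.arity k * P.chunkLen k :=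
        Nat.mul_le_mul_right _ hi
      rw [add_mul] at h4
      refine ⟨by omega, by simp only [chunkLen]; omega, ?_⟩
      rw [h3, ← P.chunk_child k w' hi (by omega)]
      congr 1
      omega
    · exact key _ _ _ _ h

theorem writes_child {k a : ℕ} {w w' : ℕ → X} {i o : ℕ} (ho : o < P.blockLen k) :
    P.writes (k + 1) a w w' (i * P.blockLen k + o) =
      match P.writes k (a + 1 + i * P.chunkLen k) (shift (i * P.blockLen k) w)
        (shift (i * P.blockLen k) w') o with
      | some f => some f
      | none => P.blockWrites (k + 1) a w w' := by
  have h2 : (i * P.blockLen k + o) / P.blockLen k = i := by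
    rw [add_comm, Nat.add_mul_div_right _ _ (P.blockLen_pos k), Nat.div_eq_of_lt ho, zero_add]
  have h3 : (i * P.blockLen k + o) % P.blockLen k = o := by
    rw [add_comm, Nat.add_mul_mod_self_right, Nat.mod_eq_of_lt ho]
  simp only [writes, h2, h3]

/-- Every changed letter lies in a block that is good before and after. -/
def Resolved (k a : ℕ) (w w' : ℕ → X) : Prop :=
  ∀ o < P.blockLen k, w o ≠ w' o → (P.writes k a w w' o).isSome = true

theorem Resolved.child {P : Params X} {k a : ℕ} {w w' : ℕ → X} (h : P.Resolved (k + 1) a w w')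
    (hb : P.blockWrites (k + 1) a w w' = none) {i : ℕ} (hi : i < P.arity k) :
    P.Resolved k (a + 1 + i * P.chunkLen k) (shift (i * P.blockLen k) w)
      (shift (i * P.blockLen k) w') := by
  intro o ho hne
  have := h (i * P.blockLen k + o) (by
    calc i * P.blockLen k + o < (i + 1) * P.blockLen k := by rw [add_mul]; omega
      _ ≤ _ := Nat.mul_le_mul_right _ hi) hne
  rw [P.writes_child ho, hb] at this
  split at this
  · rename_i f hf
    rw [hf]; rfl
  · cases this

theorem resolved_of_good {k a : ℕ} {w w' : ℕ → X} (h : P.Good k w) (h' : P.Good k w') :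
    P.Resolved k a w w' := by
  intro o _ _
  by_contra hn
  exact P.not_good_of_writes k (Option.not_isSome_iff_eq_none.1 hn) ⟨h, h'⟩

theorem stable_of_good {k : ℕ} {w w' : ℕ → X} (hg : P.Good k w ∧ P.Good k w') :
    (P.Good k w ↔ P.Good k w') ∧ Agree (P.blockLen k) (P.residue k w) (P.residue k w') := by
  refine ⟨iff_of_true hg.1 hg.2, ?_⟩
  rw [P.residue_of_good hg.1, P.residue_of_good hg.2]
  exact fun _ _ => rfl

theorem exists_ne_of_chunk_ne {k : ℕ} {w w' : ℕ → X} {j : ℕ} (hj : j < P.chunkLen k)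
    (hne : P.chunk k w j ≠ P.chunk k w' j) : ∃ o < P.blockLen k, w o ≠ w' o := by
  by_contra! ha
  exact hne (P.chunk_congr k ha j hj)

/-- A block good on both sides has blank residues. Otherwise it makes no writes of its own, so each
changed letter is resolved inside a child. By induction the children keep goodness and residue, and
these determine goodness and residue of the block. -/
theorem Resolved.stable {P : Params X} (k : ℕ) {a : ℕ} {w w' : ℕ → X}
    (h : P.Resolved k a w w') :
    (P.Good k w ↔ P.Good k w') ∧ Agree (P.blockLen k) (P.residue k w) (P.residue k w') := by
  induction k generalizing a w w' with
  | zero =>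
    by_cases ha : Agree (P.blockLen 0) w w'
    · exact ⟨P.good_congr 0 ha, P.residue_congr 0 ha⟩
    · unfold Agree at ha
      push Not at ha
      obtain ⟨o, ho, hne⟩ := ha
      have := h o ho hne
      refine P.stable_of_good ?_
      simp only [writes, blockWrites] at this
      split_ifs at this with hg
      · exact hg
      · cases this
  | succ k ih =>
    by_cases hg : P.Good (k + 1) w ∧ P.Good (k + 1) w'
    · exact P.stable_of_good hg
    · have hb : P.blockWrites (k + 1) a w w' = none := by simp [blockWrites, hg]
      have hc : ∀ i < P.arity k, _ := fun i hi => ih (h.child hb hi)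
      have hG : P.Good (k + 1) w ↔ P.Good (k + 1) w' := by
        simp only [Good]
        refine forall_congr' fun i => forall_congr' fun hi => forall_congr' fun j =>
          forall_congr' fun hj => ?_
        rw [(hc i hi).1, (hc j hj).1]
      refine ⟨hG, fun j hj => ?_⟩
      have h1 : ¬ P.Good (k + 1) w := fun h1 => hg ⟨h1, hG.1 h1⟩
      have hi : j / P.blockLen k < P.arity k := by
        rw [Nat.div_lt_iff_lt_mul (P.blockLen_pos k)]; exact hj
      have := (hc _ hi).2 _ (Nat.mod_lt j (P.blockLen_pos k))
      simpa [residue, h1, mt hG.2 h1] using this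

/-- Either the block is good before and after and some changed letter is not resolved below it, in
which case the whole chunk is rewritten; or every child is resolved, hence stable, so the flag and
the spare area do not change and any changed bit lies in the chunk of a child. -/
theorem Resolved.covers {P : Params X} (k : ℕ) {a : ℕ} {w w' : ℕ → X}
    (h : P.Resolved k a w w') {j : ℕ} (hj : j < P.chunkLen k)
    (hne : P.chunk k w j ≠ P.chunk k w' j) :
    ∃ o < P.blockLen k, w o ≠ w' o ∧
      ∃ f, P.writes k a w w' o = some f ∧ (f (a + j)).isSome = true := by
  induction k generalizing a w w' j with
  | zero =>
    obtain ⟨o, ho, hwo⟩ := P.exists_ne_of_chunk_ne hj hne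
    have := h o ho hwo
    obtain ⟨f, hf⟩ := Option.isSome_iff_exists.1 this
    refine ⟨o, ho, hwo, f, hf, ?_⟩
    simp only [writes, blockWrites] at hf
    split_ifs at hf
    cases hf
    simp [rewrite, hj]
  | succ k ih =>
    by_cases hg : P.Good (k + 1) w ∧ P.Good (k + 1) w' ∧ ∃ i < P.arity k, ∃ o < P.blockLen k,
        shift (i * P.blockLen k) w o ≠ shift (i * P.blockLen k) w' o ∧
        P.writes k (a + 1 + i * P.chunkLen k) (shift (i * P.blockLen k) w)
          (shift (i * P.blockLen k) w') o = none
    · obtain ⟨h1, h2, i, hi, o, ho, hwo, hn⟩ := hg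
      refine ⟨i * P.blockLen k + o, ?_, hwo, P.rewrite (k + 1) a w', ?_, ?_⟩
      · calc i * P.blockLen k + o < (i + 1) * P.blockLen k := by rw [add_mul]; omega
          _ ≤ _ := Nat.mul_le_mul_right _ hi
      · rw [P.writes_child ho, hn]
        simp [blockWrites, h1, h2]
      · simp [rewrite, hj]
    · have hc : ∀ i < P.arity k, P.Resolved k (a + 1 + i * P.chunkLen k)
          (shift (i * P.blockLen k) w) (shift (i * P.blockLen k) w') := by
        intro i hi
        by_cases hgg : P.Good (k + 1) w ∧ P.Good (k + 1) w'
        · intro o ho hwo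
          by_contra hn
          exact hg ⟨hgg.1, hgg.2, i, hi, o, ho, hwo, Option.not_isSome_iff_eq_none.1 hn⟩
        · exact h.child (by simp [blockWrites, hgg]) hi
      by_contra hcon
      refine hne (P.chunk_succ_congr k (fun i hi => ((hc i hi).stable k).1)
        (fun i hi => ((hc i hi).stable k).2) hj fun i hi j' hj' he => ?_)
      by_contra hne'
      obtain ⟨o, ho, hwo, f, hf, hs⟩ := ih (hc i hi) hj' hne'
      refine hcon ⟨i * P.blockLen k + o, ?_, hwo, f, ?_, ?_⟩
      · calc i * P.blockLen k + o < (i + 1) * P.blockLen k := by rw [add_mul]; omega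
          _ ≤ _ := Nat.mul_le_mul_right _ hi
      · rw [P.writes_child ho, hf]
      · rwa [he, ← add_assoc, ← add_assoc]

/-- Only the level `0` block of the position `o` matters. -/
theorem writes_round (k : ℕ) {a o : ℕ} {w w' : ℕ → X} :
    P.writes k a w w' (o / P.blockLen 0 * P.blockLen 0) = P.writes k a w w' o := by
  induction k generalizing a o w w' with
  | zero => rfl
  | succ k ih =>
    obtain ⟨q, hq⟩ := P.blockLen_zero_dvd k
    have hq0 : 0 < q := by
      rcases Nat.eq_zero_or_pos q with rfl | h
      · have := P.blockLen_pos k; simp [hq] at this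
      · exact h
    have h0 := P.blockLen_pos 0
    have h1 : o / P.blockLen 0 * P.blockLen 0 / P.blockLen k = o / P.blockLen k := by
      rw [hq, ← Nat.div_div_eq_div_mul, Nat.mul_div_cancel _ h0, Nat.div_div_eq_div_mul]
    have h2 : o / P.blockLen 0 * P.blockLen 0 % P.blockLen k =
        o % P.blockLen k / P.blockLen 0 * P.blockLen 0 := by
      rw [hq, Nat.mod_mul_right_div_self, mul_comm (P.blockLen 0) q, Nat.mul_mod_mul_right]
    simp only [writes, h1, h2, ih]

end Params

/-! ### Expectations over i.i.d. words -/

section Expectation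

variable {X : Type u} [Fintype X] (p : PMF X) {ι κ μ : Type*} [Fintype ι] [DecidableEq ι]
  [Fintype κ] [DecidableEq κ] [Fintype μ] [DecidableEq μ]

/-- The expectation of `f`, when the letters indexed by `ι` are i.i.d. with law `p`. -/
noncomputable def Ex (f : (ι → X) → ℝ≥0∞) : ℝ≥0∞ := ∑ x : ι → X, (∏ i, p (x i)) * f x

theorem Ex_mono {f g : (ι → X) → ℝ≥0∞} (h : ∀ x, f x ≤ g x) : Ex p f ≤ Ex p g :=
  Finset.sum_le_sum fun x _ => by gcongr; exact h x

theorem Ex_congr {f g : (ι → X) → ℝ≥0∞} (h : ∀ x, f x = g x) : Ex p f = Ex p g := by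
  rw [funext h]

theorem Ex_add (f g : (ι → X) → ℝ≥0∞) : Ex p (fun x => f x + g x) = Ex p f + Ex p g := by
  simp [Ex, mul_add, Finset.sum_add_distrib]

theorem Ex_const_mul (c : ℝ≥0∞) (f : (ι → X) → ℝ≥0∞) :
    Ex p (fun x => c * f x) = c * Ex p f := by
  simp only [Ex, Finset.mul_sum]
  exact Finset.sum_congr rfl fun x _ => by ring

theorem Ex_mul_const (c : ℝ≥0∞) (f : (ι → X) → ℝ≥0∞) :
    Ex p (fun x => f x * c) = Ex p f * c := by
  simp only [mul_comm _ c, Ex_const_mul]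

theorem Ex_finset_sum {σ : Type*} (s : Finset σ) (f : σ → (ι → X) → ℝ≥0∞) :
    Ex p (fun x => ∑ i ∈ s, f i x) = ∑ i ∈ s, Ex p (f i) := by
  simp only [Ex, Finset.mul_sum]
  exact Finset.sum_comm

theorem sum_pmf : ∑ a, p a = 1 := by
  rw [← tsum_fintype (L := SummationFilter.unconditional X)]; exact p.tsum_coe

theorem Ex_prod (f : ι → X → ℝ≥0∞) :
    Ex p (fun x => ∏ i, f i (x i)) = ∏ i, ∑ a, p a * f i a := by
  simp only [Ex, ← Finset.prod_mul_distrib]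
  rw [Finset.prod_univ_sum]
  simp [Fintype.piFinset_univ]

theorem Ex_one : Ex p (fun _ : ι → X => 1) = 1 := by
  have := Ex_prod p (fun (_ : ι) (_ : X) => (1 : ℝ≥0∞))
  simpa [sum_pmf] using this

theorem Ex_const (c : ℝ≥0∞) : Ex p (fun _ : ι → X => c) = c := by
  have := Ex_const_mul p c (fun _ : ι → X => 1)
  simpa [Ex_one] using this

theorem Ex_equiv (e : κ ≃ ι) (f : (κ → X) → ℝ≥0∞) :
    Ex p (fun x : ι → X => f (x ∘ e)) = Ex p f := by
  refine Fintype.sum_equiv (Equiv.arrowCongr e.symm (Equiv.refl X)) _ _ fun x => ?_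
  congr 1
  exact (Fintype.prod_equiv e _ _ fun i => by simp [Equiv.arrowCongr]).symm

theorem Ex_sum_type (f : (κ ⊕ μ → X) → ℝ≥0∞) :
    Ex p f = Ex p fun u : κ → X => Ex p fun v : μ → X => f (Sum.elim u v) := by
  simp only [Ex, Finset.mul_sum]
  rw [← Fintype.sum_prod_type']
  refine Fintype.sum_equiv (Equiv.sumArrowEquivProdArrow κ μ X) _ _ fun x => ?_
  simp [mul_assoc, Fintype.prod_sum_type, Equiv.sumArrowEquivProdArrow]

/-- Marginals of an i.i.d. family are i.i.d. -/
theorem Ex_comp {φ : κ → ι} (hφ : Function.Injective φ) (f : (κ → X) → ℝ≥0∞) :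
    Ex p (fun x : ι → X => f (x ∘ φ)) = Ex p f := by
  classical
  let e : κ ⊕ {i // i ∉ Set.range φ} ≃ ι :=
    ((Equiv.ofInjective φ hφ).sumCongr (Equiv.refl _)).trans
      (Equiv.sumCompl (· ∈ Set.range φ))
  have he : ∀ k, e (Sum.inl k) = φ k := fun k => rfl
  have h1 := Ex_equiv p e (fun y : κ ⊕ {i // i ∉ Set.range φ} → X => f (y ∘ Sum.inl))
  have h2 : ∀ x : ι → X, (x ∘ e) ∘ Sum.inl = x ∘ φ := fun x => by funext k; simp [he]
  simp only [h2] at h1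
  rw [h1, Ex_sum_type]
  simp [Ex_const, Sum.elim_comp_inl]

/-- The finite word `u`, continued by `b`. -/
def pad (b : X) {N : ℕ} (u : Fin N → X) : ℕ → X := fun j => if h : j < N then u ⟨j, h⟩ else b

/-- The law of a window of an i.i.d. family. -/
theorem Ex_window (b : X) {N o : ℕ} {ψ : ℕ → ι} (hψ : Set.InjOn ψ (Set.Ico o (o + N)))
    {f : (ℕ → X) → ℝ≥0∞} (hf : ∀ w w', Agree N w w' → f w = f w') :
    Ex p (fun x : ι → X => f (shift o (x ∘ ψ))) = Ex p fun u : Fin N → X => f (pad b u) := by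
  have hinj : Function.Injective fun j : Fin N => ψ (o + j) := by
    intro i j hij
    have := hψ (by simp) (by simp) hij
    exact Fin.ext (by omega)
  rw [← Ex_comp p hinj]
  refine Ex_congr p fun x => hf _ _ fun j hj => ?_
  simp [shift, pad, hj]

/-- Disjoint windows are independent. -/
theorem Ex_two_windows (b : X) {N o o' : ℕ} {ψ : ℕ → ι}
    (hψ : Set.InjOn ψ (Set.Ico o (o + N) ∪ Set.Ico o' (o' + N)))
    (hoo' : Disjoint (Set.Ico o (o + N)) (Set.Ico o' (o' + N)))
    {f : (ℕ → X) → ℝ≥0∞} (hf : ∀ w w', Agree N w w' → f w = f w') :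
    Ex p (fun x : ι → X => f (shift o (x ∘ ψ)) * f (shift o' (x ∘ ψ))) =
      (Ex p fun u : Fin N → X => f (pad b u)) ^ 2 := by
  have hinj : Function.Injective
      (Sum.elim (fun j : Fin N => ψ (o + j)) (fun j : Fin N => ψ (o' + j))) := by
    refine Function.Injective.sumElim ?_ ?_ ?_
    · intro i j hij
      have := hψ (Or.inl (by simp)) (Or.inl (by simp)) hij
      exact Fin.ext (by omega)
    · intro i j hij
      have := hψ (Or.inr (by simp)) (Or.inr (by simp)) hij
      exact Fin.ext (by omega)
    · intro i j hij
      have := hψ (Or.inl (by simp)) (Or.inr (by simp)) hij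
      exact (Set.disjoint_left.1 hoo' (show o + (i : ℕ) ∈ _ by simp) (by rw [this]; simp)).elim
  have key := Ex_comp p hinj (fun y : Fin N ⊕ Fin N → X =>
    f (pad b (y ∘ Sum.inl)) * f (pad b (y ∘ Sum.inr)))
  rw [Ex_sum_type] at key
  simp only [Sum.elim_comp_inl, Sum.elim_comp_inr, Ex_const_mul, Ex_mul_const] at key
  rw [pow_two, ← key]
  refine Ex_congr p fun x => ?_
  congr 1
  · exact hf _ _ fun j hj => by simp [shift, pad, hj]
  · exact hf _ _ fun j hj => by simp [shift, pad, hj]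

end Expectation

/-! ### Probabilities of bad blocks and expected costs -/

namespace Params

variable {X : Type u} (P : Params X)

open Classical in
/-- The indicator function of the bad blocks. -/
noncomputable def badInd (k : ℕ) (w : ℕ → X) : ℝ≥0∞ := if P.Good k w then 0 else 1

theorem badInd_congr (k : ℕ) (w w' : ℕ → X) (h : Agree (P.blockLen k) w w') :
    P.badInd k w = P.badInd k w' := by
  by_cases hg : P.Good k w
  · simp [badInd, hg, (P.good_congr k h).1 hg]
  · simp [badInd, hg, mt (P.good_congr k h).2 hg]

theorem badInd_succ_le (k : ℕ) (w : ℕ → X) :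
    P.badInd (k + 1) w ≤ ∑ i ∈ Finset.range (P.arity k), ∑ j ∈ Finset.range (P.arity k),
      if i = j then 0 else
        P.badInd k (shift (i * P.blockLen k) w) * P.badInd k (shift (j * P.blockLen k) w) := by
  by_cases h : P.Good (k + 1) w
  · simp [badInd, h]
  · have h' := h
    simp only [Good] at h'
    push Not at h'
    obtain ⟨i, hi, j, hj, hbi, hbj, hij⟩ := h'
    calc P.badInd (k + 1) w = if i = j then 0 else
        P.badInd k (shift (i * P.blockLen k) w) * P.badInd k (shift (j * P.blockLen k) w) := by
          simp [badInd, h, hij, hbi, hbj]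
      _ ≤ _ := (Finset.single_le_sum
          (f := fun j => if i = j then 0 else P.badInd k (shift (i * P.blockLen k) w) *
            P.badInd k (shift (j * P.blockLen k) w)) (fun _ _ => zero_le)
          (Finset.mem_range.2 hj)).trans (Finset.single_le_sum
          (f := fun i => ∑ j ∈ Finset.range (P.arity k), if i = j then 0 else
            P.badInd k (shift (i * P.blockLen k) w) * P.badInd k (shift (j * P.blockLen k) w))
          (fun _ _ => zero_le) (Finset.mem_range.2 hi))

theorem injOn_child {ι : Type*} {k o r : ℕ} {ψ : ℕ → ι}
    (hψ : Set.InjOn ψ (Set.Ico o (o + P.blockLen (k + 1)))) (hr : r < P.blockLen (k + 1)) :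
    Set.InjOn ψ (Set.Ico (o + r / P.blockLen k * P.blockLen k)
      (o + r / P.blockLen k * P.blockLen k + P.blockLen k)) := by
  refine hψ.mono (Set.Ico_subset_Ico (Nat.le_add_right _ _) ?_)
  have h1 : r / P.blockLen k < P.arity k := by
    rw [Nat.div_lt_iff_lt_mul (P.blockLen_pos k)]; exact hr
  have h2 : (r / P.blockLen k + 1) * P.blockLen k ≤ P.blockLen (k + 1) :=
    Nat.mul_le_mul_right _ h1
  rw [add_mul] at h2
  omega

variable [Fintype X] (p : PMF X)

/-- The probability that a block is bad. -/
noncomputable def badProb (k : ℕ) : ℝ≥0∞ :=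
  Ex p fun u : Fin (P.blockLen k) → X => P.badInd k (pad P.blank u)

/-- The expected code length of a sub-block. -/
noncomputable def meanLen : ℝ≥0∞ :=
  Ex p fun u : Fin P.sub → X => (P.codeLen (pad P.blank u) : ℝ≥0∞)

variable {ι : Type*} [Fintype ι] [DecidableEq ι]

theorem Ex_badInd (k : ℕ) {o : ℕ} {ψ : ℕ → ι}
    (hψ : Set.InjOn ψ (Set.Ico o (o + P.blockLen k))) :
    Ex p (fun x : ι → X => P.badInd k (shift o (x ∘ ψ))) = P.badProb p k :=
  Ex_window p P.blank hψ (P.badInd_congr k)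

/-- Union bound over pairs of distinct children; their windows are disjoint, so a pair is bad with
probability `badProb k ^ 2`. This squaring drives the doubly exponential decay. -/
theorem badProb_succ_le (k : ℕ) :
    P.badProb p (k + 1) ≤ (P.arity k : ℝ≥0∞) ^ 2 * P.badProb p k ^ 2 := by
  let ψ : ℕ → Fin (P.blockLen (k + 1)) :=
    fun j => if h : j < P.blockLen (k + 1) then ⟨j, h⟩ else ⟨0, P.blockLen_pos _⟩
  have hψ : ∀ j j', j < P.blockLen (k + 1) → j' < P.blockLen (k + 1) → ψ j = ψ j' → j = j' := by
    intro j j' hj hj' h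
    simpa [ψ, hj, hj'] using h
  have hlt : ∀ i < P.arity k, ∀ j ∈ Set.Ico (i * P.blockLen k) (i * P.blockLen k + P.blockLen k),
      j < P.blockLen (k + 1) := by
    intro i hi j hj
    calc j < (i + 1) * P.blockLen k := by rw [add_mul, one_mul]; exact hj.2
      _ ≤ _ := Nat.mul_le_mul_right _ hi
  have h0 := P.Ex_badInd p (k + 1) (o := 0) (ψ := ψ)
    (fun j hj j' hj' h => hψ j j' (by simpa using hj) (by simpa using hj') h)
  rw [← h0]
  have hz : ∀ w : ℕ → X, shift 0 w = w := fun w => by funext j; simp [shift]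
  simp only [hz]
  refine (Ex_mono p fun x => P.badInd_succ_le k _).trans ?_
  rw [Ex_finset_sum]
  simp only [Ex_finset_sum]
  have key : ∀ i ∈ Finset.range (P.arity k), ∀ j ∈ Finset.range (P.arity k),
      (Ex p fun x : Fin (P.blockLen (k + 1)) → X => if i = j then 0 else
        P.badInd k (shift (i * P.blockLen k) (x ∘ ψ)) *
          P.badInd k (shift (j * P.blockLen k) (x ∘ ψ))) ≤ P.badProb p k ^ 2 := by
    intro i hi j hj
    rw [Finset.mem_range] at hi hj
    split_ifs with hij
    · simp [Ex_const]
    · refine (Ex_two_windows p P.blank ?_ ?_ (P.badInd_congr k)).le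
      · rintro t (ht | ht) t' (ht' | ht') h
        all_goals exact hψ t t' (hlt _ ‹_› _ ht) (hlt _ ‹_› _ ht') h
      · rw [Set.disjoint_left]
        rintro t ⟨h1, h2⟩ ⟨h3, h4⟩
        have e1 : i < j + 1 := Nat.lt_of_mul_lt_mul_right (a := P.blockLen k) (by
          rw [add_mul, one_mul]; omega)
        have e2 : j < i + 1 := Nat.lt_of_mul_lt_mul_right (a := P.blockLen k) (by
          rw [add_mul, one_mul]; omega)
        omega
  refine (Finset.sum_le_sum fun i hi => Finset.sum_le_sum fun j hj => key i hi j hj).trans ?_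
  simp only [Finset.sum_const, Finset.card_range, nsmul_eq_mul]
  rw [pow_two (P.arity k : ℝ≥0∞), mul_assoc]

/-- Level `j + 1` is paid for only if the surrounding block of level `j` is bad. By linearity, no
independence between levels is needed. -/
theorem Ex_readCost_le (k : ℕ) {o r : ℕ} {ψ : ℕ → ι}
    (hψ : Set.InjOn ψ (Set.Ico o (o + P.blockLen k))) (hr : r < P.blockLen k) (hd : P.sub ∣ r) :
    Ex p (fun x : ι → X => (P.readCost k (shift o (x ∘ ψ)) r : ℝ≥0∞)) ≤
      (1 + 2 * P.ptr : ℕ) + P.meanLen p +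
        ∑ j ∈ Finset.range k, P.badProb p j * (1 + P.chunkLen (j + 1) : ℕ) := by
  induction k generalizing o r with
  | zero =>
    simp only [readCost, Nat.cast_add, Ex_add, Finset.range_zero, Finset.sum_empty, add_zero, Ex_const]
    gcongr
    simp only [shift_shift]
    refine (Ex_window p P.blank (N := P.sub) (hψ.mono ?_) (f := fun w => (P.codeLen w : ℝ≥0∞))
      fun w w' h => ?_).le
    · refine Set.Ico_subset_Ico (Nat.le_add_right _ _) ?_
      obtain ⟨x, rfl⟩ := hd
      obtain ⟨y, hy⟩ := P.sub_dvd_blockLen 0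
      rw [hy] at hr ⊢
      have := Nat.mul_le_mul_left P.sub (Nat.succ_le_of_lt (lt_of_mul_lt_mul_left hr (Nat.zero_le _)))
      rw [Nat.mul_succ] at this
      omega
    · simp only [codeLen, P.subRank_congr h]
  | succ k ih =>
    have hψ' := P.injOn_child hψ hr
    have := ih hψ' (Nat.mod_lt r (P.blockLen_pos k))
      ((Nat.dvd_mod_iff (P.sub_dvd_blockLen k)).2 hd)
    rw [Finset.sum_range_succ, ← add_assoc]
    refine le_trans ?_ (add_le_add this
      (le_of_eq (congrArg (· * _) (P.Ex_badInd p k hψ'))))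
    rw [← Ex_mul_const, ← Ex_add]
    refine Ex_mono p fun x => ?_
    by_cases hg : P.Good k (shift (o + r / P.blockLen k * P.blockLen k) (x ∘ ψ))
    · simp [readCost, shift_shift, badInd, hg]
    · simp [readCost, shift_shift, badInd, hg]

/-- Level `j + 1` is paid for if the old or the new block of level `j` is bad, whence the factor
`2`. Only the marginal laws of the two blocks enter, so `ψ` and `ψ'` may share letters. -/
theorem Ex_updateCost_le (k : ℕ) {o r : ℕ} {ψ ψ' : ℕ → ι}
    (hψ : Set.InjOn ψ (Set.Ico o (o + P.blockLen k)))
    (hψ' : Set.InjOn ψ' (Set.Ico o (o + P.blockLen k))) (hr : r < P.blockLen k) :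
    Ex p (fun x : ι → X =>
      (P.updateCost k (shift o (x ∘ ψ)) (shift o (x ∘ ψ')) r : ℝ≥0∞)) ≤
      (1 + 2 * P.chunkLen 0 : ℕ) +
        ∑ j ∈ Finset.range k, 2 * P.badProb p j * (1 + 2 * P.chunkLen (j + 1) : ℕ) := by
  induction k generalizing o r with
  | zero => simp only [updateCost, Ex_const]; simp
  | succ k ih =>
    have h1 := P.injOn_child hψ hr
    have h2 := P.injOn_child hψ' hr
    have := ih h1 h2 (Nat.mod_lt r (P.blockLen_pos k))
    rw [Finset.sum_range_succ, ← add_assoc, two_mul (P.badProb p k)]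
    refine le_trans ?_ (add_le_add this (le_of_eq (congrArg (· * _)
      (congrArg₂ (· + ·) (P.Ex_badInd p k h1) (P.Ex_badInd p k h2)))))
    rw [← Ex_add p (fun x : ι → X => P.badInd k _), ← Ex_mul_const, ← Ex_add]
    refine Ex_mono p fun x => ?_
    by_cases hg : P.Good k (shift (o + r / P.blockLen k * P.blockLen k) (x ∘ ψ))
    · by_cases hg' : P.Good k (shift (o + r / P.blockLen k * P.blockLen k) (x ∘ ψ'))
      · simp [updateCost, shift_shift, badInd, hg, hg']
      · simp [updateCost, shift_shift, badInd, hg, hg']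
    · by_cases hg' : P.Good k (shift (o + r / P.blockLen k * P.blockLen k) (x ∘ ψ'))
      · simp [updateCost, shift_shift, badInd, hg, hg']
      · simp only [updateCost, shift_shift, badInd, hg, hg', false_and, if_false]
        push_cast
        gcongr
        exact le_mul_of_one_le_left zero_le (by norm_num)

end Params

/-! ### The multilevel scheme for words of arbitrary length -/

/-- The letter of a word of length `n` at the virtual position `j`; the virtual positions from `n`
on repeat the letters that are `B` positions earlier. -/
def wrap {n : ℕ} (hn : 0 < n) (B j : ℕ) : Fin n :=
  if h : j < n then ⟨j, h⟩ else ⟨(j - B) % n, Nat.mod_lt _ hn⟩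

theorem add_div_le (a b c : ℕ) : (a + b) / c ≤ a / c + b / c + 1 := by
  rcases Nat.eq_zero_or_pos c with rfl | hc
  · simp
  · rw [Nat.add_div hc]
    split_ifs <;> omega

theorem wrap_of_lt {n : ℕ} (hn : 0 < n) (B : ℕ) {j : ℕ} (h : j < n) : wrap hn B j = ⟨j, h⟩ := by
  simp [wrap, h]

theorem wrap_val_of_le {n : ℕ} (hn : 0 < n) {B j : ℕ} (h : n ≤ j) (h' : j < n + B) :
    (wrap hn B j : ℕ) = j - B := by
  rw [wrap, dif_neg (by omega)]
  exact Nat.mod_eq_of_lt (by omega)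

/-- The last block may stick out of the word. Its positions from `n` on repeat letters `B` places
earlier, which lie before the start `o` of the block; so the letters of a block stay distinct, and
every block has the law of an i.i.d. word. -/
theorem wrap_injOn {n : ℕ} (hn : 0 < n) {B o : ℕ} (hB : B ≤ n) (ho : o + B < n + B) :
    Set.InjOn (wrap hn B) (Set.Ico o (o + B)) := by
  intro j hj j' hj' h
  have h := congrArg Fin.val h
  simp only [Set.mem_Ico] at hj hj'
  by_cases h1 : j < n <;> by_cases h2 : j' < n
  · simpa [wrap_of_lt, h1, h2] using h
  · rw [wrap_of_lt hn B h1, wrap_val_of_le hn (by omega) (by omega)] at h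
    simp only at h
    omega
  · rw [wrap_of_lt hn B h2, wrap_val_of_le hn (by omega) (by omega)] at h
    simp only at h
    omega
  · rw [wrap_val_of_le hn (by omega) (by omega), wrap_val_of_le hn (by omega) (by omega)] at h
    omega

namespace Params

variable {X : Type u} (P : Params X) {K n m : ℕ}

/-- The number of blocks of level `K` that cover `n` letters. -/
def topCount (K n : ℕ) : ℕ := (n + P.blockLen K - 1) / P.blockLen K

theorem le_topCount_mul : n ≤ P.topCount K n * P.blockLen K := by
  have hB := P.blockLen_pos K
  have h1 := Nat.div_add_mod' (n + P.blockLen K - 1) (P.blockLen K)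
  have h2 := Nat.mod_lt (n + P.blockLen K - 1) hB
  unfold topCount
  omega

theorem topCount_mul_lt : P.topCount K n * P.blockLen K < n + P.blockLen K := by
  have hB := P.blockLen_pos K
  have h1 := Nat.div_mul_le_self (n + P.blockLen K - 1) (P.blockLen K)
  unfold topCount
  omega

/-- The word of length `n` as a stream in which the blocks of level `K` can be read. -/
def stream (K : ℕ) (hn : 0 < n) (x : Fin n → X) : ℕ → X := x ∘ wrap hn (P.blockLen K)

theorem wrap_injOn_block (hn : 0 < n) (hK : P.blockLen K ≤ n) {q : ℕ} (hq : q < P.topCount K n) :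
    Set.InjOn (wrap hn (P.blockLen K))
      (Set.Ico (q * P.blockLen K) (q * P.blockLen K + P.blockLen K)) := by
  refine wrap_injOn hn hK ?_
  have h1 : (q + 1) * P.blockLen K ≤ P.topCount K n * P.blockLen K := Nat.mul_le_mul_right _ hq
  have h2 := P.topCount_mul_lt (K := K) (n := n)
  rw [add_mul] at h1
  omega

/-- The codeword of a word. -/
noncomputable def encode (K m : ℕ) (hn : 0 < n) (x : Fin n → X) : Fin m → Bool := fun j =>
  if (j : ℕ) < P.topCount K n * P.chunkLen K then
    P.chunk K (shift (j / P.chunkLen K * P.blockLen K) (P.stream K hn x)) (j % P.chunkLen K)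
  else false

/-- All blocks of level `K` of the word are good. -/
def GoodWord (K : ℕ) (hn : 0 < n) (x : Fin n → X) : Prop :=
  ∀ q < P.topCount K n, P.Good K (shift (q * P.blockLen K) (P.stream K hn x))

variable {hn : 0 < n}

theorem holds_encode (hm : P.topCount K n * P.chunkLen K ≤ m) (x : Fin n → X) {q : ℕ}
    (hq : q < P.topCount K n) :
    P.Holds (P.encode K m hn x) (q * P.chunkLen K) K
      (shift (q * P.blockLen K) (P.stream K hn x)) := by
  intro j hj
  have h1 : (q + 1) * P.chunkLen K ≤ P.topCount K n * P.chunkLen K := Nat.mul_le_mul_right _ hq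
  rw [add_mul] at h1
  have h2 : (q * P.chunkLen K + j) / P.chunkLen K = q := by
    rw [add_comm, Nat.add_mul_div_right _ _ (P.chunkLen_pos K), Nat.div_eq_of_lt hj, zero_add]
  have h3 : (q * P.chunkLen K + j) % P.chunkLen K = j := by
    rw [add_comm, Nat.add_mul_mod_self_right, Nat.mod_eq_of_lt hj]
  rw [extendBits, dif_pos (by omega)]
  simp only [encode]
  rw [if_pos (by omega), h2, h3]

theorem eq_of_encode_eq (hm : P.topCount K n * P.chunkLen K ≤ m) {x x' : Fin n → X}
    (hx : P.GoodWord K hn x) (h : P.encode K m hn x = P.encode K m hn x') : x = x' := by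
  funext i
  have hq : (i : ℕ) / P.blockLen K < P.topCount K n := by
    rw [Nat.div_lt_iff_lt_mul (P.blockLen_pos K)]
    exact i.isLt.trans_le P.le_topCount_mul
  have := P.agree_of_chunk (hx _ hq)
    (w' := shift ((i : ℕ) / P.blockLen K * P.blockLen K) (P.stream K hn x'))
    (fun j hj => by rw [← P.holds_encode hm x hq j hj, h, P.holds_encode hm x' hq j hj])
    _ (Nat.mod_lt (i : ℕ) (P.blockLen_pos K))
  simpa [shift, Nat.div_add_mod', stream, wrap_of_lt] using this

open Classical in
/-- The multilevel scheme. The word `g` is the default output of the decoder. -/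
noncomputable def scheme (K m : ℕ) (hn : 0 < n) (g : Fin n → X) : Scheme X n m where
  enc := P.encode K m hn
  dec c := if h : ∃ x, P.GoodWord K hn x ∧ P.encode K m hn x = c then h.choose else g

/-- The default word has to be good. A bad default could be returned for its own codeword and count
as recovered, and correctness would be owed on a word that the local algorithms may fail to handle.
-/
theorem recovers_iff (hm : P.topCount K n * P.chunkLen K ≤ m) {g : Fin n → X}
    (hg : P.GoodWord K hn g) (x : Fin n → X) :
    (P.scheme K m hn g).Recovers x ↔ P.GoodWord K hn x := by
  constructor
  · intro h
    simp only [Scheme.Recovers, scheme] at h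
    split_ifs at h with hx
    · exact h ▸ hx.choose_spec.1
    · exact h ▸ hg
  · intro h
    have hx : ∃ y, P.GoodWord K hn y ∧ P.encode K m hn y = P.encode K m hn x := ⟨x, h, rfl⟩
    simp only [Scheme.Recovers, scheme]
    rw [dif_pos hx]
    exact P.eq_of_encode_eq hm hx.choose_spec.1 hx.choose_spec.2

/-! #### The local decoder -/

/-- Read the sub-block with index `κ`. -/
noncomputable def readIndex (K m κ : ℕ) : ProbeTree m (ℕ → X) :=
  (P.readSub m K (κ * P.sub / P.blockLen K * P.chunkLen K) (κ * P.sub % P.blockLen K)).bind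
    fun r => .done (r.getD fun _ => P.blank)

/-- Read the sub-blocks that meet a fragment. -/
noncomputable def readFragment (K m s i : ℕ) : ProbeTree m (Fin s → X) :=
  (gather (fun _ => P.blank) (P.readIndex K m) (i / P.sub)
    ((i + s - 1) / P.sub - i / P.sub + 1)).bind fun f =>
      .done fun k => f ((i + k) / P.sub - i / P.sub) ((i + k) % P.sub)

theorem div_blockLen_lt {j : ℕ} (hj : j < n) : j / P.blockLen K < P.topCount K n := by
  rw [Nat.div_lt_iff_lt_mul (P.blockLen_pos K)]
  exact hj.trans_le P.le_topCount_mul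

theorem readIndex_spec (hm : P.topCount K n * P.chunkLen K ≤ m) (x : Fin n → X)
    {κ : ℕ} (hκ : κ * P.sub < n) :
    (P.GoodWord K hn x → Agree P.sub ((P.readIndex K m κ).output (P.encode K m hn x))
      (shift (κ * P.sub) (P.stream K hn x))) ∧
    (P.readIndex K m κ).numProbes (P.encode K m hn x) ≤
      P.readCost K (shift (κ * P.sub / P.blockLen K * P.blockLen K) (P.stream K hn x))
        (κ * P.sub % P.blockLen K) := by
  have hq := P.div_blockLen_lt (K := K) hκ
  obtain ⟨h1, h2, h3⟩ := P.readSub_spec K (P.holds_encode (hn := hn) hm x hq)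
    (Nat.mod_lt (κ * P.sub) (P.blockLen_pos K))
    ((Nat.dvd_mod_iff (P.sub_dvd_blockLen K)).2 (dvd_mul_left _ _))
  simp only [readIndex, ProbeTree.output_bind, ProbeTree.numProbes_bind, ProbeTree.output,
    ProbeTree.numProbes, add_zero]
  refine ⟨fun hg => ?_, h3⟩
  cases hr : (P.readSub m K (κ * P.sub / P.blockLen K * P.chunkLen K)
    (κ * P.sub % P.blockLen K)).output (P.encode K m hn x) with
  | none => exact absurd (hg _ hq) (h1 hr)
  | some v =>
    have := h2 v hr
    rwa [shift_shift, Nat.div_add_mod'] at this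

theorem readFragment_output (hm : P.topCount K n * P.chunkLen K ≤ m) {x : Fin n → X}
    (hx : P.GoodWord K hn x) {s i : ℕ} (h : i + s ≤ n) :
    (P.readFragment K m s i).output (P.encode K m hn x) = fragment x i s h := by
  funext k
  have hk := k.isLt
  simp only [readFragment, ProbeTree.output_bind, ProbeTree.output, output_gather]
  have h1 : i / P.sub ≤ (i + k) / P.sub := Nat.div_le_div_right (by omega)
  have h2 : (i + k) / P.sub ≤ (i + s - 1) / P.sub := Nat.div_le_div_right (by omega)
  rw [if_pos (by omega), Nat.add_sub_cancel' h1]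
  have h3 := Nat.div_mul_le_self (i + k) P.sub
  rw [(P.readIndex_spec hm x (by omega)).1 hx _ (Nat.mod_lt _ P.sub_pos), shift_apply,
    Nat.div_add_mod', stream, Function.comp, wrap_of_lt hn _ (by omega)]
  rfl

/-- The local decoder of the multilevel scheme. -/
noncomputable def decoder (hm : P.topCount K n * P.chunkLen K ≤ m)
    {g : Fin n → X} (hg : P.GoodWord K hn g) : LocalDecoder (P.scheme K m hn g) where
  alg s i _ := PMF.pure (P.readFragment K m s i)
  correct s i h x hx t ht := by
    rw [PMF.support_pure, Set.mem_singleton_iff] at ht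
    subst ht
    exact P.readFragment_output hm ((P.recovers_iff hm hg x).1 hx) h

theorem tsum_pure_mul {α : Type*} (a : α) (f : α → ℝ≥0∞) :
    ∑' t, (PMF.pure a) t * f t = f a := by
  rw [tsum_eq_single a]
  · simp
  · intro b hb
    simp [PMF.pure_apply, hb]

/-- A bound for the expected cost of reading a sub-block. -/
noncomputable def meanReadCost [Fintype X] (p : PMF X) (K : ℕ) : ℝ≥0∞ :=
  (1 + 2 * P.ptr : ℕ) + P.meanLen p +
    ∑ j ∈ Finset.range K, P.badProb p j * (1 + P.chunkLen (j + 1) : ℕ)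

/-- A bound for the expected cost of updating a block of level `0`. -/
noncomputable def meanUpdateCost [Fintype X] (p : PMF X) (K : ℕ) : ℝ≥0∞ :=
  (1 + 2 * P.chunkLen 0 : ℕ) +
    ∑ j ∈ Finset.range K, 2 * P.badProb p j * (1 + 2 * P.chunkLen (j + 1) : ℕ)

theorem decoder_rAvg_le [Fintype X] (p : PMF X) (hK : P.blockLen K ≤ n)
    (hm : P.topCount K n * P.chunkLen K ≤ m) {g : Fin n → X} (hg : P.GoodWord K hn g) {s : ℕ}
    (hs : 1 ≤ s) :
    (P.decoder hm hg).rAvg p s ≤ (s / P.sub + 2 : ℕ) * P.meanReadCost p K := by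
  refine iSup₂_le fun i h => ?_
  simp only [decoder, tsum_pure_mul]
  set cnt := (i + s - 1) / P.sub - i / P.sub + 1 with hcnt
  have hcost : ∀ x : Fin n → X,
      ((P.readFragment K m s i).numProbes (P.encode K m hn x) : ℝ≥0∞) ≤
      ∑ j ∈ Finset.range cnt, (P.readCost K (shift ((i / P.sub + j) * P.sub / P.blockLen K *
        P.blockLen K) (x ∘ wrap hn (P.blockLen K))) ((i / P.sub + j) * P.sub % P.blockLen K) :
          ℝ≥0∞) := by
    intro x
    simp only [readFragment, ProbeTree.numProbes_bind, ProbeTree.numProbes, add_zero,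
      numProbes_gather]
    rw [← Nat.cast_sum, Nat.cast_le]
    refine Finset.sum_le_sum fun j hj => (P.readIndex_spec hm x ?_).2
    rw [Finset.mem_range] at hj
    have h0 : i / P.sub ≤ (i + s - 1) / P.sub := Nat.div_le_div_right (by omega)
    have h1 : (i / P.sub + j) * P.sub ≤ (i + s - 1) / P.sub * P.sub :=
      Nat.mul_le_mul_right _ (by omega)
    have h2 := Nat.div_mul_le_self (i + s - 1) P.sub
    omega
  have hle : cnt ≤ s / P.sub + 2 := by
    have h1 : (i + s - 1) / P.sub ≤ i / P.sub + s / P.sub + 1 := by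
      calc (i + s - 1) / P.sub ≤ (i + s) / P.sub := Nat.div_le_div_right (by omega)
        _ ≤ _ := add_div_le _ _ _
    have h2 : 0 ≤ s / P.sub := Nat.zero_le _
    generalize s / P.sub = k at *
    omega
  calc _ ≤ Ex p fun x : Fin n → X => ∑ j ∈ Finset.range cnt, (P.readCost K
        (shift ((i / P.sub + j) * P.sub / P.blockLen K *
        P.blockLen K) (x ∘ wrap hn (P.blockLen K))) ((i / P.sub + j) * P.sub % P.blockLen K) :
          ℝ≥0∞) := Ex_mono p hcost
    _ ≤ ∑ j ∈ Finset.range cnt, P.meanReadCost p K := by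
        rw [Ex_finset_sum]
        refine Finset.sum_le_sum fun j hj => P.Ex_readCost_le p K ?_
          (Nat.mod_lt _ (P.blockLen_pos K))
          ((Nat.dvd_mod_iff (P.sub_dvd_blockLen K)).2 (dvd_mul_left _ _))
        refine P.wrap_injOn_block hn hK (P.div_blockLen_lt ?_)
        rw [Finset.mem_range] at hj
        have h0 : i / P.sub ≤ (i + s - 1) / P.sub := Nat.div_le_div_right (by omega)
        have h1 : (i / P.sub + j) * P.sub ≤ (i + s - 1) / P.sub * P.sub :=
          Nat.mul_le_mul_right _ (by omega)
        have h2 := Nat.div_mul_le_self (i + s - 1) P.sub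
        omega
    _ ≤ _ := by
        rw [Finset.sum_const, Finset.card_range, nsmul_eq_mul]
        gcongr

/-! #### The local updater -/

/-- The letters prescribed by the update of a fragment. -/
def patch (K : ℕ) (hn : 0 < n) (i : ℕ) {s : ℕ} (y : Fin s → X) (j : ℕ) : Option X :=
  if h : i ≤ (wrap hn (P.blockLen K) j : ℕ) ∧ (wrap hn (P.blockLen K) j : ℕ) < i + s then
    some (y ⟨wrap hn (P.blockLen K) j - i, by omega⟩) else none

theorem stream_replaceFragment (x : Fin n → X) (i : ℕ) {s : ℕ} (y : Fin s → X) :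
    P.stream K hn (replaceFragment x i y) = patched (P.patch K hn i y) (P.stream K hn x) := by
  funext j
  simp only [stream, replaceFragment, patched, patch, Function.comp]
  split_ifs <;> rfl

/-- Update around the level `0` block with index `β`. -/
noncomputable def updateIndex (K m n : ℕ) (π : ℕ → Option X) (β : ℕ) :
    ProbeTree m (ℕ → Option Bool) :=
  if β * P.blockLen 0 < P.topCount K n * P.blockLen K then
    (P.update m K (β * P.blockLen 0 / P.blockLen K * P.chunkLen K)
      (β * P.blockLen 0 % P.blockLen K)
      (shift (β * P.blockLen 0 / P.blockLen K * P.blockLen K) π)).bind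
        fun r => .done (r.getD fun _ => none)
  else .done fun _ => none

/-- The outcome of `updateIndex` when the stream `w` is changed into `w'`. -/
noncomputable def indexWrites (K n : ℕ) (w w' : ℕ → X) (β : ℕ) : ℕ → Option Bool :=
  if β * P.blockLen 0 < P.topCount K n * P.blockLen K then
    (P.writes K (β * P.blockLen 0 / P.blockLen K * P.chunkLen K)
      (shift (β * P.blockLen 0 / P.blockLen K * P.blockLen K) w)
      (shift (β * P.blockLen 0 / P.blockLen K * P.blockLen K) w')
      (β * P.blockLen 0 % P.blockLen K)).getD fun _ => none
  else fun _ => none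

/-- The indices of the level `0` blocks that a fragment may meet. -/
def touched (K s i t : ℕ) : ℕ :=
  if t < s / P.blockLen 0 + 2 then i / P.blockLen 0 + t
  else (i + P.blockLen K) / P.blockLen 0 + (t - (s / P.blockLen 0 + 2))

open Classical in
/-- Perform all the writes. -/
noncomputable def merge (m : ℕ) (f : ℕ → ℕ → Option Bool) : Writes m := fun j =>
  if h : ∃ b t, f t j = some b then some h.choose else none

/-- Update a fragment. -/
noncomputable def updateFragment (K m : ℕ) (hn : 0 < n) (s i : ℕ) (y : Fin s → X) :
    ProbeTree m (Writes m) :=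
  (gather (fun _ => none) (fun t => P.updateIndex K m n (P.patch K hn i y) (P.touched K s i t)) 0
    (2 * (s / P.blockLen 0 + 2))).bind fun f => .done (merge m f)

theorem updateIndex_spec (hm : P.topCount K n * P.chunkLen K ≤ m) (x : Fin n → X)
    (π : ℕ → Option X) (β : ℕ) :
    (P.updateIndex K m n π β).output (P.encode K m hn x) =
      P.indexWrites K n (P.stream K hn x) (patched π (P.stream K hn x)) β ∧
    (P.updateIndex K m n π β).numProbes (P.encode K m hn x) +
      writeCount m (P.indexWrites K n (P.stream K hn x) (patched π (P.stream K hn x)) β) ≤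
      if β * P.blockLen 0 < P.topCount K n * P.blockLen K then
        P.updateCost K (shift (β * P.blockLen 0 / P.blockLen K * P.blockLen K) (P.stream K hn x))
        (shift (β * P.blockLen 0 / P.blockLen K * P.blockLen K) (patched π (P.stream K hn x)))
        (β * P.blockLen 0 % P.blockLen K) else 0 := by
  by_cases hβ : β * P.blockLen 0 < P.topCount K n * P.blockLen K
  · have hq : β * P.blockLen 0 / P.blockLen K < P.topCount K n := by
      rwa [Nat.div_lt_iff_lt_mul (P.blockLen_pos K)]
    obtain ⟨h1, h2⟩ := P.update_spec K
      (π := shift (β * P.blockLen 0 / P.blockLen K * P.blockLen K) π)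
      (P.holds_encode (hn := hn) hm x hq) (Nat.mod_lt (β * P.blockLen 0) (P.blockLen_pos K))
    rw [← shift_patched] at h1 h2
    simp only [updateIndex, indexWrites, hβ, if_true, ProbeTree.output_bind,
      ProbeTree.numProbes_bind, ProbeTree.output, ProbeTree.numProbes, h1, add_zero]
    exact ⟨trivial, h2⟩
  · simp [updateIndex, indexWrites, hβ, ProbeTree.output, ProbeTree.numProbes, writeCount_none]

theorem size_merge_le (f : ℕ → ℕ → Option Bool) (l : ℕ) (hf : ∀ t, l ≤ t → ∀ j, f t j = none) :
    (merge m f).size ≤ ∑ t ∈ Finset.range l, writeCount m (f t) := by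
  classical
  unfold Writes.size writeCount
  refine le_trans (Finset.card_le_card ?_) Finset.card_biUnion_le
  intro j hj
  have hj := (Finset.mem_filter.1 hj).2
  simp only [merge] at hj
  split_ifs at hj with h
  · obtain ⟨b, t, ht⟩ := h
    refine Finset.mem_biUnion.2 ⟨t, Finset.mem_range.2 ?_, by simp [ht]⟩
    by_contra hlt
    simp [hf t (not_lt.1 hlt) j] at ht
  · cases hj

theorem indexWrites_sound {hn : 0 < n} (hm : P.topCount K n * P.chunkLen K ≤ m) {w : ℕ → X}
    {x' : Fin n → X} {β : ℕ} {j : Fin m} {b : Bool}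
    (h : P.indexWrites K n w (P.stream K hn x') β j = some b) :
    P.encode K m hn x' j = b := by
  simp only [indexWrites] at h
  split_ifs at h with hβ
  have hq : β * P.blockLen 0 / P.blockLen K < P.topCount K n := by
    rwa [Nat.div_lt_iff_lt_mul (P.blockLen_pos K)]
  cases hw : P.writes K (β * P.blockLen 0 / P.blockLen K * P.chunkLen K)
      (shift (β * P.blockLen 0 / P.blockLen K * P.blockLen K) w)
      (shift (β * P.blockLen 0 / P.blockLen K * P.blockLen K) (P.stream K hn x'))
      (β * P.blockLen 0 % P.blockLen K) with
  | none => simp [hw] at h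
  | some f =>
    rw [hw] at h
    obtain ⟨h1, h2, h3⟩ := P.writes_sound K (Nat.mod_lt (β * P.blockLen 0) (P.blockLen_pos K)) hw h
    rw [h3, ← P.holds_encode hm x' hq _ (by omega), Nat.add_sub_cancel' h1]
    simp [extendBits]

/-- A letter near the end of the word also occurs `blockLen K` virtual positions later. A fragment
therefore meets two runs of level `0` blocks, each covered by `s / blockLen 0 + 2` indices. -/
theorem exists_touched (hK : P.blockLen K ≤ n) {s i j : ℕ} (hj : j < P.topCount K n * P.blockLen K)
    (hi : i ≤ (wrap hn (P.blockLen K) j : ℕ)) (hs : (wrap hn (P.blockLen K) j : ℕ) < i + s) :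
    ∃ t < 2 * (s / P.blockLen 0 + 2), P.touched K s i t = j / P.blockLen 0 := by
  have key : ∀ i, i ≤ j → j < i + s → i / P.blockLen 0 ≤ j / P.blockLen 0 ∧
      j / P.blockLen 0 < i / P.blockLen 0 + (s / P.blockLen 0 + 2) := by
    intro i h1 h2
    refine ⟨Nat.div_le_div_right h1, ?_⟩
    have : j / P.blockLen 0 ≤ i / P.blockLen 0 + s / P.blockLen 0 + 1 := by
      calc j / P.blockLen 0 ≤ (i + s) / P.blockLen 0 := Nat.div_le_div_right (by omega)
        _ ≤ _ := add_div_le _ _ _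
    omega
  by_cases h : j < n
  · rw [wrap_of_lt hn _ h] at hi hs
    obtain ⟨h1, h2⟩ := key i hi hs
    refine ⟨j / P.blockLen 0 - i / P.blockLen 0, by omega, ?_⟩
    rw [touched, if_pos (by omega)]
    omega
  · have hlt := P.topCount_mul_lt (K := K) (n := n)
    rw [wrap_val_of_le hn (by omega) (by omega)] at hi hs
    obtain ⟨h1, h2⟩ := key (i + P.blockLen K) (by omega) (by omega)
    refine ⟨s / P.blockLen 0 + 2 + (j / P.blockLen 0 - (i + P.blockLen K) / P.blockLen 0),
      by omega, ?_⟩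
    rw [touched, if_neg (by omega)]
    omega

/-- Written bits are right by `indexWrites_sound`. A bit that has to change lies in a top block that
is good before and after, hence `Resolved`, so `Resolved.covers` finds a changed position whose
update writes it. That position lies in a touched level `0` block, and by `writes_round` the update
for this block is the same. -/
theorem updateFragment_correct (hK : P.blockLen K ≤ n) (hm : P.topCount K n * P.chunkLen K ≤ m)
    {s i : ℕ} (y : Fin s → X) {x : Fin n → X} (hx : P.GoodWord K hn x)
    (hx' : P.GoodWord K hn (replaceFragment x i y)) :
    ((P.updateFragment K m hn s i y).output (P.encode K m hn x)).apply (P.encode K m hn x) =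
      P.encode K m hn (replaceFragment x i y) := by
  have hout : (P.updateFragment K m hn s i y).output (P.encode K m hn x) =
      merge m fun t => if t < 2 * (s / P.blockLen 0 + 2) then
        P.indexWrites K n (P.stream K hn x) (P.stream K hn (replaceFragment x i y))
          (P.touched K s i t) else fun _ => none := by
    simp only [updateFragment, ProbeTree.output_bind, ProbeTree.output, output_gather, zero_add,
      (P.updateIndex_spec hm x _ _).1, stream_replaceFragment]
  rw [hout]
  funext j
  simp only [Writes.apply, merge]
  split_ifs with h
  · obtain ⟨t, ht⟩ := h.choose_spec
    split_ifs at ht with htl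
    · exact (P.indexWrites_sound hm ht).symm
  · by_contra hne
    simp only [Option.getD_none] at hne
    have hj : (j : ℕ) < P.topCount K n * P.chunkLen K := by
      by_contra hj
      simp [encode, hj] at hne
    have hq : (j : ℕ) / P.chunkLen K < P.topCount K n := by
      rwa [Nat.div_lt_iff_lt_mul (P.chunkLen_pos K)]
    simp only [encode, hj, if_true] at hne
    have hres : P.Resolved K ((j : ℕ) / P.chunkLen K * P.chunkLen K) _ _ :=
      P.resolved_of_good (hx _ hq) (hx' _ hq)
    obtain ⟨o, ho, hwo, f, hf, hs⟩ := hres.covers K (Nat.mod_lt _ (P.chunkLen_pos K)) hne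
    rw [Nat.div_add_mod'] at hs
    set q := (j : ℕ) / P.chunkLen K with hqdef
    have hpos : q * P.blockLen K + o < P.topCount K n * P.blockLen K := by
      have := Nat.mul_le_mul_right (P.blockLen K) (show q + 1 ≤ P.topCount K n from hq)
      rw [add_mul] at this
      omega
    have hin : i ≤ (wrap hn (P.blockLen K) (q * P.blockLen K + o) : ℕ) ∧
        (wrap hn (P.blockLen K) (q * P.blockLen K + o) : ℕ) < i + s := by
      by_contra hin
      refine hwo ?_
      simp only [stream, shift, replaceFragment, Function.comp, hin, dif_neg, not_false_eq_true]
    obtain ⟨t, htl, ht⟩ := P.exists_touched hK hpos hin.1 hin.2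
    obtain ⟨r, hr⟩ := P.blockLen_zero_dvd K
    have e1 : (q * P.blockLen K + o) / P.blockLen 0 * P.blockLen 0 =
        q * P.blockLen K + o / P.blockLen 0 * P.blockLen 0 := by
      rw [hr, show q * (P.blockLen 0 * r) + o = o + P.blockLen 0 * (q * r) by ring,
        Nat.add_mul_div_left _ _ (P.blockLen_pos 0)]
      ring
    have e0 : o / P.blockLen 0 * P.blockLen 0 < P.blockLen K :=
      (Nat.div_mul_le_self _ _).trans_lt ho
    have e2 : (q * P.blockLen K + o / P.blockLen 0 * P.blockLen 0) / P.blockLen K = q := by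
      rw [add_comm, Nat.add_mul_div_right _ _ (P.blockLen_pos K), Nat.div_eq_of_lt e0, zero_add]
    have e3 : (q * P.blockLen K + o / P.blockLen 0 * P.blockLen 0) % P.blockLen K =
        o / P.blockLen 0 * P.blockLen 0 := by
      rw [add_comm, Nat.add_mul_mod_self_right, Nat.mod_eq_of_lt e0]
    obtain ⟨b, hb⟩ := Option.isSome_iff_exists.1 hs
    refine h ⟨b, t, ?_⟩
    rw [if_pos htl, ht, indexWrites, e1, e2, e3, P.writes_round K, hf,
      if_pos ((Nat.add_le_add_left (Nat.div_mul_le_self _ _) _).trans_lt hpos)]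
    exact hb

/-- The local updater of the multilevel scheme. -/
noncomputable def updater (hK : P.blockLen K ≤ n) (hm : P.topCount K n * P.chunkLen K ≤ m)
    {g : Fin n → X} (hg : P.GoodWord K hn g) : LocalUpdater (P.scheme K m hn g) where
  alg s i _ y := P.updateFragment K m hn s i y
  correct _ _ _ y x hx hx' := P.updateFragment_correct hK hm y
    ((P.recovers_iff hm hg x).1 hx) ((P.recovers_iff hm hg _).1 hx')

theorem updateFragment_cost_le (hm : P.topCount K n * P.chunkLen K ≤ m) {s i : ℕ}
    (y : Fin s → X) (x : Fin n → X) :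
    (P.updateFragment K m hn s i y).numProbes (P.encode K m hn x) +
      ((P.updateFragment K m hn s i y).output (P.encode K m hn x)).size ≤
    ∑ t ∈ Finset.range (2 * (s / P.blockLen 0 + 2)),
      if P.touched K s i t * P.blockLen 0 < P.topCount K n * P.blockLen K then
        P.updateCost K (shift (P.touched K s i t * P.blockLen 0 / P.blockLen K * P.blockLen K)
          (P.stream K hn x))
        (shift (P.touched K s i t * P.blockLen 0 / P.blockLen K * P.blockLen K)
          (P.stream K hn (replaceFragment x i y)))
        (P.touched K s i t * P.blockLen 0 % P.blockLen K) else 0 := by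
  simp only [updateFragment, ProbeTree.output_bind, ProbeTree.output, ProbeTree.numProbes_bind,
    ProbeTree.numProbes, output_gather, numProbes_gather, zero_add, add_zero]
  refine (Nat.add_le_add_left (size_merge_le _ (2 * (s / P.blockLen 0 + 2))
    fun t ht j => by rw [if_neg (not_lt.2 ht)]) _).trans ?_
  rw [← Finset.sum_add_distrib]
  refine Finset.sum_le_sum fun t ht => ?_
  rw [if_pos (Finset.mem_range.1 ht), (P.updateIndex_spec hm x _ _).1, stream_replaceFragment]
  exact (P.updateIndex_spec hm x _ _).2

/-- The word and the new content form one i.i.d. family indexed by `Fin n ⊕ Fin s`. The old and the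
new stream are its pullbacks along `ψ` and `ψ'`, both injective on each top block, so blocks of the
updated word have the same law as those of the source word. -/
theorem updater_tAvg_le [Fintype X] (p : PMF X) (hK : P.blockLen K ≤ n)
    (hm : P.topCount K n * P.chunkLen K ≤ m) {g : Fin n → X} (hg : P.GoodWord K hn g) (s : ℕ) :
    (P.updater hK hm hg).tAvg p s ≤
      (2 * (s / P.blockLen 0 + 2) : ℕ) * P.meanUpdateCost p K := by
  refine iSup₂_le fun i h => ?_
  let ψ : ℕ → Fin n ⊕ Fin s := fun j => Sum.inl (wrap hn (P.blockLen K) j)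
  let ψ' : ℕ → Fin n ⊕ Fin s := fun j =>
    if h : i ≤ (wrap hn (P.blockLen K) j : ℕ) ∧ (wrap hn (P.blockLen K) j : ℕ) < i + s then
      Sum.inr ⟨wrap hn (P.blockLen K) j - i, by omega⟩ else Sum.inl (wrap hn (P.blockLen K) j)
  have hψ : ∀ (x : Fin n → X) (y : Fin s → X), P.stream K hn x = Sum.elim x y ∘ ψ := by
    intro x y
    funext j
    simp [stream, ψ]
  have hψ' : ∀ (x : Fin n → X) (y : Fin s → X),
      P.stream K hn (replaceFragment x i y) = Sum.elim x y ∘ ψ' := by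
    intro x y
    funext j
    simp only [stream, Function.comp, replaceFragment, ψ']
    split_ifs <;> rfl
  have hinj : ∀ S : Set ℕ, Set.InjOn (wrap hn (P.blockLen K)) S →
      Set.InjOn ψ S ∧ Set.InjOn ψ' S := by
    intro S hS
    refine ⟨fun j hj j' hj' hjj => hS hj hj' (Sum.inl_injective hjj), fun j hj j' hj' hjj =>
      hS hj hj' ?_⟩
    simp only [ψ'] at hjj
    split_ifs at hjj with h1 h2 h3
    · have := congrArg Fin.val (Sum.inr_injective hjj)
      simp only at this
      exact Fin.ext (by omega)
    · exact Sum.inl_injective hjj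
  let F : ℕ → (Fin n ⊕ Fin s → X) → ℝ≥0∞ := fun t z =>
    if P.touched K s i t * P.blockLen 0 < P.topCount K n * P.blockLen K then
        (P.updateCost K (shift (P.touched K s i t * P.blockLen 0 / P.blockLen K * P.blockLen K)
          (z ∘ ψ))
        (shift (P.touched K s i t * P.blockLen 0 / P.blockLen K * P.blockLen K) (z ∘ ψ'))
        (P.touched K s i t * P.blockLen 0 % P.blockLen K) : ℝ≥0∞) else 0
  calc _ = Ex p fun x : Fin n → X => Ex p fun y : Fin s → X =>
        (((P.updateFragment K m hn s i y).numProbes (P.encode K m hn x) +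
          ((P.updateFragment K m hn s i y).output (P.encode K m hn x)).size : ℕ) : ℝ≥0∞) := by
        simp only [Ex, Finset.mul_sum, wordProb, mul_assoc]
        rfl
    _ ≤ Ex p fun x : Fin n → X => Ex p fun y : Fin s → X =>
        ∑ t ∈ Finset.range (2 * (s / P.blockLen 0 + 2)), F t (Sum.elim x y) := by
        refine Ex_mono p fun x => Ex_mono p fun y => ?_
        refine (Nat.cast_le.2 (P.updateFragment_cost_le hm y x)).trans (le_of_eq ?_)
        push_cast
        refine Finset.sum_congr rfl fun t _ => ?_
        simp only [F, ← hψ, ← hψ']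
    _ = ∑ t ∈ Finset.range (2 * (s / P.blockLen 0 + 2)), Ex p (F t) := by
        rw [← Ex_sum_type p (fun z : Fin n ⊕ Fin s → X =>
          ∑ t ∈ Finset.range (2 * (s / P.blockLen 0 + 2)), F t z), Ex_finset_sum]
    _ ≤ ∑ t ∈ Finset.range (2 * (s / P.blockLen 0 + 2)), P.meanUpdateCost p K := by
        refine Finset.sum_le_sum fun t _ => ?_
        by_cases ht : P.touched K s i t * P.blockLen 0 < P.topCount K n * P.blockLen K
        · simp only [F, ht, if_true]
          have hq : P.touched K s i t * P.blockLen 0 / P.blockLen K < P.topCount K n := by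
            rwa [Nat.div_lt_iff_lt_mul (P.blockLen_pos K)]
          obtain ⟨i1, i2⟩ := hinj _ (P.wrap_injOn_block hn hK hq)
          exact P.Ex_updateCost_le p K i1 i2 (Nat.mod_lt _ (P.blockLen_pos K))
        · simp [F, ht, Ex_const]
    _ = _ := by rw [Finset.sum_const, Finset.card_range, nsmul_eq_mul]

/-! #### The probability of error -/

open Classical in
theorem Ex_not_goodWord_le [Fintype X] (p : PMF X) (hK : P.blockLen K ≤ n) :
    Ex p (fun x : Fin n → X => if P.GoodWord K hn x then 0 else 1) ≤
      P.topCount K n * P.badProb p K := by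
  calc _ ≤ Ex p fun x : Fin n → X => ∑ q ∈ Finset.range (P.topCount K n),
        P.badInd K (shift (q * P.blockLen K) (x ∘ wrap hn (P.blockLen K))) := by
        refine Ex_mono p fun x => ?_
        split_ifs with h
        · exact zero_le
        · unfold GoodWord at h
          push Not at h
          obtain ⟨q, hq, hb⟩ := h
          refine le_trans (le_of_eq ?_) (Finset.single_le_sum (f := fun q => P.badInd K
            (shift (q * P.blockLen K) (x ∘ wrap hn (P.blockLen K)))) (fun _ _ => zero_le)
            (Finset.mem_range.2 hq))
          exact (if_neg hb).symm
    _ = _ := by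
        rw [Ex_finset_sum, Finset.sum_congr rfl fun q hq => P.Ex_badInd p K
          (P.wrap_injOn_block hn hK (Finset.mem_range.1 hq))]
        simp

theorem errorProb_le [Fintype X] (p : PMF X) (hK : P.blockLen K ≤ n)
    (hm : P.topCount K n * P.chunkLen K ≤ m) {g : Fin n → X} (hg : P.GoodWord K hn g) :
    (P.scheme K m hn g).errorProb p ≤ P.topCount K n * P.badProb p K := by
  refine le_trans (le_of_eq ?_) (P.Ex_not_goodWord_le p (hn := hn) hK)
  refine Finset.sum_congr rfl fun x _ => ?_
  by_cases h : P.GoodWord K hn x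
  · simp [P.recovers_iff hm hg, h]
  · simp [P.recovers_iff hm hg, h, wordProb]

/-- A random word is good with positive probability. The source serves only to prove existence; the
default word of the scheme is then chosen without reference to it. -/
theorem exists_goodWord [Fintype X] (p : PMF X) (hK : P.blockLen K ≤ n)
    (h : P.topCount K n * P.badProb p K < 1) : ∃ g : Fin n → X, P.GoodWord K hn g := by
  classical
  by_contra! hg
  have h1 := P.Ex_not_goodWord_le p (hn := hn) hK
  simp only [hg, if_false, Ex_one] at h1
  exact absurd h (not_lt.2 h1)

/-- The multilevel scheme with its local decoder and updater. -/
noncomputable def localScheme (hK : P.blockLen K ≤ n) (hm : P.topCount K n * P.chunkLen K ≤ m)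
    {g : Fin n → X} (hg : P.GoodWord K hn g) : LocalScheme X n m where
  scheme := P.scheme K m hn g
  decoder := P.decoder hm hg
  updater := P.updater hK hm hg

end Params

/-- The scheme that stores nothing. -/
noncomputable def constScheme {X : Type u} (a : X) (n m : ℕ) : LocalScheme X n m where
  scheme := { enc := fun _ _ => false, dec := fun _ _ => a }
  decoder :=
    { alg := fun _ _ _ => PMF.pure (.done fun _ => a)
      correct := fun s i h x hx t ht => by
        rw [PMF.support_pure, Set.mem_singleton_iff] at ht
        subst ht
        simp only [Scheme.Recovers] at hx
        subst hx
        rfl }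
  updater :=
    { alg := fun _ _ _ _ => .done fun _ => none
      correct := fun _ _ _ _ _ _ _ => rfl }

/-! ### A universal variable-length code -/

/-- List the elements by increasing `f`, ties broken by an enumeration. All predecessors of `a` have
value at most `f a`, and `a` itself makes the inequality strict. -/
theorem exists_rank {α : Type*} [Fintype α] (f : α → ℕ) :
    ∃ r : α → ℕ, Function.Injective r ∧
      ∀ a, r a < (Finset.univ.filter fun a' => f a' ≤ f a).card := by
  classical
  let e := Fintype.equivFin α
  let key : α → ℕ := fun a => f a * Fintype.card α + e a
  have hpos : ∀ a, (e a : ℕ) < Fintype.card α := fun a => (e a).isLt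
  have hf : ∀ a a', key a < key a' → f a ≤ f a' := by
    intro a a' h
    by_contra hlt
    have h1 : (f a' + 1) * Fintype.card α ≤ f a * Fintype.card α :=
      Nat.mul_le_mul_right _ (by omega)
    have := hpos a'
    simp only [key] at h
    rw [add_mul] at h1
    omega
  have hkey : Function.Injective key := by
    intro a a' h
    have h1 := congrArg (· % Fintype.card α) h
    simp only [key, Nat.mul_add_mod_self_right, Nat.mod_eq_of_lt (hpos _)] at h1
    exact e.injective (Fin.ext h1)
  have hss : ∀ a a', key a < key a' → (Finset.univ.filter fun b => key b < key a) ⊂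
      Finset.univ.filter fun b => key b < key a' := by
    intro a a' h
    refine (Finset.ssubset_iff_of_subset fun b hb => ?_).2 ⟨a, by simpa using h, by simp⟩
    simp only [Finset.mem_filter, Finset.mem_univ, true_and] at hb ⊢
    omega
  refine ⟨fun a => (Finset.univ.filter fun b => key b < key a).card, ?_, ?_⟩
  · intro a a' h
    rcases lt_trichotomy (key a) (key a') with h1 | h1 | h1
    · exact absurd h (Finset.card_lt_card (hss _ _ h1)).ne
    · exact hkey h1
    · exact absurd h (Finset.card_lt_card (hss _ _ h1)).ne'
  · intro a
    refine Finset.card_lt_card ((Finset.ssubset_iff_of_subset fun b hb => ?_).2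
      ⟨a, by simp, by simp⟩)
    simp only [Finset.mem_filter, Finset.mem_univ, true_and] at hb ⊢
    exact hf _ _ hb

section Types

variable {X : Type u} [Fintype X] {N : ℕ}

open Classical in
/-- The type of a word: how often each letter occurs. -/
noncomputable def wordType (x : Fin N → X) (a : X) : Fin (N + 1) :=
  ⟨(Finset.univ.filter fun i => x i = a).card,
    Nat.lt_succ_of_le ((Finset.card_le_univ _).trans (by simp))⟩

open Classical in
/-- The number of words of the same type. -/
noncomputable def typeSize (x : Fin N → X) : ℕ :=
  (Finset.univ.filter fun y : Fin N → X => wordType y = wordType x).card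

theorem wordProb_eq_of_wordType_eq (p : PMF X) {x y : Fin N → X} (h : wordType x = wordType y) :
    ∏ i, p (x i) = ∏ i, p (y i) := by
  classical
  have key : ∀ x : Fin N → X, ∏ i, p (x i) = ∏ a, p a ^ (wordType x a : ℕ) := by
    intro x
    rw [← Finset.prod_fiberwise Finset.univ x]
    refine Finset.prod_congr rfl fun a _ => ?_
    rw [Finset.prod_congr rfl (g := fun _ => p a) fun i hi => by rw [(Finset.mem_filter.1 hi).2],
      Finset.prod_const]
    rfl
  rw [key, key, h]

/-- All words of a type are equally likely and their total probability is at most `1`. The size of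
the type class, which involves no source, is thus at most the inverse probability under every
source. -/
theorem typeSize_mul_wordProb_le (p : PMF X) (x : Fin N → X) :
    (typeSize x : ℝ≥0∞) * ∏ i, p (x i) ≤ 1 := by
  classical
  calc (typeSize x : ℝ≥0∞) * ∏ i, p (x i)
      = ∑ y ∈ Finset.univ.filter fun y : Fin N → X => wordType y = wordType x,
          ∏ i, p (y i) := by
        rw [Finset.sum_congr rfl fun y hy =>
          wordProb_eq_of_wordType_eq p (Finset.mem_filter.1 hy).2]
        simp [typeSize]
    _ ≤ ∑ y : Fin N → X, ∏ i, p (y i) :=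
        Finset.sum_le_sum_of_subset (Finset.filter_subset _ _)
    _ = 1 := by simpa [Ex] using Ex_one (ι := Fin N) p

theorem typeSize_pos (x : Fin N → X) : 0 < typeSize x :=
  Finset.card_pos.2 ⟨x, by simp⟩

/-- A ranking of the words of length `N` whose code lengths are within
`|X| log (N + 1) + 1` bits of the ideal ones, for every source. -/
theorem exists_universal_rank (X : Type u) [Fintype X] (N : ℕ) :
    ∃ r : (Fin N → X) → ℕ, Function.Injective r ∧ ∀ (p : PMF X) (x : Fin N → X),
      (2 : ℝ≥0∞) ^ Nat.size (r x) * ∏ i, p (x i) ≤ 2 * (N + 1 : ℕ) ^ Fintype.card X := by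
  classical
  obtain ⟨r, hr, hlt⟩ := exists_rank (typeSize (X := X) (N := N))
  refine ⟨r, hr, fun p x => ?_⟩
  -- These words have at most `(N + 1) ^ |X|` types, and each type contains at most `typeSize x` of
  -- them.
  have h1 : (Finset.univ.filter fun y : Fin N → X => typeSize y ≤ typeSize x).card ≤
      typeSize x * (N + 1) ^ Fintype.card X := by
    refine (Finset.card_le_mul_card_image (f := wordType) _ (typeSize x) ?_).trans ?_
    · intro τ hτ
      obtain ⟨y, hy, rfl⟩ := Finset.mem_image.1 hτ
      refine le_trans (Finset.card_le_card ?_) (Finset.mem_filter.1 hy).2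
      intro z hz
      simp only [Finset.mem_filter, Finset.mem_univ, true_and] at hz ⊢
      exact hz.2
    · gcongr
      refine (Finset.card_le_univ _).trans ?_
      simp
  -- Rounding to whole bits costs the factor `2`; the word of rank `0` has the empty code.
  have h2 : 2 ^ Nat.size (r x) ≤ 2 * (typeSize x * (N + 1) ^ Fintype.card X) := by
    rcases Nat.eq_zero_or_pos (r x) with h0 | h0
    · rw [h0]
      have := Nat.mul_pos (typeSize_pos x) (pow_pos (Nat.succ_pos N) (Fintype.card X))
      simp only [Nat.size_zero, pow_zero, Nat.succ_eq_add_one] at this ⊢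
      omega
    · have h3 : 0 < Nat.size (r x) := Nat.size_pos.2 h0
      have h4 : 2 ^ (Nat.size (r x) - 1) ≤ r x := by
        rw [← Nat.lt_size]; omega
      have h5 : 2 ^ Nat.size (r x) = 2 * 2 ^ (Nat.size (r x) - 1) := by
        rw [← pow_succ']; congr 1; omega
      have := hlt x
      omega
  calc (2 : ℝ≥0∞) ^ Nat.size (r x) * ∏ i, p (x i)
      ≤ (2 * (typeSize x * (N + 1 : ℕ) ^ Fintype.card X)) * ∏ i, p (x i) := by
        gcongr
        exact_mod_cast h2
    _ = 2 * (N + 1 : ℕ) ^ Fintype.card X * (typeSize x * ∏ i, p (x i)) := by ring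
    _ ≤ 2 * (N + 1 : ℕ) ^ Fintype.card X * 1 := by
        gcongr
        exact typeSize_mul_wordProb_le p x
    _ = _ := mul_one _

end Types

/-! ### Ideal code lengths -/

section Surprisal

variable {X : Type u} (p : PMF X)

/-- The ideal code length of a letter, in nats. -/
noncomputable def surprisal (a : X) : ℝ := -Real.log (p a).toReal

theorem toReal_le_one (a : X) : (p a).toReal ≤ 1 :=
  ENNReal.toReal_le_of_le_ofReal zero_le_one (by simpa using p.coe_le_one a)

theorem ofReal_toReal (a : X) : ENNReal.ofReal (p a).toReal = p a :=
  ENNReal.ofReal_toReal (p.apply_ne_top a)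

theorem surprisal_nonneg (a : X) : 0 ≤ surprisal p a :=
  neg_nonneg.2 (Real.log_nonpos ENNReal.toReal_nonneg (toReal_le_one p a))

variable [Fintype X]

theorem sum_toReal : ∑ a, (p a).toReal = 1 := by
  rw [← ENNReal.toReal_sum fun a _ => p.apply_ne_top a, sum_pmf]
  rfl

theorem sum_mul_surprisal : ∑ a, (p a).toReal * surprisal p a = entropy p * Real.log 2 := by
  simp only [entropy, Finset.sum_mul]
  refine Finset.sum_congr rfl fun a _ => ?_
  rw [div_mul_cancel₀ _ (Real.log_pos (by norm_num)).ne', Real.negMulLog, surprisal]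
  ring

theorem entropy_nonneg : 0 ≤ entropy p :=
  Finset.sum_nonneg fun a _ => div_nonneg (Real.negMulLog_nonneg ENNReal.toReal_nonneg
    (toReal_le_one p a)) (Real.log_nonneg (by norm_num))

theorem Ex_surprisal (N : ℕ) : Ex p (fun x : Fin N → X => ∑ i, ENNReal.ofReal (surprisal p (x i)))
    = N * ENNReal.ofReal (entropy p * Real.log 2) := by
  have h1 : Ex p (fun x : Fin 1 → X => ENNReal.ofReal (surprisal p (x 0))) =
      ENNReal.ofReal (entropy p * Real.log 2) := by
    have := Ex_prod (ι := Fin 1) p (fun _ a => ENNReal.ofReal (surprisal p a))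
    simp only [Fin.prod_univ_one] at this
    rw [this, ← sum_mul_surprisal, ENNReal.ofReal_sum_of_nonneg fun a _ =>
      mul_nonneg ENNReal.toReal_nonneg (surprisal_nonneg p a)]
    refine Finset.sum_congr rfl fun a _ => ?_
    rw [ENNReal.ofReal_mul ENNReal.toReal_nonneg, ofReal_toReal]
  have h2 : ∀ i : Fin N, Ex p (fun x : Fin N → X => ENNReal.ofReal (surprisal p (x i))) =
      ENNReal.ofReal (entropy p * Real.log 2) := by
    intro i
    rw [← h1, ← Ex_comp p (φ := fun _ : Fin 1 => i) (Function.injective_of_subsingleton _)]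
    rfl
  rw [Ex_finset_sum, Finset.sum_congr rfl fun i _ => h2 i]
  simp

theorem exp_le_one_add (y : ℝ) (hy : 0 ≤ y) : Real.exp y ≤ 1 + y + y ^ 2 * Real.exp y := by
  have h1 := Real.add_one_le_exp (-y)
  have h2 := Real.exp_pos y
  have h3 : Real.exp (-y) * Real.exp y = 1 := by rw [← Real.exp_add]; simp
  nlinarith [mul_le_mul_of_nonneg_left h1 h2.le, mul_nonneg hy h2.le,
    mul_le_mul_of_nonneg_left (mul_le_mul_of_nonneg_left h1 h2.le) hy]

/-- With `q = exp (-y)` for the probability of a letter of surprisal `y`, the second-order term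
satisfies `q * y ^ 2 * exp (t * y) ≤ 8` when `t ≤ 1 / 2`. Hence the constant depends on the alphabet
size only, however small the probabilities are. -/
theorem mgf_surprisal_le {t : ℝ} (h0 : 0 ≤ t) (h1 : t ≤ 1 / 2) :
    ∑ a, (p a).toReal * Real.exp (t * surprisal p a) ≤
      Real.exp (t * (entropy p * Real.log 2) + 8 * Fintype.card X * t ^ 2) := by
  have key : ∀ a, (p a).toReal * Real.exp (t * surprisal p a) ≤
      (p a).toReal + t * ((p a).toReal * surprisal p a) + 8 * t ^ 2 := by
    intro a
    have hy := surprisal_nonneg p a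
    have hq : (0 : ℝ) ≤ (p a).toReal := ENNReal.toReal_nonneg
    have e1 := mul_le_mul_of_nonneg_left (exp_le_one_add _ (mul_nonneg h0 hy)) hq
    have e2 : (p a).toReal * (surprisal p a ^ 2 * Real.exp (t * surprisal p a)) ≤ 8 := by
      rcases hq.eq_or_lt with hz | hpos
      · rw [← hz]; norm_num
      · have hp : (p a).toReal = Real.exp (-surprisal p a) := by
          rw [surprisal, neg_neg, Real.exp_log hpos]
        have e3 : Real.exp (t * surprisal p a) ≤ Real.exp (surprisal p a / 2) :=
          Real.exp_le_exp.2 (by nlinarith)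
        have e4 := Real.quadratic_le_exp_of_nonneg (div_nonneg hy (by norm_num : (0 : ℝ) ≤ 2))
        have e5 : Real.exp (-surprisal p a) * Real.exp (surprisal p a / 2) *
            Real.exp (surprisal p a / 2) = 1 := by
          rw [← Real.exp_add, ← Real.exp_add, Real.exp_eq_one_iff]; ring
        have e6 : surprisal p a ^ 2 ≤ 8 * Real.exp (surprisal p a / 2) := by nlinarith
        calc (p a).toReal * (surprisal p a ^ 2 * Real.exp (t * surprisal p a))
            ≤ Real.exp (-surprisal p a) * (8 * Real.exp (surprisal p a / 2) *
              Real.exp (surprisal p a / 2)) := by rw [hp]; gcongr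
          _ = 8 * (Real.exp (-surprisal p a) * Real.exp (surprisal p a / 2) *
            Real.exp (surprisal p a / 2)) := by ring
          _ = 8 := by rw [e5, mul_one]
    nlinarith [mul_le_mul_of_nonneg_left e2 (sq_nonneg t)]
  calc _ ≤ ∑ a, ((p a).toReal + t * ((p a).toReal * surprisal p a) + 8 * t ^ 2) :=
        Finset.sum_le_sum fun a _ => key a
    _ = (t * (entropy p * Real.log 2) + 8 * Fintype.card X * t ^ 2) + 1 := by
        rw [Finset.sum_add_distrib, Finset.sum_add_distrib, ← Finset.mul_sum, sum_mul_surprisal,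
          sum_toReal, Finset.sum_const, Finset.card_univ, nsmul_eq_mul]
        ring
    _ ≤ _ := Real.add_one_le_exp _

/-- Words containing a letter of probability zero carry no weight. They must be set aside because
`log 0 = 0` gives such a letter the surprisal `0`, which says nothing about its code length. -/
theorem Ex_mono_of_pos {ι : Type*} [Fintype ι] [DecidableEq ι] {f g : (ι → X) → ℝ≥0∞}
    (h : ∀ x, (∀ i, p (x i) ≠ 0) → f x ≤ g x) : Ex p f ≤ Ex p g := by
  refine Finset.sum_le_sum fun x _ => ?_
  by_cases hx : ∀ i, p (x i) ≠ 0
  · gcongr; exact h x hx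
  · push Not at hx
    obtain ⟨i, hi⟩ := hx
    rw [Finset.prod_eq_zero (Finset.mem_univ i) hi]
    simp

end Surprisal

/-! ### Actual against ideal code lengths, and the overflow of a payload -/

namespace Params

variable {X : Type u} (P : Params X) (p : PMF X)

/-- The overhead of the sub-block code is at most `W` bits. -/
def Overhead (W : ℕ) : Prop :=
  ∀ (p : PMF X) (x : Fin P.sub → X),
    (2 : ℝ≥0∞) ^ Nat.size (P.rank x) * ∏ i, p (x i) ≤ 2 ^ W

variable {P}

theorem Overhead.codeLen_le {W : ℕ} (hW : P.Overhead W) {w : ℕ → X}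
    (hw : ∀ i < P.sub, p (w i) ≠ 0) :
    (P.codeLen w : ℝ) * Real.log 2 ≤
      W * Real.log 2 + ∑ i ∈ Finset.range P.sub, surprisal p (w i) := by
  have h := hW p fun i => w i
  have hpos : ∀ i : Fin P.sub, 0 < (p (w i)).toReal := fun i =>
    ENNReal.toReal_pos (hw i i.isLt) (p.apply_ne_top _)
  have h1 : (2 : ℝ) ^ P.codeLen w * ∏ i : Fin P.sub, (p (w i)).toReal ≤ 2 ^ W := by
    have := ENNReal.toReal_mono (by simp) h
    simpa [ENNReal.toReal_mul, ENNReal.toReal_pow, ENNReal.toReal_prod, codeLen, subRank]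
      using this
  have h2 := Real.log_le_log (by
    exact mul_pos (by positivity) (Finset.prod_pos fun i _ => hpos i)) h1
  rw [Real.log_mul (by positivity) (Finset.prod_pos fun i _ => hpos i).ne', Real.log_pow,
    Real.log_pow, Real.log_prod fun i _ => (hpos i).ne'] at h2
  rw [Finset.sum_range fun i => surprisal p (w i)]
  simp only [surprisal, Finset.sum_neg_distrib]
  linarith

theorem Overhead.start_le {W : ℕ} (hW : P.Overhead W) {w : ℕ → X} (k : ℕ)
    (hw : ∀ i < k * P.sub, p (w i) ≠ 0) :
    (P.start w k : ℝ) * Real.log 2 ≤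
      k * W * Real.log 2 + ∑ i ∈ Finset.range (k * P.sub), surprisal p (w i) := by
  induction k with
  | zero => simp [start]
  | succ k ih =>
    rw [add_mul, one_mul] at hw
    have h1 := ih fun i hi => hw i (by omega)
    have h2 := hW.codeLen_le p (w := shift (k * P.sub) w)
      (fun i hi => by rw [shift_apply]; exact hw _ (by omega))
    rw [P.start_succ, add_mul k 1, one_mul, Finset.sum_range_add]
    simp only [shift_apply] at h2
    push_cast
    linarith

variable [Fintype X]

theorem Overhead.meanLen_le {W : ℕ} (hW : P.Overhead W) :
    P.meanLen p ≤ ENNReal.ofReal (W + P.sub * entropy p) := by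
  have hl : (0 : ℝ) < Real.log 2 := Real.log_pos (by norm_num)
  calc P.meanLen p ≤ Ex p fun x : Fin P.sub → X => (W : ℝ≥0∞) +
        (∑ i, ENNReal.ofReal (surprisal p (x i))) * ENNReal.ofReal (1 / Real.log 2) := by
        refine Ex_mono_of_pos p fun x hx => ?_
        have := hW.codeLen_le p (w := pad P.blank x) (fun i hi => by simpa [pad, hi] using hx _)
        rw [Finset.sum_range] at this
        simp only [pad, Fin.is_lt, dif_pos, Fin.eta] at this
        rw [← ENNReal.ofReal_sum_of_nonneg fun i _ => surprisal_nonneg p _,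
          ← ENNReal.ofReal_mul (Finset.sum_nonneg fun i _ => surprisal_nonneg p _),
          ← ENNReal.ofReal_natCast W, ← ENNReal.ofReal_add (by positivity)
          (mul_nonneg (Finset.sum_nonneg fun i _ => surprisal_nonneg p _) (by positivity)),
          ← ENNReal.ofReal_natCast]
        refine ENNReal.ofReal_le_ofReal ?_
        rw [← mul_le_mul_iff_left₀ hl, add_mul, mul_assoc, one_div_mul_cancel hl.ne', mul_one]
        exact this
    _ = W + P.sub * ENNReal.ofReal (entropy p * Real.log 2) * ENNReal.ofReal (1 / Real.log 2) := by
        rw [Ex_add, Ex_const, Ex_mul_const, Ex_surprisal]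
    _ = _ := by
        rw [mul_assoc, ← ENNReal.ofReal_mul (mul_nonneg (entropy_nonneg p) hl.le),
          mul_assoc, mul_one_div_cancel hl.ne', mul_one,
          ENNReal.ofReal_add (by positivity) (mul_nonneg (by positivity) (entropy_nonneg p)),
          ENNReal.ofReal_natCast, ENNReal.ofReal_mul (by positivity), ENNReal.ofReal_natCast]

/-- Chernoff's bound for the payload of a block of level `0`. -/
theorem Overhead.badProb_zero_le {W : ℕ} (hW : P.Overhead W) {t : ℝ} (h0 : 0 ≤ t) (h1 : t ≤ 1)
    (hslot : P.blockLen 0 * (entropy p + t) + P.num * W ≤ P.slot) :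
    P.badProb p 0 ≤
      ENNReal.ofReal (Real.exp (-(P.blockLen 0 * t ^ 2 / (128 * Fintype.card X)))) := by
  have hl : (1 / 2 : ℝ) < Real.log 2 := by have := Real.log_two_gt_d9; linarith
  have hne : Nonempty X := ⟨P.blank⟩
  have hd : (1 : ℝ) ≤ Fintype.card X := by exact_mod_cast Fintype.card_pos
  -- With this `c` the loss `8 d c ^ 2 = t ^ 2 / (128 d)` is at most half of the gain `c t log 2`,
  -- since `log 2 > 1 / 2`.
  set c : ℝ := t / (32 * Fintype.card X) with hc
  have hc0 : 0 ≤ c := by positivity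
  have hc1 : c ≤ 1 / 2 := by
    rw [hc, div_le_iff₀ (by positivity)]; nlinarith
  set N := P.blockLen 0 with hN
  set L : ℝ := N * (entropy p + t) * Real.log 2 with hL
  calc P.badProb p 0 ≤ Ex p fun x : Fin N → X => ENNReal.ofReal (Real.exp (-(c * L))) *
        ∏ i, ENNReal.ofReal (Real.exp (c * surprisal p (x i))) := by
        refine Ex_mono_of_pos p fun x hx => ?_
        by_cases hg : P.Good 0 (pad P.blank x)
        · simp [badInd, hg]
        · have hlt : (P.slot : ℝ) < P.start (pad P.blank x) P.num := by
            simp only [Good, not_le] at hg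
            exact_mod_cast hg
          have hs := hW.start_le p (w := pad P.blank x) P.num (fun i hi => by
            simpa [pad, show i < P.blockLen 0 from hi] using hx _)
          have hsum : ∑ i ∈ Finset.range (P.num * P.sub), surprisal p (pad P.blank x i) =
              ∑ i, surprisal p (x i) := by
            change ∑ i ∈ Finset.range N, surprisal p (pad P.blank x i) = _
            rw [Finset.sum_range]
            refine Finset.sum_congr rfl fun i _ => ?_
            rw [pad, dif_pos i.isLt]
          rw [hsum] at hs
          -- The payload overflows the slot; without the code overhead of at most `num * W` bits, at
          -- least `N (H + t)` bits of ideal code length remain.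
          have hLs : L ≤ ∑ i, surprisal p (x i) := by
            have := mul_le_mul_of_nonneg_right (hslot.trans hlt.le) (by linarith : 0 ≤ Real.log 2)
            rw [add_mul] at this
            linarith
          rw [← ENNReal.ofReal_prod_of_nonneg fun i _ => (Real.exp_pos _).le, ← Real.exp_sum,
            ← Finset.mul_sum, ← ENNReal.ofReal_mul (Real.exp_pos _).le, ← Real.exp_add]
          refine (le_of_eq (b := ENNReal.ofReal 1) ?_).trans (ENNReal.ofReal_le_ofReal ?_)
          · simp [badInd, hg]
          · refine Real.one_le_exp ?_
            nlinarith
    _ = ENNReal.ofReal (Real.exp (-(c * L))) *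
        ENNReal.ofReal (∑ a, (p a).toReal * Real.exp (c * surprisal p a)) ^ N := by
        rw [Ex_const_mul, Ex_prod p (fun (_ : Fin N) a =>
          ENNReal.ofReal (Real.exp (c * surprisal p a)))]
        rw [Finset.prod_const, Finset.card_univ, Fintype.card_fin]
        congr 2
        rw [ENNReal.ofReal_sum_of_nonneg fun a _ =>
          mul_nonneg ENNReal.toReal_nonneg (Real.exp_pos _).le]
        refine Finset.sum_congr rfl fun a _ => ?_
        rw [ENNReal.ofReal_mul ENNReal.toReal_nonneg, ofReal_toReal]
    _ ≤ ENNReal.ofReal (Real.exp (-(c * L))) * ENNReal.ofReal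
        (Real.exp (c * (entropy p * Real.log 2) + 8 * Fintype.card X * c ^ 2)) ^ N := by
        gcongr
        exact mgf_surprisal_le p hc0 hc1
    _ ≤ _ := by
        rw [← ENNReal.ofReal_pow (Real.exp_pos _).le, ← Real.exp_nat_mul,
          ← ENNReal.ofReal_mul (Real.exp_pos _).le, ← Real.exp_add]
        refine ENNReal.ofReal_le_ofReal (Real.exp_le_exp.2 ?_)
        have e1 : -(c * L) + N * (c * (entropy p * Real.log 2) + 8 * Fintype.card X * c ^ 2) =
            N * (8 * Fintype.card X * c ^ 2 - c * t * Real.log 2) := by rw [hL]; ring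
        have e2 : (8 : ℝ) * Fintype.card X * c ^ 2 = t ^ 2 / (128 * Fintype.card X) := by
          rw [hc]; field_simp; ring
        have e3 : c * t = 2 * (t ^ 2 / (64 * Fintype.card X)) := by
          rw [hc]; field_simp; ring
        have e4 : (0 : ℝ) ≤ t ^ 2 / (64 * Fintype.card X) := by positivity
        have e5 : t ^ 2 / (64 * Fintype.card X) = 2 * (t ^ 2 / (128 * Fintype.card X)) := by
          field_simp; ring
        rw [e1, e2, e3, mul_div_assoc, ← mul_neg]
        refine mul_le_mul_of_nonneg_left ?_ (Nat.cast_nonneg _)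
        nlinarith

end Params

/-! ### The single-symbol lower bound -/

section LeafWeight

variable {m : ℕ} {β : Type v}

open Classical in
/-- `2 ^ (-l)`, where `l` is the least depth at which the algorithm outputs `b`. -/
noncomputable def ProbeTree.leafWeight (b : β) : ProbeTree m β → ℝ
  | .done b' => if b' = b then 1 else 0
  | .probe _ t₀ t₁ => max (t₀.leafWeight b) (t₁.leafWeight b) / 2

theorem ProbeTree.leafWeight_nonneg (t : ProbeTree m β) (b : β) : 0 ≤ t.leafWeight b := by
  induction t with
  | done b' => simp only [leafWeight]; split_ifs <;> norm_num
  | probe j t₀ t₁ h₀ h₁ =>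
    simp only [leafWeight]
    exact div_nonneg (h₀.trans (le_max_left _ _)) (by norm_num)

/-- Kraft's inequality. Repeated probes of a bit and leaves reached by no codeword do no harm, since
the argument concerns the tree and not the codewords. -/
theorem ProbeTree.sum_leafWeight_le [Fintype β] (t : ProbeTree m β) :
    ∑ b, t.leafWeight b ≤ 1 := by
  classical
  induction t with
  | done b' => simp [leafWeight]
  | probe j t₀ t₁ h₀ h₁ =>
    calc ∑ b, (ProbeTree.probe j t₀ t₁).leafWeight b
        ≤ ∑ b, (t₀.leafWeight b / 2 + t₁.leafWeight b / 2) := by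
          refine Finset.sum_le_sum fun b _ => ?_
          simp only [leafWeight]
          have := max_le_add_of_nonneg (t₀.leafWeight_nonneg b) (t₁.leafWeight_nonneg b)
          linarith
      _ ≤ 1 := by
          rw [Finset.sum_add_distrib, ← Finset.sum_div, ← Finset.sum_div]
          linarith

theorem ProbeTree.leafWeight_eq (t : ProbeTree m β) (b : β) :
    t.leafWeight b = 0 ∨ ∃ l : ℕ, t.leafWeight b = (1 / 2) ^ l := by
  induction t with
  | done b' =>
    simp only [leafWeight]
    split_ifs
    · exact Or.inr ⟨0, by simp⟩
    · exact Or.inl rfl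
  | probe j t₀ t₁ h₀ h₁ =>
    have key : ∀ y : ℝ, (y = 0 ∨ ∃ l : ℕ, y = (1 / 2) ^ l) →
        y / 2 = 0 ∨ ∃ l : ℕ, y / 2 = (1 / 2) ^ l := by
      rintro y (rfl | ⟨l, rfl⟩)
      · simp
      · exact Or.inr ⟨l + 1, by rw [pow_succ]; ring⟩
    simp only [leafWeight]
    rcases max_choice (t₀.leafWeight b) (t₁.leafWeight b) with h | h <;> rw [h]
    · exact key _ h₀
    · exact key _ h₁

theorem ProbeTree.le_leafWeight (t : ProbeTree m β) (c : Fin m → Bool) :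
    (1 / 2 : ℝ) ^ t.numProbes c ≤ t.leafWeight (t.output c) := by
  induction t with
  | done b' => simp [leafWeight, numProbes, output]
  | probe j t₀ t₁ h₀ h₁ =>
    simp only [leafWeight, numProbes, output]
    rw [pow_add, pow_one]
    split_ifs
    · have := le_max_right (t₀.leafWeight (t₁.output c)) (t₁.leafWeight (t₁.output c))
      linarith
    · have := le_max_left (t₀.leafWeight (t₀.output c)) (t₁.leafWeight (t₀.output c))
      linarith

end LeafWeight

/-- The distance of `√r` to the endpoints of `(A, B)`, squared (`0` outside). -/
noncomputable def gap (A B r : ℝ) : ℝ := max (min (√r - A) (B - √r)) 0 ^ 2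

theorem gap_le {A B r y : ℝ} (hy : y ≤ A ∨ B ≤ y) : gap A B r ≤ (√r - y) ^ 2 := by
  unfold gap
  rcases le_total (min (√r - A) (B - √r)) 0 with h | h
  · rw [max_eq_right h]; simpa using sq_nonneg (√r - y)
  · rw [max_eq_left h]
    have h1 := min_le_left (√r - A) (B - √r)
    have h2 := min_le_right (√r - A) (B - √r)
    rcases hy with hy | hy
    · exact pow_le_pow_left₀ h (by linarith) 2
    · rw [← neg_sq (√r - y)]
      exact pow_le_pow_left₀ h (by linarith) 2

/-- Applying `log x ≤ x - 1` to `√q / √r` instead of `q / r`, and doubling, leaves the squared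
Hellinger term as a remainder. -/
theorem gibbs_le {r q : ℝ} (hr : 0 ≤ r) (hq : 0 ≤ q) (hrq : 0 < r → 0 < q) :
    Real.negMulLog r + r - q + (√r - √q) ^ 2 ≤ r * -Real.log q := by
  rcases hr.eq_or_lt with rfl | hr'
  · simp [Real.sq_sqrt hq]
  · have hq' := hrq hr'
    have h1 := Real.log_le_sub_one_of_pos (div_pos (Real.sqrt_pos.2 hq') (Real.sqrt_pos.2 hr'))
    rw [Real.log_div (Real.sqrt_pos.2 hq').ne' (Real.sqrt_pos.2 hr').ne', Real.log_sqrt hq,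
      Real.log_sqrt hr] at h1
    have h2 : r * (√q / √r) = √r * √q := by
      rw [mul_div_assoc', div_eq_iff (Real.sqrt_pos.2 hr').ne']
      linear_combination (-√q) * Real.mul_self_sqrt hr
    have h3 := mul_le_mul_of_nonneg_left h1 hr
    have h5 : r * (√q / √r - 1) = √r * √q - r := by rw [mul_sub, h2, mul_one]
    rw [h5] at h3
    have h4 : (√r - √q) ^ 2 = r + q - 2 * (√r * √q) := by
      nlinarith [Real.mul_self_sqrt hr, Real.mul_self_sqrt hq]
    rw [h4, Real.negMulLog]
    linarith

section LowerBound

variable {X : Type u} [Fintype X] (p : PMF X)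

/-- A lower bound, in terms of the error probability `θ`, for the expected number of probes of an
algorithm that outputs a letter. -/
noncomputable def probeBound (A B : ℝ) (a₀ : X) (θ : ℝ) : ℝ :=
  ((∑ a, (Real.negMulLog (max ((p a).toReal - θ) 0) + max ((p a).toReal - θ) 0)) - 1 +
    gap A B (max ((p a₀).toReal - θ) 0)) / Real.log 2

theorem continuous_probeBound (A B : ℝ) (a₀ : X) : Continuous (probeBound p A B a₀) := by
  unfold probeBound gap
  fun_prop

theorem probeBound_zero (A B : ℝ) (a₀ : X) :
    probeBound p A B a₀ 0 = entropy p + gap A B (p a₀).toReal / Real.log 2 := by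
  simp only [probeBound, sub_zero, max_eq_left ENNReal.toReal_nonneg, Finset.sum_add_distrib,
    sum_toReal, entropy]
  rw [← Finset.sum_div]
  ring

theorem Ex_letter {n : ℕ} (i : Fin n) (f : X → ℝ≥0∞) :
    Ex p (fun x : Fin n → X => f (x i)) = ∑ a, p a * f a := by
  have h1 := Ex_prod (ι := Fin 1) p (fun _ a => f a)
  simp only [Fin.prod_univ_one] at h1
  rw [← h1, ← Ex_comp p (φ := fun _ : Fin 1 => i) (Function.injective_of_subsingleton _)]
  rfl

theorem errorProb_le_one {n m : ℕ} (S : Scheme X n m) : S.errorProb p ≤ 1 := by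
  rw [← Ex_one (ι := Fin n) p]
  refine Finset.sum_le_sum fun x _ => ?_
  split_ifs <;> simp [wordProb]

open Classical in
theorem sub_errorProb_le {n m : ℕ} (S : Scheme X n m) (i : Fin n) (a : X) :
    p a - S.errorProb p ≤ Ex p fun x : Fin n → X => if S.Recovers x ∧ x i = a then 1 else 0 := by
  rw [tsub_le_iff_right]
  have h1 := Ex_letter p i fun b => if b = a then 1 else 0
  simp only [mul_ite, mul_one, mul_zero, Finset.sum_ite_eq', Finset.mem_univ, if_true] at h1
  have h2 : S.errorProb p = Ex p fun x : Fin n → X => if S.Recovers x then 0 else 1 := by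
    refine Finset.sum_congr rfl fun x _ => ?_
    by_cases h : S.Recovers x <;> simp [wordProb, h]
  rw [h2, ← Ex_add, ← h1]
  refine Ex_mono p fun x => ?_
  split_ifs <;> simp_all

/-- On a recovered word the number of probes is at least `-log₂ q`, where `q` is the weight of its
first letter. The event that the word is recovered and starts with `a` has probability at least `r
a`. These masses need not sum to `1`, hence the unnormalised `gibbs_le`; of the Hellinger terms only
that of `a₀` is kept. -/
theorem probeBound_le {n m : ℕ} (S : Scheme X n m) (hn : 0 + 1 ≤ n)
    (t : ProbeTree m (Fin 1 → X))
    (ht : ∀ x, S.Recovers x → t.output (S.enc x) = fragment x 0 1 hn) {A B : ℝ} {a₀ : X}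
    (hAB : ∀ q : ℝ, (q = 0 ∨ ∃ l : ℕ, q = (1 / 2) ^ l) → √q ≤ A ∨ B ≤ √q) :
    ENNReal.ofReal (probeBound p A B a₀ (S.errorProb p).toReal) ≤
      Ex p fun x : Fin n → X => (t.numProbes (S.enc x) : ℝ≥0∞) := by
  classical
  set θ := (S.errorProb p).toReal with hθ
  have hl : (0 : ℝ) < Real.log 2 := Real.log_pos (by norm_num)
  set q : X → ℝ := fun a => t.leafWeight fun _ => a with hq
  set r : X → ℝ := fun a => max ((p a).toReal - θ) 0 with hr
  have hq0 : ∀ a, 0 ≤ q a := fun a => t.leafWeight_nonneg _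
  have hr0 : ∀ a, 0 ≤ r a := fun a => le_max_right _ _
  have hqsum : ∑ a, q a ≤ 1 := by
    refine le_trans (le_of_eq ?_) t.sum_leafWeight_le
    refine Fintype.sum_equiv (Equiv.funUnique (Fin 1) X).symm _ _ fun a => ?_
    rfl
  have hq1 : ∀ a, q a ≤ 1 := fun a =>
    (Finset.single_le_sum (fun b _ => hq0 b) (Finset.mem_univ a)).trans hqsum
  let i₀ : Fin n := ⟨0, by omega⟩
  have hfrag : ∀ x, S.Recovers x → t.output (S.enc x) = fun _ => x i₀ := by
    intro x hx
    rw [ht x hx]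
    funext k
    fin_cases k
    rfl
  have hle : ∀ x, S.Recovers x → 0 < q (x i₀) ∧
      -Real.log (q (x i₀)) / Real.log 2 ≤ t.numProbes (S.enc x) := by
    intro x hx
    have h1 := t.le_leafWeight (S.enc x)
    rw [hfrag x hx] at h1
    have h2 : (0 : ℝ) < (1 / 2) ^ t.numProbes (S.enc x) := by positivity
    refine ⟨h2.trans_le h1, ?_⟩
    have h3 := Real.log_le_log h2 h1
    rw [Real.log_pow, one_div, Real.log_inv] at h3
    rw [div_le_iff₀ hl]
    linarith
  have hprob : ∀ a, ENNReal.ofReal (r a) ≤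
      Ex p fun x : Fin n → X => if S.Recovers x ∧ x i₀ = a then 1 else 0 := by
    intro a
    refine le_trans (le_of_eq ?_) (sub_errorProb_le p S i₀ a)
    have he : S.errorProb p ≠ ⊤ := ((errorProb_le_one p S).trans_lt ENNReal.one_lt_top).ne
    simp only [hr, ENNReal.ofReal_max, ENNReal.ofReal_zero, max_eq_left, zero_le]
    rw [ENNReal.ofReal_sub _ ENNReal.toReal_nonneg, ofReal_toReal, ENNReal.ofReal_toReal he]
  -- A letter that is output with positive probability has a leaf. This excludes the default value
  -- `log 0 = 0`, for which the bound would fail.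
  have hrq : ∀ a, 0 < r a → 0 < q a := by
    intro a ha
    by_contra hna
    have h1 := hprob a
    have h2 : (Ex p fun x : Fin n → X =>
        (if S.Recovers x ∧ x i₀ = a then 1 else 0 : ℝ≥0∞)) = 0 := by
      refine (Ex_congr p (g := fun _ => 0) fun x => if_neg ?_).trans (Ex_const p 0)
      rintro ⟨hx, rfl⟩
      exact hna (hle x hx).1
    rw [h2, nonpos_iff_eq_zero, ENNReal.ofReal_eq_zero] at h1
    linarith
  have hsum : probeBound p A B a₀ θ ≤ ∑ a, r a * (-Real.log (q a) / Real.log 2) := by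
    have h1 : (∑ a, (Real.negMulLog (r a) + r a)) - 1 + gap A B (r a₀) ≤
        ∑ a, r a * -Real.log (q a) := by
      calc _ ≤ (∑ a, (Real.negMulLog (r a) + r a)) - (∑ a, q a) + ∑ a, (√(r a) - √(q a)) ^ 2 := by
            have h2 := gap_le (r := r a₀) (hAB _ (t.leafWeight_eq fun _ => a₀))
            have h3 := Finset.single_le_sum (f := fun a => (√(r a) - √(q a)) ^ 2)
              (fun a _ => sq_nonneg _) (Finset.mem_univ a₀)
            have h4 := h2.trans h3
            linarith
        _ = ∑ a, (Real.negMulLog (r a) + r a - q a + (√(r a) - √(q a)) ^ 2) := by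
            rw [← Finset.sum_sub_distrib, ← Finset.sum_add_distrib]
        _ ≤ _ := Finset.sum_le_sum fun a _ => gibbs_le (hr0 a) (hq0 a) (hrq a)
    unfold probeBound
    rw [div_le_iff₀ hl, Finset.sum_mul]
    refine h1.trans (le_of_eq (Finset.sum_congr rfl fun a _ => ?_))
    rw [mul_assoc, div_mul_cancel₀ _ hl.ne']
  calc ENNReal.ofReal (probeBound p A B a₀ θ)
      ≤ ENNReal.ofReal (∑ a, r a * (-Real.log (q a) / Real.log 2)) :=
        ENNReal.ofReal_le_ofReal hsum
    _ = ∑ a, ENNReal.ofReal (r a) * ENNReal.ofReal (-Real.log (q a) / Real.log 2) := by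
        rw [ENNReal.ofReal_sum_of_nonneg fun a _ => mul_nonneg (hr0 a)
          (div_nonneg (neg_nonneg.2 (Real.log_nonpos (hq0 a) (hq1 a))) hl.le)]
        exact Finset.sum_congr rfl fun a _ => ENNReal.ofReal_mul (hr0 a)
    _ ≤ ∑ a, Ex p fun x : Fin n → X => (if S.Recovers x ∧ x i₀ = a then 1 else 0) *
          ENNReal.ofReal (-Real.log (q a) / Real.log 2) := by
        refine Finset.sum_le_sum fun a _ => ?_
        rw [Ex_mul_const]
        gcongr
        exact hprob a
    _ ≤ _ := by
        rw [← Ex_finset_sum]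
        refine Ex_mono p fun x => ?_
        by_cases hx : S.Recovers x
        · simp only [hx, true_and, ite_mul, one_mul, zero_mul, Finset.sum_ite_eq,
            Finset.mem_univ, if_true]
          rw [← ENNReal.ofReal_natCast]
          exact ENNReal.ofReal_le_ofReal (hle x hx).2
        · simp [hx]

/-- A randomized decoder is a mixture of trees, each tree of the support being correct, so the bound
for a single tree averages. The position `0` suffices for a lower bound on the supremum. -/
theorem probeBound_le_rAvg {n m : ℕ} {S : Scheme X n m} (D : LocalDecoder S) (hn : 0 + 1 ≤ n)
    {A B : ℝ} {a₀ : X}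
    (hAB : ∀ q : ℝ, (q = 0 ∨ ∃ l : ℕ, q = (1 / 2) ^ l) → √q ≤ A ∨ B ≤ √q) :
    ENNReal.ofReal (probeBound p A B a₀ (S.errorProb p).toReal) ≤ D.rAvg p 1 := by
  refine le_trans ?_ (le_iSup₂ (f := fun (i : ℕ) (h : i + 1 ≤ n) => ∑ x : Fin n → X,
    wordProb p x * ∑' t : ProbeTree m (Fin 1 → X), D.alg 1 i h t * (t.numProbes (S.enc x) : ℝ≥0∞))
    0 hn)
  have hswap : ∑ x : Fin n → X, wordProb p x * ∑' t : ProbeTree m (Fin 1 → X),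
      D.alg 1 0 hn t * (t.numProbes (S.enc x) : ℝ≥0∞) =
      ∑' t : ProbeTree m (Fin 1 → X), D.alg 1 0 hn t *
        Ex p fun x : Fin n → X => (t.numProbes (S.enc x) : ℝ≥0∞) := by
    simp only [← ENNReal.tsum_mul_left, Ex, Finset.mul_sum]
    rw [← Summable.tsum_finsetSum fun _ _ => ENNReal.summable]
    refine tsum_congr fun t => Finset.sum_congr rfl fun x _ => ?_
    rw [wordProb]
    ring
  rw [hswap]
  set F := ENNReal.ofReal (probeBound p A B a₀ (S.errorProb p).toReal)
  calc F = ∑' t, D.alg 1 0 hn t * F := by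
        rw [ENNReal.tsum_mul_right, PMF.tsum_coe, one_mul]
    _ ≤ _ := by
        refine ENNReal.tsum_le_tsum fun t => ?_
        by_cases ht : t ∈ (D.alg 1 0 hn).support
        · gcongr
          exact probeBound_le p S hn t (fun x hx => D.correct 1 0 hn x hx t ht) hAB
        · rw [PMF.mem_support_iff, not_not] at ht
          simp [ht]

/-- For a source that is not dyadic, decoding one letter costs more than the entropy. -/
theorem exists_lt_rStar (hp : ¬ IsDyadic p) :
    ∃ δ : ℝ, 0 < δ ∧ ∀ ε : ℝ, ENNReal.ofReal (entropy p + δ) ≤ rStar p ε := by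
  have hl : (0 : ℝ) < Real.log 2 := Real.log_pos (by norm_num)
  unfold IsDyadic at hp
  push Not at hp
  obtain ⟨a₀, h0, hk⟩ := hp
  have hpos : 0 < (p a₀).toReal := ENNReal.toReal_pos h0 (p.apply_ne_top _)
  have hne : ∀ k : ℕ, (p a₀).toReal ≠ (1 / 2) ^ k := by
    intro k h
    apply hk k
    rw [← ofReal_toReal, h, ENNReal.ofReal_pow (by norm_num), one_div,
      ENNReal.ofReal_inv_of_pos (by norm_num)]
    simp
  -- The non-dyadic probability lies strictly between two consecutive powers of `1/2`, where no leaf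
  -- weight can lie.
  obtain ⟨k, hk1, hk2⟩ := exists_nat_pow_near_of_lt_one hpos (toReal_le_one p a₀)
    (by norm_num : (0 : ℝ) < 1 / 2) (by norm_num)
  have hk2 := lt_of_le_of_ne hk2 (hne k)
  set A := √((1 / 2 : ℝ) ^ (k + 1)) with hA
  set B := √((1 / 2 : ℝ) ^ k) with hB
  have hAB : ∀ q : ℝ, (q = 0 ∨ ∃ l : ℕ, q = (1 / 2) ^ l) → √q ≤ A ∨ B ≤ √q := by
    rintro q (rfl | ⟨l, rfl⟩)
    · left; simp [hA]
    · rcases Nat.lt_or_ge k l with h | h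
      · left
        exact Real.sqrt_le_sqrt (pow_le_pow_of_le_one (by norm_num) (by norm_num) h)
      · right
        exact Real.sqrt_le_sqrt (pow_le_pow_of_le_one (by norm_num) (by norm_num) h)
  refine ⟨gap A B (p a₀).toReal / Real.log 2, ?_, fun ε => ?_⟩
  · refine div_pos ?_ hl
    unfold gap
    have h1 : A < √(p a₀).toReal := Real.sqrt_lt_sqrt (by positivity) hk1
    have h2 : √(p a₀).toReal < B := Real.sqrt_lt_sqrt hpos.le hk2
    have : 0 < min (√(p a₀).toReal - A) (B - √(p a₀).toReal) :=
      lt_min (by linarith) (by linarith)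
    rw [max_eq_left this.le]
    positivity
  · refine le_iInf fun m => le_iInf fun S => le_iInf fun D => le_iInf fun _ => le_iInf fun hS => ?_
    have hlim : Tendsto (fun n => ENNReal.ofReal
        (probeBound p A B a₀ ((S n).errorProb p).toReal)) atTop
        (𝓝 (ENNReal.ofReal (entropy p + gap A B (p a₀).toReal / Real.log 2))) := by
      rw [← probeBound_zero]
      refine ENNReal.tendsto_ofReal (((continuous_probeBound p A B a₀).tendsto 0).comp ?_)
      have := (ENNReal.tendsto_toReal ENNReal.zero_ne_top).comp hS
      simpa [Function.comp_def] using this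
    rw [← hlim.liminf_eq]
    refine liminf_le_liminf ?_
    filter_upwards [eventually_ge_atTop 1] with n hn
    exact probeBound_le_rAvg p (D n) (by omega) hAB

end LowerBound

/-! ### The choice of the parameters -/

/-- A crude bound, sufficient for `m / n ≤ 3 d`, which in turn keeps payload addresses within `ptr`
bits. -/
theorem entropy_le {X : Type u} [Fintype X] (p : PMF X) :
    entropy p ≤ 2 * Fintype.card X := by
  have hl : (1 / 2 : ℝ) < Real.log 2 := by have := Real.log_two_gt_d9; linarith
  calc entropy p ≤ ∑ _a : X, (2 : ℝ) := by
        refine Finset.sum_le_sum fun a _ => ?_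
        rw [div_le_iff₀ (by linarith)]
        have h1 : Real.negMulLog (p a).toReal ≤ 1 - (p a).toReal := by
          have := Real.self_sub_one_le_mul_log (x := (p a).toReal) ENNReal.toReal_nonneg
          rw [Real.negMulLog]; linarith
        have h2 : (0 : ℝ) ≤ (p a).toReal := ENNReal.toReal_nonneg
        linarith
    _ = _ := by simp [mul_comm]

section Parameters

variable (X : Type u) [Fintype X] [Nonempty X]

/-- The parameters of the multilevel code with redundancy of order `2 ^ (-e)`. -/
noncomputable def codeParams (e : ℕ) (he : 0 < e) (slot : ℕ) : Params X where
  -- Pointers and code overhead amount to `O(d ^ 2 * e)` bits per sub-block; this length makes them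
  -- a small fraction of `2 ^ (-e)` bits per letter.
  sub := 2 ^ 10 * Fintype.card X ^ 2 * 2 ^ e * e
  -- Then `blockLen 0 / 4 ^ e` is of order `d ^ 2 * e`, enough for Chernoff's bound with deviation
  -- `2 ^ (-e)` to be polynomially small in `2 ^ (-e)`.
  num := 2 ^ 10 * 2 ^ e
  ptr := 30 * Fintype.card X * e
  -- The minimum makes `slot_lt` hold for every `slot`; for the payloads in use it equals `slot`, by
  -- `codeParams_slot`.
  slot := min slot (2 ^ (30 * Fintype.card X * e) - 1)
  -- The factor `2 ^ k` makes the spare areas, relative to their blocks, a geometric series with sum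
  -- of order `2 ^ (-e)`.
  arity k := 16 * Fintype.card X * 2 ^ e * 2 ^ k
  width := Fintype.card X
  rank := (exists_universal_rank X _).choose
  sym a := Fintype.equivFin X a
  blank := Classical.arbitrary X
  sub_pos := by have := Fintype.card_pos (α := X); positivity
  num_pos := by positivity
  ptr_pos := by have := Fintype.card_pos (α := X); positivity
  width_pos := Fintype.card_pos
  arity_pos k := by have := Fintype.card_pos (α := X); positivity
  slot_lt := (min_le_right _ _).trans_lt (Nat.sub_lt (by positivity) one_pos)
  rank_injective := (exists_universal_rank X _).choose_spec.1
  sym_injective a b h := (Fintype.equivFin X).injective (Fin.ext h)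
  sym_lt a := Fin.isLt _

variable {X} {e : ℕ} (he : 0 < e) (slot : ℕ)

local notation "P" => codeParams X e he slot
local notation "d" => Fintype.card X

theorem codeParams_blockLen_zero : (P).blockLen 0 = 2 ^ 20 * d ^ 2 * 2 ^ e * 2 ^ e * e := by
  change 2 ^ 10 * 2 ^ e * (2 ^ 10 * d ^ 2 * 2 ^ e * e) = _
  ring

theorem codeParams_blockLen_succ (k : ℕ) :
    (P).blockLen (k + 1) = 16 * d * 2 ^ e * 2 ^ k * (P).blockLen k := rfl

theorem codeParams_overhead : (P).Overhead (16 * d ^ 2 * e) := by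
  intro p x
  have hd : 0 < d := Fintype.card_pos
  refine ((exists_universal_rank X (P).sub).choose_spec.2 p x).trans ?_
  have h1 : (P).sub + 1 ≤ 2 ^ (15 * d * e) := by
    change 2 ^ 10 * d ^ 2 * 2 ^ e * e + 1 ≤ _
    have e1 : d ^ 2 ≤ 2 ^ (2 * d) := by
      rw [mul_comm, pow_mul]; exact Nat.pow_le_pow_left Nat.lt_two_pow_self.le 2
    have e2 : e ≤ 2 ^ e := Nat.lt_two_pow_self.le
    calc 2 ^ 10 * d ^ 2 * 2 ^ e * e + 1 ≤ 2 ^ 10 * d ^ 2 * 2 ^ e * e +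
          2 ^ 10 * d ^ 2 * 2 ^ e * e := by
          have : 0 < 2 ^ 10 * d ^ 2 * 2 ^ e * e := by positivity
          omega
      _ = 2 ^ 11 * d ^ 2 * 2 ^ e * e := by ring
      _ ≤ 2 ^ 11 * 2 ^ (2 * d) * 2 ^ e * 2 ^ e := by gcongr
      _ = 2 ^ (11 + 2 * d + e + e) := by rw [pow_add, pow_add, pow_add]
      _ ≤ _ := Nat.pow_le_pow_right (by norm_num) (by nlinarith [Nat.mul_le_mul hd he])
  have h2 : 2 * ((P).sub + 1) ^ d ≤ 2 ^ (16 * d ^ 2 * e) := by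
    calc 2 * ((P).sub + 1) ^ d ≤ 2 * (2 ^ (15 * d * e)) ^ d := by gcongr
      _ = 2 ^ (1 + 15 * d * e * d) := by rw [← pow_mul, pow_add, pow_one]
      _ ≤ _ := Nat.pow_le_pow_right (by norm_num) (by nlinarith [Nat.mul_le_mul (Nat.mul_le_mul hd hd) he])
  exact_mod_cast h2

/-- The arities double from level to level, so the exponent is quadratic in `k`. This is why the
number of levels is of order `√(log n)`. -/
theorem codeParams_blockLen_le (k : ℕ) :
    (P).blockLen k ≤ 2 ^ ((20 + 2 * d + 3 * e) * (k + 1) ^ 2) := by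
  have e0 : d ≤ 2 ^ d := Nat.lt_two_pow_self.le
  have e2 : e ≤ 2 ^ e := Nat.lt_two_pow_self.le
  induction k with
  | zero =>
    have e1 : d ^ 2 ≤ 2 ^ (2 * d) := by
      rw [mul_comm, pow_mul]; exact Nat.pow_le_pow_left e0 2
    rw [codeParams_blockLen_zero]
    calc 2 ^ 20 * d ^ 2 * 2 ^ e * 2 ^ e * e ≤ 2 ^ 20 * 2 ^ (2 * d) * 2 ^ e * 2 ^ e * 2 ^ e := by
          gcongr
      _ = _ := by
          rw [← pow_add, ← pow_add, ← pow_add, ← pow_add]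
          congr 1
          ring
  | succ k ih =>
    rw [codeParams_blockLen_succ]
    calc 16 * d * 2 ^ e * 2 ^ k * (P).blockLen k
        ≤ 2 ^ 4 * 2 ^ d * 2 ^ e * 2 ^ k * 2 ^ ((20 + 2 * d + 3 * e) * (k + 1) ^ 2) := by
          gcongr; norm_num
      _ = 2 ^ (4 + d + e + k + (20 + 2 * d + 3 * e) * (k + 1) ^ 2) := by
          rw [pow_add, pow_add, pow_add, pow_add]
      _ ≤ _ := Nat.pow_le_pow_right (by norm_num) (by nlinarith)

/-- The negative term closes the induction: its halving frees `2 d` bits per letter of one child, of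
which the spare area takes `d` and the flag takes one bit in all. At level `0` the net `1 / (8 * 2 ^
e)` bits per letter pay for the flag and the pointers. -/
theorem codeParams_chunkLen_le (k : ℕ) :
    ((P).chunkLen k : ℝ) ≤ (P).blockLen k *
      (slot / (P).blockLen 0 + 3 / (8 * 2 ^ e) - 1 / (4 * 2 ^ e * 2 ^ k)) := by
  have hd : (1 : ℝ) ≤ d := by exact_mod_cast Fintype.card_pos (α := X)
  have he' : (1 : ℝ) ≤ e := by exact_mod_cast he
  have hE : (1 : ℝ) ≤ 2 ^ e := one_le_pow₀ (by norm_num)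
  induction k with
  | zero =>
    have hb : (0 : ℝ) < (P).blockLen 0 := by exact_mod_cast (P).blockLen_pos 0
    have h1 : ((P).blockLen 0 : ℝ) * (slot / (P).blockLen 0 + 3 / (8 * 2 ^ e) -
        1 / (4 * 2 ^ e * 2 ^ 0)) = slot + (P).blockLen 0 * (1 / (8 * 2 ^ e)) := by
      field_simp; ring
    rw [h1, codeParams_blockLen_zero]
    have h2 : (((2 ^ 20 * d ^ 2 * 2 ^ e * 2 ^ e * e : ℕ) : ℝ)) * (1 / (8 * 2 ^ e)) =
        2 ^ 17 * d ^ 2 * 2 ^ e * e := by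
      push_cast; field_simp; norm_num
    rw [h2]
    have h3 : ((P).chunkLen 0 : ℝ) = 1 + (2 ^ 10 * 2 ^ e + 1) * (30 * d * e) +
        ((P).slot : ℝ) := by
      change ((1 + (2 ^ 10 * 2 ^ e + 1) * (30 * d * e) + (P).slot : ℕ) : ℝ) = _
      push_cast; ring
    have h4 : ((P).slot : ℝ) ≤ slot := by exact_mod_cast min_le_left _ _
    rw [h3]
    have h5 : (1 : ℝ) ≤ d * e := by nlinarith
    have h6 : (d * e : ℝ) ≤ 2 ^ e * (d * e) := by nlinarith
    have h7 : 2 ^ e * (d * e : ℝ) ≤ d * (2 ^ e * (d * e)) := by nlinarith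
    nlinarith
  | succ k ih =>
    have hB : (1 : ℝ) ≤ (P).blockLen k := by exact_mod_cast (P).blockLen_pos k
    have h1 : ((P).chunkLen (k + 1) : ℝ) =
        1 + 16 * d * 2 ^ e * 2 ^ k * (P).chunkLen k + d * (P).blockLen k := by
      change ((1 + 16 * d * 2 ^ e * 2 ^ k * (P).chunkLen k + d * (P).blockLen k : ℕ) : ℝ) = _
      push_cast; ring
    have h2 : (((P).blockLen (k + 1) : ℕ) : ℝ) =
        16 * d * 2 ^ e * 2 ^ k * (P).blockLen k := by
      rw [codeParams_blockLen_succ]; push_cast; ring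
    rw [h1, h2]
    set s : ℝ := slot / (P).blockLen 0 + 3 / (8 * 2 ^ e) with hs
    have h3 : 16 * d * 2 ^ e * 2 ^ k * ((P).blockLen k : ℝ) *
        (s - 1 / (4 * 2 ^ e * 2 ^ (k + 1))) = 16 * d * 2 ^ e * 2 ^ k * ((P).blockLen k *
        (s - 1 / (4 * 2 ^ e * 2 ^ k))) + 2 * d * (P).blockLen k := by
      rw [pow_succ]; field_simp; ring
    rw [h3]
    have h4 : 16 * d * 2 ^ e * 2 ^ k * ((P).chunkLen k : ℝ) ≤ 16 * d * 2 ^ e * 2 ^ k *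
      ((P).blockLen k * (s - 1 / (4 * 2 ^ e * 2 ^ k))) := by gcongr
    nlinarith

variable (p : PMF X)

/-- The bound for the probability of bad blocks. -/
noncomputable def badBound (D e b k : ℕ) : ℝ :=
  (1 / (16 * D * b * (16 * D * 2 ^ e))) ^ 2 ^ k / (16 * (16 * D * 2 ^ e) ^ 2 * 4 ^ k)

theorem badBound_nonneg (D e b k : ℕ) : 0 ≤ badBound D e b k := by
  unfold badBound; positivity

/-- The denominator of `badBound` is there to absorb the factor `arity ^ 2` of each step, so that
the base of the power is simply squared. -/
theorem badBound_succ (b k : ℕ) :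
    ((16 * d * 2 ^ e * 2 ^ k : ℕ) : ℝ) ^ 2 * badBound d e b k ^ 2 ≤ badBound d e b (k + 1) := by
  have hd : (0 : ℝ) < d := by exact_mod_cast Fintype.card_pos (α := X)
  unfold badBound
  set θ : ℝ := 1 / (16 * d * b * (16 * d * 2 ^ e))
  have hθ : 0 ≤ θ := by positivity
  rw [pow_succ 2 k, pow_mul]
  set y : ℝ := θ ^ 2 ^ k
  push_cast
  set G : ℝ := 16 * d * 2 ^ e with hG
  have hG0 : 0 < G := by positivity
  have h4 : (2 : ℝ) ^ k * 2 ^ k = 4 ^ k := by rw [← mul_pow]; norm_num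
  have e1 : (G * 2 ^ k) ^ 2 * (y / (16 * G ^ 2 * 4 ^ k)) ^ 2 =
      y ^ 2 / (256 * (G ^ 2 * 4 ^ k)) := by
    rw [← h4]; field_simp; norm_num
  rw [e1, pow_succ 4 k]
  refine div_le_div_of_nonneg_left (sq_nonneg y) (by positivity) ?_
  have : 0 < G ^ 2 * 4 ^ k := by positivity
  nlinarith

theorem codeParams_badProb_le (h : (P).badProb p 0 ≤
    ENNReal.ofReal (badBound d e ((P).blockLen 0) 0)) (k : ℕ) :
    (P).badProb p k ≤ ENNReal.ofReal (badBound d e ((P).blockLen 0) k) := by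
  induction k with
  | zero => exact h
  | succ k ih =>
    refine ((P).badProb_succ_le p k).trans ?_
    refine le_trans ?_ (ENNReal.ofReal_le_ofReal (badBound_succ (X := X) (e := e) ((P).blockLen 0) k))
    rw [ENNReal.ofReal_mul (by positivity), ENNReal.ofReal_pow (badBound_nonneg _ _ _ _),
      ENNReal.ofReal_pow (by positivity), ENNReal.ofReal_natCast]
    gcongr
    exact le_rfl

/-- Deliberately weak: a bound of the same doubly exponential shape as `badBound`, with which it is
to be multiplied. -/
theorem codeParams_blockLen_succ_le (k : ℕ) :
    (P).blockLen (k + 1) ≤ (2 * (P).blockLen 0 * (16 * d * 2 ^ e)) ^ 2 ^ k := by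
  have hd : 0 < d := Fintype.card_pos
  set G := 16 * d * 2 ^ e with hG
  have hG0 : 0 < G := by positivity
  have hb : 2 ≤ (P).blockLen 0 := by
    rw [codeParams_blockLen_zero]
    have : 0 < d ^ 2 * 2 ^ e * 2 ^ e * e := by positivity
    have h2 : 2 ^ 20 * d ^ 2 * 2 ^ e * 2 ^ e * e = 2 ^ 20 * (d ^ 2 * 2 ^ e * 2 ^ e * e) := by ring
    omega
  set b := (P).blockLen 0 with hbdef
  induction k with
  | zero =>
    rw [codeParams_blockLen_succ, ← hG, ← hbdef]
    simp only [pow_zero, pow_one, mul_one]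
    nlinarith [Nat.mul_pos hG0 (show 0 < b by omega)]
  | succ k ih =>
    rw [codeParams_blockLen_succ, ← hG, pow_succ 2 k, pow_mul, pow_two, mul_comm]
    refine Nat.mul_le_mul ih ?_
    calc G * 2 ^ (k + 1) ≤ G ^ (k + 1) * 4 ^ (k + 1) := by
          gcongr
          · exact Nat.le_self_pow (by omega) _
          · norm_num
      _ = (4 * G) ^ (k + 1) := by rw [mul_pow 4 G, mul_comm]
      _ ≤ (4 * G) ^ 2 ^ k := Nat.pow_le_pow_right (by positivity) Nat.lt_two_pow_self
      _ ≤ _ := by gcongr; omega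

/-- The base of `badBound` times the base in `codeParams_blockLen_succ_le` is `1 / (8 d)`. Its `2 ^
k`-th power is harmless, and the denominator of `badBound` leaves a geometric series. -/
theorem codeParams_cost_le (h : (P).badProb p 0 ≤
    ENNReal.ofReal (badBound d e ((P).blockLen 0) 0))
    (hc : ∀ k, ((P).chunkLen k : ℝ) ≤ 3 * d * (P).blockLen k) (K : ℕ) :
    ∑ k ∈ Finset.range K, 2 * (P).badProb p k * (1 + 2 * (P).chunkLen (k + 1) : ℕ) ≤ 1 := by
  have hd : (1 : ℝ) ≤ d := by exact_mod_cast Fintype.card_pos (α := X)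
  have hb : (1 : ℝ) ≤ (P).blockLen 0 := by exact_mod_cast (P).blockLen_pos 0
  have hE : (1 : ℝ) ≤ 2 ^ e := one_le_pow₀ (by norm_num)
  have key : ∀ k, 2 * (P).badProb p k * (1 + 2 * (P).chunkLen (k + 1) : ℕ) ≤
      ENNReal.ofReal ((1 / 2) ^ (k + 1)) := by
    intro k
    have h1 : (((1 + 2 * (P).chunkLen (k + 1) : ℕ)) : ℝ) ≤ 7 * d * (P).blockLen (k + 1) := by
      have h2 := hc (k + 1)
      have h3 : (1 : ℝ) ≤ (P).blockLen (k + 1) := by exact_mod_cast (P).blockLen_pos (k + 1)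
      push_cast
      nlinarith
    have h2 : ((P).blockLen (k + 1) : ℝ) ≤
        (2 * (P).blockLen 0 * (16 * d * 2 ^ e)) ^ 2 ^ k := by
      exact_mod_cast codeParams_blockLen_succ_le he slot k
    have h3 : (1 / (16 * d * (P).blockLen 0 * (16 * d * 2 ^ e) : ℝ)) ^ 2 ^ k *
        (2 * (P).blockLen 0 * (16 * d * 2 ^ e)) ^ 2 ^ k ≤ 1 / (8 * d) := by
      rw [← mul_pow]
      have e1 : 1 / (16 * d * (P).blockLen 0 * (16 * d * 2 ^ e) : ℝ) *
          (2 * (P).blockLen 0 * (16 * d * 2 ^ e)) = 1 / (8 * d) := by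
        field_simp; norm_num
      rw [e1]
      refine pow_le_of_le_one (by positivity) ?_ (by positivity)
      rw [div_le_one (by positivity)]
      linarith
    have h4 : 2 * badBound d e ((P).blockLen 0) k * ((1 + 2 * (P).chunkLen (k + 1) : ℕ)) ≤
        (1 / 2) ^ (k + 1) := by
      calc 2 * badBound d e ((P).blockLen 0) k * ((1 + 2 * (P).chunkLen (k + 1) : ℕ))
          ≤ 2 * badBound d e ((P).blockLen 0) k * (7 * d *
            (2 * (P).blockLen 0 * (16 * d * 2 ^ e)) ^ 2 ^ k) := by
            have := badBound_nonneg d e ((P).blockLen 0) k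
            gcongr
            exact h1.trans (by gcongr)
        _ = 14 * d * ((1 / (16 * d * (P).blockLen 0 * (16 * d * 2 ^ e) : ℝ)) ^ 2 ^ k *
            (2 * (P).blockLen 0 * (16 * d * 2 ^ e)) ^ 2 ^ k) /
            (16 * (16 * d * 2 ^ e) ^ 2 * 4 ^ k) := by
            unfold badBound; ring
        _ ≤ 14 * d * (1 / (8 * d)) / (16 * 1 ^ 2 * 2 ^ k) := by
            gcongr
            · nlinarith
            · norm_num
        _ ≤ _ := by
            rw [pow_succ, one_div_pow]
            field_simp
            rw [pow_succ]
            nlinarith [pow_pos (two_pos : (0 : ℝ) < 2) k]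
    calc _ ≤ 2 * ENNReal.ofReal (badBound d e ((P).blockLen 0) k) *
          (1 + 2 * (P).chunkLen (k + 1) : ℕ) := by
          gcongr
          exact codeParams_badProb_le he slot p h k
      _ = ENNReal.ofReal (2 * badBound d e ((P).blockLen 0) k *
          ((1 + 2 * (P).chunkLen (k + 1) : ℕ))) := by
          rw [ENNReal.ofReal_mul (mul_nonneg (by norm_num) (badBound_nonneg _ _ _ _)),
            ENNReal.ofReal_mul (by norm_num), ENNReal.ofReal_natCast]
          norm_num
      _ ≤ _ := ENNReal.ofReal_le_ofReal h4
  refine (Finset.sum_le_sum fun k _ => key k).trans ?_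
  rw [← ENNReal.ofReal_sum_of_nonneg fun k _ => by positivity, ← ENNReal.ofReal_one]
  refine ENNReal.ofReal_le_ofReal ?_
  have : ∀ K : ℕ, ∑ k ∈ Finset.range K, (1 / 2 : ℝ) ^ (k + 1) = 1 - (1 / 2) ^ K := by
    intro K
    induction K with
    | zero => simp
    | succ K ih => rw [Finset.sum_range_succ, ih, pow_succ]; ring
  rw [this]
  have : (0 : ℝ) ≤ (1 / 2) ^ K := by positivity
  linarith

/-- On the left is Chernoff's bound at `t = 1 / 2 ^ e` for the level `0` block length; on the right
the inverse of a polynomial in `d`, `2 ^ e` and `e`, hence `2 ^ (-O(d * e))`. -/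
theorem exp_le_badBound (he : 0 < e) : Real.exp (-(2 ^ 13 * (d * e))) ≤
    badBound d e (2 ^ 20 * d ^ 2 * 2 ^ e * 2 ^ e * e) 0 := by
  have hd : 0 < d := Fintype.card_pos
  have h1 : (2 : ℝ) ^ (2 ^ 13 * (d * e)) ≤ Real.exp (2 ^ 13 * (d * e)) := by
    have h2 : (2 : ℝ) ≤ Real.exp 1 := by have := Real.add_one_le_exp (1 : ℝ); linarith
    calc (2 : ℝ) ^ (2 ^ 13 * (d * e)) ≤ Real.exp 1 ^ (2 ^ 13 * (d * e)) := by gcongr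
      _ = _ := by rw [← Real.exp_nat_mul]; push_cast; ring_nf
  have h2 : 2 ^ 40 * d ^ 6 * (2 ^ e) ^ 5 * e ≤ 2 ^ (2 ^ 13 * (d * e)) := by
    have e1 : d ^ 6 ≤ (2 ^ d) ^ 6 := Nat.pow_le_pow_left Nat.lt_two_pow_self.le 6
    have e2 : e ≤ 2 ^ e := Nat.lt_two_pow_self.le
    calc 2 ^ 40 * d ^ 6 * (2 ^ e) ^ 5 * e ≤ 2 ^ 40 * (2 ^ d) ^ 6 * (2 ^ e) ^ 5 * 2 ^ e := by gcongr
      _ = 2 ^ (40 + d * 6 + e * 5 + e) := by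
          rw [pow_add, pow_add, pow_add, pow_mul, pow_mul]
      _ ≤ _ := Nat.pow_le_pow_right (by norm_num) (by nlinarith [Nat.mul_le_mul hd he])
  have h3 : ((2 ^ 40 * d ^ 6 * (2 ^ e) ^ 5 * e : ℕ) : ℝ) ≤ Real.exp (2 ^ 13 * (d * e)) :=
    le_trans (by exact_mod_cast h2) h1
  have h4 : badBound d e (2 ^ 20 * d ^ 2 * 2 ^ e * 2 ^ e * e) 0 =
      ((2 ^ 40 * d ^ 6 * (2 ^ e) ^ 5 * e : ℕ) : ℝ)⁻¹ := by
    unfold badBound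
    push_cast
    rw [pow_one, div_div, one_div]
    congr 1
    ring
  rw [h4, Real.exp_neg]
  have : (0 : ℝ) < ((2 ^ 40 * d ^ 6 * (2 ^ e) ^ 5 * e : ℕ) : ℝ) := by
    have : 0 < 2 ^ 40 * d ^ 6 * (2 ^ e) ^ 5 * e := by positivity
    exact_mod_cast this
  exact inv_anti₀ this h3

end Parameters

/-! ### The universal scheme -/

/-- The redundancy `ε` is realized as `2 ^ (-redLevel ε)`, up to a constant. -/
noncomputable def redLevel (ε : ℝ) : ℕ := ⌈Real.logb 2 (1 / ε)⌉₊ + 1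

/-- The number of levels at blocklength `n`. -/
def levelCount (D e n : ℕ) : ℕ := Nat.sqrt (Nat.log 2 n / (2 * (20 + 2 * D + 3 * e))) - 1

/-- The size of the payload of a block of level `0`. -/
noncomputable def slotSize (D e n m : ℕ) : ℕ :=
  -- Of the rate `m / n`, half of `2 ^ (-e)` is withheld: `3/8` for flags, pointers and spare areas
  -- of all levels, and `1/8` for the part of the last top block beyond the word.
  ⌊((2 ^ 20 * D ^ 2 * 2 ^ e * 2 ^ e * e : ℕ) : ℝ) * ((m : ℝ) / n - 1 / (2 * 2 ^ e))⌋₊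

/-- The parameters for redundancy `ε`, blocklength `n` and codeword length `m`. -/
noncomputable def multilevelParams (X : Type u) [Fintype X] [Nonempty X] (ε : ℝ) (n m : ℕ) :
    Params X :=
  codeParams X (redLevel ε) (Nat.succ_pos _) (slotSize (Fintype.card X) (redLevel ε) n m)

open Classical in
/-- The universal scheme. -/
noncomputable def multilevelScheme (X : Type u) [Fintype X] [Nonempty X] : UniversalScheme X :=
  fun ε n m =>
    if h : ∃ hn : 0 < n,
        (multilevelParams X ε n m).blockLen (levelCount (Fintype.card X) (redLevel ε) n) ≤ n ∧
        (multilevelParams X ε n m).topCount (levelCount (Fintype.card X) (redLevel ε) n) n *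
          (multilevelParams X ε n m).chunkLen (levelCount (Fintype.card X) (redLevel ε) n) ≤ m ∧
        ∃ g, (multilevelParams X ε n m).GoodWord (levelCount (Fintype.card X) (redLevel ε) n) hn g
    then (multilevelParams X ε n m).localScheme h.choose_spec.1 h.choose_spec.2.1
      h.choose_spec.2.2.choose_spec
    else constScheme (Classical.arbitrary X) n m

theorem multilevelScheme_eq {X : Type u} [Fintype X] [Nonempty X] {ε : ℝ} {n m : ℕ} {hn : 0 < n}
    (hK : (multilevelParams X ε n m).blockLen
      (levelCount (Fintype.card X) (redLevel ε) n) ≤ n)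
    (hm : (multilevelParams X ε n m).topCount (levelCount (Fintype.card X) (redLevel ε) n) n *
      (multilevelParams X ε n m).chunkLen (levelCount (Fintype.card X) (redLevel ε) n) ≤ m)
    (hg : ∃ g, (multilevelParams X ε n m).GoodWord
      (levelCount (Fintype.card X) (redLevel ε) n) hn g) :
    ∃ (g : _) (hg : (multilevelParams X ε n m).GoodWord
      (levelCount (Fintype.card X) (redLevel ε) n) hn g),
      multilevelScheme X ε n m = (multilevelParams X ε n m).localScheme hK hm hg := by
  have h : ∃ hn : 0 < n,
        (multilevelParams X ε n m).blockLen (levelCount (Fintype.card X) (redLevel ε) n) ≤ n ∧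
        (multilevelParams X ε n m).topCount (levelCount (Fintype.card X) (redLevel ε) n) n *
          (multilevelParams X ε n m).chunkLen (levelCount (Fintype.card X) (redLevel ε) n) ≤ m ∧
        ∃ g, (multilevelParams X ε n m).GoodWord
          (levelCount (Fintype.card X) (redLevel ε) n) hn g := ⟨hn, hK, hm, hg⟩
  exact ⟨h.choose_spec.2.2.choose, h.choose_spec.2.2.choose_spec, dif_pos h⟩

/-! ### Growth of the redundancy level and of the number of levels -/

section Asymptotics

theorem redLevel_pos (ε : ℝ) : 0 < redLevel ε := Nat.succ_pos _

theorem two_div_le_two_pow {ε : ℝ} (h0 : 0 < ε) : 2 / ε ≤ 2 ^ redLevel ε := by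
  have h1 : Real.logb 2 (1 / ε) ≤ ⌈Real.logb 2 (1 / ε)⌉₊ := Nat.le_ceil _
  rw [Real.logb_le_iff_le_rpow (by norm_num) (by positivity), Real.rpow_natCast] at h1
  rw [redLevel, pow_succ]
  calc 2 / ε = 1 / ε * 2 := by ring
    _ ≤ _ := by gcongr

theorem one_le_logb {ε : ℝ} (h0 : 0 < ε) (h1 : ε < 1 / 2) : 1 ≤ Real.logb 2 (1 / ε) := by
  rw [Real.le_logb_iff_rpow_le (by norm_num) (by positivity), Real.rpow_one,
    le_div_iff₀ h0]
  linarith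

theorem two_pow_le {ε : ℝ} (h0 : 0 < ε) (h1 : ε < 1 / 2) : (2 : ℝ) ^ redLevel ε ≤ 4 / ε := by
  have h2 := Nat.ceil_lt_add_one (zero_le_one.trans (one_le_logb h0 h1))
  have h3 : ((⌈Real.logb 2 (1 / ε)⌉₊ : ℕ) : ℝ) - 1 ≤ Real.logb 2 (1 / ε) := by linarith
  rw [Real.le_logb_iff_rpow_le (by norm_num) (by positivity), Real.rpow_sub_one (by norm_num),
    Real.rpow_natCast] at h3
  rw [redLevel, pow_succ]
  have h4 : 4 / ε = 4 * (1 / ε) := by ring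
  rw [h4]
  linarith

theorem redLevel_le {ε : ℝ} (h0 : 0 < ε) (h1 : ε < 1 / 2) :
    (redLevel ε : ℝ) ≤ Real.logb 2 (1 / ε) + 2 := by
  have h2 := Nat.ceil_lt_add_one (zero_le_one.trans (one_le_logb h0 h1))
  rw [redLevel]
  push_cast
  linarith

theorem lt_levelCount (D e n : ℕ) : Nat.log 2 n <
    2 * (20 + 2 * D + 3 * e) * (levelCount D e n + 2) ^ 2 := by
  have h1 := Nat.lt_succ_sqrt (Nat.log 2 n / (2 * (20 + 2 * D + 3 * e)))
  rw [Nat.div_lt_iff_lt_mul (by omega)] at h1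
  refine h1.trans_le ?_
  rw [mul_comm]
  refine Nat.mul_le_mul_left _ ?_
  rw [pow_two]
  have h2 : (Nat.sqrt (Nat.log 2 n / (2 * (20 + 2 * D + 3 * e)))).succ ≤ levelCount D e n + 2 := by
    unfold levelCount; omega
  exact Nat.mul_le_mul h2 h2

/-- The factor `2` makes the top block length at most `√n`, so that rounding `n` up to whole top
blocks is asymptotically free. -/
theorem levelCount_sq_le {D e n : ℕ} (hn : 2 ^ (2 * (20 + 2 * D + 3 * e)) ≤ n) :
    2 * ((20 + 2 * D + 3 * e) * (levelCount D e n + 1) ^ 2) ≤ Nat.log 2 n := by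
  have h0 : n ≠ 0 := by rintro rfl; simp at hn
  have h1 : 2 * (20 + 2 * D + 3 * e) ≤ Nat.log 2 n := Nat.le_log_of_pow_le (by norm_num) hn
  have h2 : 1 ≤ Nat.log 2 n / (2 * (20 + 2 * D + 3 * e)) := by
    rw [Nat.le_div_iff_mul_le (by omega)]; omega
  have h3 : 1 ≤ Nat.sqrt (Nat.log 2 n / (2 * (20 + 2 * D + 3 * e))) := Nat.le_sqrt.2 (by omega)
  have h4 : levelCount D e n + 1 = Nat.sqrt (Nat.log 2 n / (2 * (20 + 2 * D + 3 * e))) := by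
    unfold levelCount; omega
  rw [h4, ← mul_assoc]
  refine le_trans (Nat.mul_le_mul_left _ ?_) (Nat.mul_div_le _ (2 * (20 + 2 * D + 3 * e)))
  rw [pow_two]
  exact Nat.sqrt_le _

theorem tendsto_levelCount (D e : ℕ) : Tendsto (levelCount D e) atTop atTop := by
  refine tendsto_atTop.2 fun b => ?_
  filter_upwards [eventually_ge_atTop (2 ^ (2 * (20 + 2 * D + 3 * e) * (b + 2) ^ 2))] with n hn
  have h1 := Nat.le_log_of_pow_le (by norm_num) hn
  have h2 := lt_of_le_of_lt h1 (lt_levelCount D e n)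
  have h3 := lt_of_mul_lt_mul_left h2 (Nat.zero_le _)
  have h4 := lt_of_pow_lt_pow_left₀ 2 (Nat.zero_le _) h3
  omega

/-- Meant for `J = K + 2` with `K` levels: `2 ^ K = 2 ^ J / 4` has to beat both `log₂ n = O(J ^ 2)`,
the cost of the union bound over top blocks, and the target exponent `2 ^ (J / 2)`. -/
theorem eventually_sq_le {C : ℝ} (hC : 0 ≤ C) :
    ∀ᶠ J : ℕ in atTop, 4 * (2 : ℝ) ^ ((J : ℝ) / 2) + C * (J : ℝ) ^ 2 ≤ 2 ^ J := by
  set r : ℝ := 2 ^ (-(1 / 2) : ℝ) with hr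
  have hr0 : 0 < r := by positivity
  have hr1 : |r| < 1 := by
    rw [abs_of_pos hr0]
    exact Real.rpow_lt_one_of_one_lt_of_neg (by norm_num) (by norm_num)
  have h1 := tendsto_pow_const_mul_const_pow_of_abs_lt_one 2 hr1
  have h2 := tendsto_pow_const_mul_const_pow_of_abs_lt_one 0 hr1
  have h3 := (h2.const_mul 4).add (h1.const_mul C)
  simp only [mul_zero, add_zero, pow_zero, one_mul] at h3
  filter_upwards [h3.eventually (gt_mem_nhds zero_lt_one)] with J hJ
  set x : ℝ := 2 ^ ((J : ℝ) / 2) with hx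
  have hx0 : 0 < x := by positivity
  have hx1 : 1 ≤ x := Real.one_le_rpow (by norm_num) (by positivity)
  have hxr : r ^ J * x = 1 := by
    rw [hr, hx, ← Real.rpow_natCast, ← Real.rpow_mul (by norm_num), ← Real.rpow_add (by norm_num)]
    rw [show -(1 / 2) * (J : ℝ) + (J : ℝ) / 2 = 0 by ring, Real.rpow_zero]
  have hxx : x * x = 2 ^ J := by
    rw [hx, ← Real.rpow_add (by norm_num), add_halves, Real.rpow_natCast]
  have h4 := mul_le_mul_of_nonneg_right hJ.le (mul_pos hx0 hx0).le
  have h5 : (4 * r ^ J + C * ((J : ℝ) ^ 2 * r ^ J)) * (x * x) = 4 * x + C * (J : ℝ) ^ 2 * x := by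
    calc _ = (4 * x + C * (J : ℝ) ^ 2 * x) * (r ^ J * x) := by ring
      _ = _ := by rw [hxr, mul_one]
  rw [h5, one_mul, hxx] at h4
  have h6 : C * (J : ℝ) ^ 2 ≤ C * (J : ℝ) ^ 2 * x :=
    le_mul_of_one_le_right (by positivity) hx1
  linarith

end Asymptotics

theorem exists_error_exponent (D e : ℕ) : ∃ c : ℝ, 0 < c ∧ ∀ᶠ n : ℕ in atTop,
    (n : ℝ) * (1 / 2) ^ 2 ^ levelCount D e n ≤
      2 ^ (-(2 : ℝ) ^ (c * Real.sqrt (Real.logb 2 n))) := by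
  set u : ℝ := ((20 + 2 * D + 3 * e : ℕ) : ℝ) with hu
  have hu0 : 0 < u := by rw [hu]; positivity
  -- From `log₂ n ≤ 2 u (K + 2) ^ 2`, this constant gives `c √(log₂ n) ≤ (K + 2) / 2`.
  refine ⟨1 / (2 * Real.sqrt (2 * u)), by positivity, ?_⟩
  have h1 := eventually_sq_le (C := 8 * u) (by positivity)
  have h2 : Tendsto (fun n => levelCount D e n + 2) atTop atTop :=
    (tendsto_add_atTop_nat 2).comp (tendsto_levelCount D e)
  filter_upwards [h2.eventually h1, eventually_ge_atTop 1] with n hJ hn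
  set K := levelCount D e n with hK
  have hn0 : (0 : ℝ) < n := by exact_mod_cast hn
  set L := Real.logb 2 n with hL
  have hLn : (n : ℝ) = 2 ^ L := (Real.rpow_logb (by norm_num) (by norm_num) hn0).symm
  have hLJ : L ≤ 2 * u * ((K + 2 : ℕ) : ℝ) ^ 2 := by
    have h3 : L ≤ (Nat.log 2 n + 1 : ℕ) := by
      rw [hL, Real.logb_le_iff_le_rpow (by norm_num) hn0, Real.rpow_natCast]
      exact_mod_cast (Nat.lt_pow_succ_log_self (by norm_num) n).le
    have h4 : Nat.log 2 n + 1 ≤ 2 * (20 + 2 * D + 3 * e) * (K + 2) ^ 2 := lt_levelCount D e n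
    refine h3.trans ?_
    have h5 := (Nat.cast_le (α := ℝ)).2 h4
    rw [Nat.cast_mul, Nat.cast_mul, ← hu, Nat.cast_pow] at h5
    exact_mod_cast h5
  have hsq : 1 / (2 * Real.sqrt (2 * u)) * Real.sqrt L ≤ ((K + 2 : ℕ) : ℝ) / 2 := by
    have h3 : Real.sqrt L ≤ Real.sqrt (2 * u) * ((K + 2 : ℕ) : ℝ) := by
      refine (Real.sqrt_le_sqrt hLJ).trans (le_of_eq ?_)
      rw [Real.sqrt_mul (by positivity), Real.sqrt_sq (by positivity)]
    calc _ ≤ 1 / (2 * Real.sqrt (2 * u)) * (Real.sqrt (2 * u) * ((K + 2 : ℕ) : ℝ)) := by gcongr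
      _ = _ := by
        have : Real.sqrt (2 * u) ≠ 0 := by positivity
        field_simp
  have h3 : (2 : ℝ) ^ (1 / (2 * Real.sqrt (2 * u)) * Real.sqrt L) ≤
      2 ^ (((K + 2 : ℕ) : ℝ) / 2) := Real.rpow_le_rpow_of_exponent_le (by norm_num) hsq
  have h4 : ((1 : ℝ) / 2) ^ 2 ^ K = 2 ^ (-((2 : ℝ) ^ K)) := by
    rw [Real.rpow_neg (by norm_num), one_div, inv_pow, ← Real.rpow_natCast 2 (2 ^ K)]
    push_cast
    rfl
  rw [hLn, h4, ← Real.rpow_add (by norm_num)]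
  refine Real.rpow_le_rpow_of_exponent_le (by norm_num) ?_
  rw [pow_add] at hJ
  linarith

theorem badBound_le {D e b : ℕ} (hD : 0 < D) (hb : 0 < b) (k : ℕ) :
    badBound D e b k ≤ (1 / 2) ^ 2 ^ k := by
  have hD' : (1 : ℝ) ≤ D := by exact_mod_cast hD
  have hb' : (1 : ℝ) ≤ b := by exact_mod_cast hb
  have hE : (1 : ℝ) ≤ 2 ^ e := one_le_pow₀ (by norm_num)
  have h4 : (1 : ℝ) ≤ 4 ^ k := one_le_pow₀ (by norm_num)
  have h16 : (1 : ℝ) ≤ 16 * D * 2 ^ e := by nlinarith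
  unfold badBound
  refine (div_le_self (by positivity) ?_).trans ?_
  · have : (1 : ℝ) ≤ (16 * D * 2 ^ e) ^ 2 := one_le_pow₀ h16
    nlinarith
  · refine pow_le_pow_left₀ (by positivity) ?_ _
    refine one_div_le_one_div_of_le (by norm_num) ?_
    have : (2 : ℝ) ≤ 16 * D * b := by nlinarith
    nlinarith

/-! ### Probabilities, sizes and costs for the chosen parameters -/

section Sizes

variable {X : Type u} [Fintype X] [Nonempty X] {e : ℕ} (he : 0 < e) (slot : ℕ)

local notation "P" => codeParams X e he slot
local notation "d" => Fintype.card X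

theorem codeParams_blockLen_zero_cast :
    ((P).blockLen 0 : ℝ) = 2 ^ 20 * d ^ 2 * 2 ^ e * 2 ^ e * e := by
  rw [codeParams_blockLen_zero]; push_cast; ring

theorem le_codeParams_blockLen_zero : (8 : ℝ) * 2 ^ e ≤ (P).blockLen 0 := by
  have hd : (1 : ℝ) ≤ d := by exact_mod_cast Fintype.card_pos (α := X)
  have he' : (1 : ℝ) ≤ e := by exact_mod_cast he
  have hE : (1 : ℝ) ≤ 2 ^ e := one_le_pow₀ (by norm_num)
  rw [codeParams_blockLen_zero_cast]
  calc (8 : ℝ) * 2 ^ e ≤ 2 ^ 20 * 1 ^ 2 * 1 * 2 ^ e * 1 := by linarith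
    _ ≤ _ := by gcongr

theorem codeParams_slot (h : slot ≤ 3 * d * (P).blockLen 0) : (P).slot = slot := by
  have hd : 0 < d := Fintype.card_pos
  refine min_eq_left (Nat.le_sub_one_of_lt (h.trans_lt ?_))
  rw [codeParams_blockLen_zero]
  have e0 : d < 2 ^ d := Nat.lt_two_pow_self
  have e2 : e < 2 ^ e := Nat.lt_two_pow_self
  have e1 : d ^ 2 ≤ (2 ^ d) ^ 2 := Nat.pow_le_pow_left e0.le 2
  calc 3 * d * (2 ^ 20 * d ^ 2 * 2 ^ e * 2 ^ e * e)
      ≤ 3 * 2 ^ d * (2 ^ 20 * (2 ^ d) ^ 2 * 2 ^ e * 2 ^ e * 2 ^ e) := by gcongr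
    _ < 4 * 2 ^ d * (2 ^ 20 * (2 ^ d) ^ 2 * 2 ^ e * 2 ^ e * 2 ^ e) := by
        gcongr; norm_num
    _ = 2 ^ (22 + 3 * d + 3 * e) := by ring
    _ ≤ 2 ^ (30 * d * e) := by
        refine Nat.pow_le_pow_right (by norm_num) ?_
        nlinarith [Nat.mul_le_mul hd he, Nat.mul_le_mul_left d he, Nat.mul_le_mul_right e hd]

variable {slot} {p : PMF X} {ε μ : ℝ} {n : ℕ}

/-- Beyond the entropy, the slot offers at least `2 - 1/8 - 1/2` units of `2 ^ (-e)` bits per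
letter. It needs `1` for the deviation `t`, `1/64` for the code overhead, and at most `1/8` for
rounding the slot to an integer. -/
theorem codeParams_badProb_zero_le (hlt : (P).blockLen 0 * (μ - 1 / (2 * 2 ^ e)) ≤ slot + 1)
    (hle : slot ≤ 3 * d * (P).blockLen 0) (hμ : entropy p + ε - 1 / (8 * 2 ^ e) ≤ μ)
    (hε : 2 / 2 ^ e ≤ ε) :
    (P).badProb p 0 ≤ ENNReal.ofReal (badBound d e ((P).blockLen 0) 0) := by
  have hd : (1 : ℝ) ≤ d := by exact_mod_cast Fintype.card_pos (α := X)
  have he' : (1 : ℝ) ≤ e := by exact_mod_cast he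
  have hE : (1 : ℝ) ≤ 2 ^ e := one_le_pow₀ (by norm_num)
  have hb := le_codeParams_blockLen_zero (X := X) he slot
  have hbE := codeParams_blockLen_zero_cast (X := X) he slot
  refine ((codeParams_overhead he slot).badProb_zero_le (p := p) (t := 1 / 2 ^ e) (by positivity)
    (by rw [div_le_one (by positivity)]; exact hE) ?_).trans (ENNReal.ofReal_le_ofReal ?_)
  · rw [codeParams_slot he slot hle]
    have hnum : (((P).num : ℕ) : ℝ) * ((16 * d ^ 2 * e : ℕ) : ℝ) =
        (P).blockLen 0 * (1 / (64 * 2 ^ e)) := by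
      rw [hbE]
      change ((2 ^ 10 * 2 ^ e : ℕ) : ℝ) * _ = _
      push_cast
      field_simp
      norm_num
    rw [hnum]
    have h1 : (P).blockLen 0 * (entropy p + ε - 1 / (8 * 2 ^ e) - 1 / (2 * 2 ^ e)) ≤
        (slot : ℝ) + 1 := le_trans (by gcongr) hlt
    have h2 : (P).blockLen 0 * (entropy p + 2 / 2 ^ e - 1 / (8 * 2 ^ e) - 1 / (2 * 2 ^ e)) ≤
        (slot : ℝ) + 1 := le_trans (by gcongr) h1
    have h3 : (8 : ℝ) * 2 ^ e * (1 / (8 * 2 ^ e)) ≤ (P).blockLen 0 * (1 / (8 * 2 ^ e)) := by gcongr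
    have h4 : (8 : ℝ) * 2 ^ e * (1 / (8 * 2 ^ e)) = 1 := by field_simp
    have h5 : (0 : ℝ) ≤ (P).blockLen 0 * (1 / (64 * 2 ^ e)) := by positivity
    have h6 : ((P).blockLen 0 : ℝ) * (entropy p + 1 / 2 ^ e) +
        (P).blockLen 0 * (1 / (64 * 2 ^ e)) + (P).blockLen 0 * (1 / (8 * 2 ^ e)) +
        15 * ((P).blockLen 0 * (1 / (64 * 2 ^ e))) =
        (P).blockLen 0 * (entropy p + 2 / 2 ^ e - 1 / (8 * 2 ^ e) - 1 / (2 * 2 ^ e)) := by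
      field_simp
      ring
    linarith
  · refine le_trans (le_of_eq ?_) ((exp_le_badBound (X := X) he).trans_eq ?_)
    · rw [hbE]
      congr 2
      field_simp
      norm_num
    · rw [codeParams_blockLen_zero]

theorem codeParams_chunkLen_le_of_slot_le (hle : (slot : ℝ) ≤ (P).blockLen 0 * (μ - 1 / (2 * 2 ^ e)))
    (k : ℕ) : ((P).chunkLen k : ℝ) ≤ (P).blockLen k * (μ - 1 / (8 * 2 ^ e)) := by
  have hb : (0 : ℝ) < (P).blockLen 0 := by exact_mod_cast (P).blockLen_pos 0
  refine (codeParams_chunkLen_le he slot k).trans ?_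
  have h1 : (slot : ℝ) / (P).blockLen 0 ≤ μ - 1 / (2 * 2 ^ e) := by
    rwa [div_le_iff₀ hb, mul_comm]
  have h2 : (0 : ℝ) ≤ 1 / (4 * 2 ^ e * 2 ^ k) := by positivity
  have h3 : (1 : ℝ) / (2 * 2 ^ e) = 3 / (8 * 2 ^ e) + 1 / (8 * 2 ^ e) := by field_simp; norm_num
  exact mul_le_mul_of_nonneg_left (by linarith) (Nat.cast_nonneg _)

theorem codeParams_blockLen_levelCount_sq_le (hn : 2 ^ (2 * (20 + 2 * d + 3 * e)) ≤ n) :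
    (P).blockLen (levelCount d e n) ^ 2 ≤ n := by
  have h0 : n ≠ 0 := by rintro rfl; simp at hn
  refine (Nat.pow_le_pow_left (codeParams_blockLen_le he slot _) 2).trans ?_
  rw [← pow_mul, mul_comm]
  exact (Nat.pow_le_pow_right (by norm_num) (levelCount_sq_le hn)).trans (Nat.pow_log_le_self 2 h0)

/-- The top blocks exceed the word by less than `blockLen K` letters. Both `blockLen K` and `24 d 2
^ e` are at most `√n`, so at `3 d` bits per letter the excess fits into the reserve `n / (8 * 2 ^
e)`. -/
theorem codeParams_topCount_mul_le {m : ℕ} (hn : 2 ^ (2 * (20 + 2 * d + 3 * e)) ≤ n)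
    (hn' : (24 * d * 2 ^ e) ^ 2 ≤ n) (hμ : (m : ℝ) / n ≤ 3 * d)
    (hμ' : 1 / (8 * 2 ^ e) ≤ (m : ℝ) / n)
    (hc : ∀ k, ((P).chunkLen k : ℝ) ≤ (P).blockLen k * ((m : ℝ) / n - 1 / (8 * 2 ^ e))) :
    (P).topCount (levelCount d e n) n * (P).chunkLen (levelCount d e n) ≤ m := by
  set K := levelCount d e n
  have h0 : 0 < n := lt_of_lt_of_le (by positivity) hn
  have h0' : (0 : ℝ) < n := by exact_mod_cast h0
  have hB := codeParams_blockLen_levelCount_sq_le (X := X) (slot := slot) he hn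
  have hBn : (P).blockLen K * (24 * d * 2 ^ e) ≤ n := by
    have := Nat.mul_le_mul hB hn'
    rw [← mul_pow, ← pow_two] at this
    exact (Nat.pow_le_pow_iff_left two_ne_zero).1 this
  have hBn' : ((P).blockLen K : ℝ) * (24 * d * 2 ^ e) ≤ n := by exact_mod_cast hBn
  have ht : ((P).topCount K n : ℝ) * (P).blockLen K ≤ n + (P).blockLen K := by
    exact_mod_cast (P).topCount_mul_lt.le
  have hm : (n : ℝ) * ((m : ℝ) / n) = m := by field_simp
  set μ := (m : ℝ) / n
  have h1 : ((P).topCount K n : ℝ) * (P).chunkLen K ≤ m := by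
    calc ((P).topCount K n : ℝ) * (P).chunkLen K
        ≤ (P).topCount K n * ((P).blockLen K * (μ - 1 / (8 * 2 ^ e))) := by gcongr; exact hc K
      _ = ((P).topCount K n * (P).blockLen K) * (μ - 1 / (8 * 2 ^ e)) := by ring
      _ ≤ (n + (P).blockLen K) * (μ - 1 / (8 * 2 ^ e)) := by
          gcongr
      _ = m + ((P).blockLen K * (μ - 1 / (8 * 2 ^ e)) - n / (8 * 2 ^ e)) := by
          rw [← hm]; ring
      _ ≤ m + ((P).blockLen K * (3 * d) - n / (8 * 2 ^ e)) := by
          have : (0 : ℝ) ≤ 1 / (8 * 2 ^ e) := by positivity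
          gcongr
          linarith
      _ ≤ m := by
          have : ((P).blockLen K : ℝ) * (3 * d) ≤ n / (8 * 2 ^ e) := by
            rw [le_div_iff₀ (by positivity)]
            linarith
          linarith
  exact_mod_cast h1

/-- All overheads of reading a sub-block are `O(d ^ 2 * e)` bits, less than `sub / 2 ^ e`, and
disappear in the term `sub * ε`. The entropy thus enters with constant exactly `1`, on which the
comparison with `rStar` rests. -/
theorem codeParams_meanReadCost_le (hε : 1 / 2 ^ e ≤ ε) (hbad : (P).badProb p 0 ≤
      ENNReal.ofReal (badBound d e ((P).blockLen 0) 0))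
    (hc : ∀ k, ((P).chunkLen k : ℝ) ≤ 3 * d * (P).blockLen k) (K : ℕ) :
    (P).meanReadCost p K ≤ ENNReal.ofReal ((P).sub * (entropy p + ε)) := by
  have hd : (1 : ℝ) ≤ d := by exact_mod_cast Fintype.card_pos (α := X)
  have he' : (1 : ℝ) ≤ e := by exact_mod_cast he
  have hE : (1 : ℝ) ≤ 2 ^ e := one_le_pow₀ (by norm_num)
  have hH := entropy_nonneg p
  have h1 : ∑ j ∈ Finset.range K, (P).badProb p j * (1 + (P).chunkLen (j + 1) : ℕ) ≤ 1 := by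
    refine le_trans (Finset.sum_le_sum fun j _ => ?_) (codeParams_cost_le he slot p hbad hc K)
    refine mul_le_mul' ?_ ?_
    · rw [two_mul]; exact le_self_add
    · exact_mod_cast (by omega : 1 + (P).chunkLen (j + 1) ≤ 1 + 2 * (P).chunkLen (j + 1))
  unfold Params.meanReadCost
  refine (add_le_add (add_le_add_right ((codeParams_overhead he slot).meanLen_le p) _) h1).trans ?_
  rw [← ENNReal.ofReal_natCast, ← ENNReal.ofReal_one,
    ← ENNReal.ofReal_add (by positivity) (by positivity),
    ← ENNReal.ofReal_add (by positivity) (by positivity)]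
  refine ENNReal.ofReal_le_ofReal ?_
  have h2 : ((P).sub : ℝ) * (1 / 2 ^ e) = 2 ^ 10 * d ^ 2 * e := by
    change ((2 ^ 10 * d ^ 2 * 2 ^ e * e : ℕ) : ℝ) * _ = _
    push_cast
    field_simp
    norm_num
  have h3 : ((P).sub : ℝ) * (1 / 2 ^ e) ≤ (P).sub * ε := by gcongr
  have h4 : (((1 + 2 * (P).ptr : ℕ)) : ℝ) = 1 + 60 * d * e := by
    change ((1 + 2 * (30 * d * e) : ℕ) : ℝ) = _
    push_cast; ring
  rw [h4]
  push_cast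
  have h5 : (d : ℝ) * e ≤ d ^ 2 * e := by gcongr; nlinarith
  have h6 : (1 : ℝ) ≤ d ^ 2 * e := by nlinarith
  rw [mul_add]
  linarith

theorem codeParams_meanUpdateCost_le (hbad : (P).badProb p 0 ≤
      ENNReal.ofReal (badBound d e ((P).blockLen 0) 0))
    (hc : ∀ k, ((P).chunkLen k : ℝ) ≤ 3 * d * (P).blockLen k) (K : ℕ) :
    (P).meanUpdateCost p K ≤ ENNReal.ofReal (8 * d * (P).blockLen 0) := by
  have hd : (1 : ℝ) ≤ d := by exact_mod_cast Fintype.card_pos (α := X)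
  have hb : (1 : ℝ) ≤ (P).blockLen 0 := by exact_mod_cast (P).blockLen_pos 0
  unfold Params.meanUpdateCost
  refine (add_le_add_right (codeParams_cost_le he slot p hbad hc K) _).trans ?_
  rw [← ENNReal.ofReal_natCast, ← ENNReal.ofReal_one,
    ← ENNReal.ofReal_add (by positivity) (by positivity)]
  refine ENNReal.ofReal_le_ofReal ?_
  push_cast
  nlinarith [hc 0]

end Sizes

theorem codeLength_div_le {X : Type u} [Fintype X] (p : PMF X) {ε : ℝ} (h0 : 0 < ε) {n : ℕ} (hn : 0 < n) :
    (codeLength p ε n : ℝ) / n ≤ entropy p + ε := by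
  have h0' : (0 : ℝ) < n := by exact_mod_cast hn
  have hH := entropy_nonneg p
  rw [div_le_iff₀ h0', mul_comm]
  exact Nat.floor_le (by positivity)

theorem le_codeLength_div {X : Type u} [Fintype X] (p : PMF X) (ε : ℝ) {n : ℕ} (hn : 0 < n) :
    entropy p + ε - 1 / n ≤ (codeLength p ε n : ℝ) / n := by
  have h0' : (0 : ℝ) < n := by exact_mod_cast hn
  have h1 := Nat.lt_floor_add_one ((n : ℝ) * (entropy p + ε))
  rw [le_div_iff₀ h0', sub_mul, div_mul_cancel₀ _ h0'.ne']
  unfold codeLength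
  linarith

/-- Continuity at `0`, where `ε log ε` has the value `0`. The constant `2 ^ 13 d ^ 2` comes from two
surplus sub-blocks of `2 ^ 10 d ^ 2 * 2 ^ e * e` letters and from `2 ^ e ≤ 4 / ε`. -/
theorem exists_overhead_lt {X : Type u} [Fintype X] (p : PMF X) {δ : ℝ} (hδ : 0 < δ) : ∃ ε₀ : ℝ, 0 < ε₀ ∧ ε₀ ≤ 1 / 2 ∧
    ∀ ε : ℝ, 0 < ε → ε < ε₀ →
      (1 + 2 ^ 13 * (Fintype.card X : ℝ) ^ 2 * (ε * (Real.logb 2 (1 / ε) + 2))) * (entropy p + ε) <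
        entropy p + δ := by
  have hcont : Continuous fun ε : ℝ =>
      (1 + 2 ^ 13 * (Fintype.card X : ℝ) ^ 2 * (-(ε * Real.log ε) / Real.log 2 + 2 * ε)) * (entropy p + ε) := by
    have := Real.continuous_mul_log
    fun_prop
  have h1 := hcont.tendsto 0
  have h2 := h1.eventually_lt_const (u := entropy p + δ) (by simpa using hδ)
  obtain ⟨r, hr, h3⟩ := Metric.eventually_nhds_iff.1 h2
  refine ⟨min r (1 / 2), by positivity, min_le_right _ _, fun ε h0 hε => ?_⟩
  have h4 := h3 (y := ε) (by
    rw [Real.dist_0_eq_abs, abs_of_pos h0]; exact hε.trans_le (min_le_left _ _))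
  refine lt_of_eq_of_lt ?_ h4
  rw [one_div, Real.logb_inv, Real.logb]
  ring

/-! ### Performance of the universal scheme -/

section Performance

variable {X : Type u} [Fintype X] [Nonempty X]

local notation "d" => Fintype.card X

theorem one_div_two_pow_le {ε : ℝ} (h0 : 0 < ε) : 2 / 2 ^ redLevel ε ≤ ε := by
  have h := two_div_le_two_pow h0
  rw [div_le_iff₀ h0] at h
  rw [div_le_iff₀ (by positivity)]
  linarith

/-- The surplus of two sub-blocks, or two level `0` blocks, allows for those met only partially at
the ends of a fragment. The factor `16 d` stands for two runs of touched blocks at `8 d` bits per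
letter. -/
theorem multilevelScheme_bounds (p : PMF X) {ε : ℝ} (h0 : 0 < ε) (h1 : ε < 1 / 2) :
    ∀ᶠ n : ℕ in atTop,
      ((multilevelScheme X).at p ε n).scheme.errorProb p ≤
        ENNReal.ofReal ((n : ℝ) * (1 / 2) ^ 2 ^ levelCount d (redLevel ε) n) ∧
      ∀ s : ℕ, 1 ≤ s →
        ((multilevelScheme X).at p ε n).decoder.rAvg p s ≤ ENNReal.ofReal
          ((s + 2 * (2 ^ 10 * d ^ 2 * 2 ^ redLevel ε * redLevel ε)) * (entropy p + ε)) ∧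
        ((multilevelScheme X).at p ε n).updater.tAvg p s ≤ ENNReal.ofReal
          (16 * d * (s + 2 * (2 ^ 20 * d ^ 2 * 2 ^ redLevel ε * 2 ^ redLevel ε * redLevel ε))) := by
  obtain ⟨c, hc0, hc⟩ := exists_error_exponent d (redLevel ε)
  filter_upwards [hc, eventually_ge_atTop (8 * 2 ^ redLevel ε),
    eventually_ge_atTop ((24 * d * 2 ^ redLevel ε) ^ 2),
    eventually_ge_atTop (2 ^ (2 * (20 + 2 * d + 3 * redLevel ε)))] with n hn1 hn2 hn3 hn4
  have hn : 0 < n := lt_of_lt_of_le (by positivity) hn2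
  have hn' : (0 : ℝ) < n := by exact_mod_cast hn
  have hsmall : (n : ℝ) * (1 / 2) ^ 2 ^ levelCount d (redLevel ε) n < 1 :=
    hn1.trans_lt (Real.rpow_lt_one_of_one_lt_of_neg (by norm_num)
      (neg_lt_zero.2 (by positivity)))
  set m := codeLength p ε n with hm
  have hμ1 := codeLength_div_le p h0 hn
  have hμ2 := le_codeLength_div p ε hn
  rw [← hm] at hμ1 hμ2
  have hH := entropy_nonneg p
  have hd : (1 : ℝ) ≤ d := by exact_mod_cast Fintype.card_pos (α := X)
  have hε := one_div_two_pow_le h0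
  have he := redLevel_pos ε
  set e := redLevel ε with hedef
  have hE : (1 : ℝ) ≤ 2 ^ e := one_le_pow₀ (by norm_num)
  have hμ3 : entropy p + ε - 1 / (8 * 2 ^ e) ≤ (m : ℝ) / n := by
    refine le_trans ?_ hμ2
    have : (1 : ℝ) / n ≤ 1 / (8 * 2 ^ e) :=
      one_div_le_one_div_of_le (by positivity) (by exact_mod_cast hn2)
    linarith
  have hμ4 : (m : ℝ) / n ≤ 3 * d := by have := entropy_le p; linarith
  have hE1 : (2 : ℝ) / 2 ^ e = 4 * (1 / (2 * 2 ^ e)) := by field_simp; norm_num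
  have hE2 : (1 : ℝ) / (2 * 2 ^ e) = 4 * (1 / (8 * 2 ^ e)) := by field_simp; norm_num
  have hE3 : (1 : ℝ) / 2 ^ e = 8 * (1 / (8 * 2 ^ e)) := by field_simp
  have hE0 : (0 : ℝ) < 1 / (8 * 2 ^ e) := by positivity
  set ℓ := slotSize d e n m with hℓ
  have hb := codeParams_blockLen_zero (X := X) he ℓ
  have hbr := codeParams_blockLen_zero_cast (X := X) he ℓ
  have hℓ1 : (ℓ : ℝ) ≤ (codeParams X e he ℓ).blockLen 0 * ((m : ℝ) / n - 1 / (2 * 2 ^ e)) := by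
    rw [hb]
    exact Nat.floor_le (mul_nonneg (Nat.cast_nonneg _) (by linarith))
  have hℓ2 : (codeParams X e he ℓ).blockLen 0 * ((m : ℝ) / n - 1 / (2 * 2 ^ e)) ≤ ℓ + 1 := by
    rw [hb]
    exact (Nat.lt_floor_add_one _).le
  have hℓ3 : ℓ ≤ 3 * d * (codeParams X e he ℓ).blockLen 0 := by
    have : (ℓ : ℝ) ≤ 3 * d * (codeParams X e he ℓ).blockLen 0 := by
      refine hℓ1.trans ?_
      rw [mul_comm]
      gcongr
      linarith
    exact_mod_cast this
  have hck := codeParams_chunkLen_le_of_slot_le he hℓ1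
  have hck' : ∀ k, ((codeParams X e he ℓ).chunkLen k : ℝ) ≤
      3 * d * (codeParams X e he ℓ).blockLen k := fun k => (hck k).trans (by
    rw [mul_comm]
    gcongr
    linarith)
  have hbad := codeParams_badProb_zero_le (p := p) he hℓ2 hℓ3 hμ3 hε
  set K := levelCount d e n with hKdef
  have hK : (codeParams X e he ℓ).blockLen K ≤ n :=
    (Nat.le_self_pow two_ne_zero _).trans (codeParams_blockLen_levelCount_sq_le he hn4)
  have htop := codeParams_topCount_mul_le he hn4 hn3 hμ4 (by linarith) hck
  have hbK : (codeParams X e he ℓ).topCount K n * (codeParams X e he ℓ).badProb p K ≤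
      ENNReal.ofReal ((n : ℝ) * (1 / 2) ^ 2 ^ K) := by
    rw [ENNReal.ofReal_mul (Nat.cast_nonneg _), ENNReal.ofReal_natCast]
    refine mul_le_mul' ?_ ?_
    · have hB := (codeParams X e he ℓ).blockLen_pos K
      have : (codeParams X e he ℓ).topCount K n ≤ n := by
        unfold Params.topCount
        rw [← Nat.lt_succ_iff, Nat.div_lt_iff_lt_mul hB, Nat.succ_mul]
        have := Nat.le_mul_of_pos_right n hB
        omega
      exact_mod_cast this
    · exact (codeParams_badProb_le he ℓ p hbad K).trans (ENNReal.ofReal_le_ofReal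
        (badBound_le Fintype.card_pos ((codeParams X e he ℓ).blockLen_pos 0) K))
  have hex : ∃ g, (codeParams X e he ℓ).GoodWord K hn g :=
    (codeParams X e he ℓ).exists_goodWord p hK
      (hbK.trans_lt (ENNReal.ofReal_lt_one.2 hsmall))
  obtain ⟨g, hg, heq⟩ := multilevelScheme_eq (X := X) (ε := ε) (n := n) (m := m) hK htop hex
  change ((multilevelScheme X) ε n m).scheme.errorProb p ≤ _ ∧ ∀ s : ℕ, 1 ≤ s →
    ((multilevelScheme X) ε n m).decoder.rAvg p s ≤ _ ∧
    ((multilevelScheme X) ε n m).updater.tAvg p s ≤ _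
  rw [heq]
  refine ⟨((codeParams X e he ℓ).errorProb_le p hK htop hg).trans hbK, fun s hs => ⟨?_, ?_⟩⟩
  · refine ((codeParams X e he ℓ).decoder_rAvg_le p hK htop hg hs).trans ?_
    refine (mul_le_mul' le_rfl (codeParams_meanReadCost_le (p := p) (ε := ε) he
      (by linarith) hbad hck' K)).trans ?_
    rw [← ENNReal.ofReal_natCast, ← ENNReal.ofReal_mul (Nat.cast_nonneg _)]
    refine ENNReal.ofReal_le_ofReal ?_
    rw [← mul_assoc]
    refine mul_le_mul_of_nonneg_right ?_ (by positivity)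
    have h2 : ((s / (codeParams X e he ℓ).sub : ℕ) : ℝ) * (codeParams X e he ℓ).sub ≤ s := by
      exact_mod_cast Nat.div_mul_le_self _ _
    have h3 : ((codeParams X e he ℓ).sub : ℝ) = 2 ^ 10 * d ^ 2 * 2 ^ e * e := by
      change ((2 ^ 10 * d ^ 2 * 2 ^ e * e : ℕ) : ℝ) = _
      push_cast
      ring
    rw [← h3]
    push_cast
    linarith
  · refine ((codeParams X e he ℓ).updater_tAvg_le p hK htop hg s).trans ?_
    refine (mul_le_mul' le_rfl (codeParams_meanUpdateCost_le (p := p) he hbad hck' K)).trans ?_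
    rw [← ENNReal.ofReal_natCast, ← ENNReal.ofReal_mul (Nat.cast_nonneg _)]
    refine ENNReal.ofReal_le_ofReal ?_
    have h2 : ((s / (codeParams X e he ℓ).blockLen 0 : ℕ) : ℝ) *
        (codeParams X e he ℓ).blockLen 0 ≤ s := by
      exact_mod_cast Nat.div_mul_le_self _ _
    rw [← hbr]
    push_cast
    calc _ = 16 * (d : ℝ) * (((s / (codeParams X e he ℓ).blockLen 0 : ℕ) : ℝ) *
        (codeParams X e he ℓ).blockLen 0 + 2 * (codeParams X e he ℓ).blockLen 0) := by
          ring
      _ ≤ _ := by gcongr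

theorem redLevel_le_three_mul {ε : ℝ} (h0 : 0 < ε) (h1 : ε < 1 / 2) :
    (redLevel ε : ℝ) ≤ 3 * Real.logb 2 (1 / ε) := by
  have := redLevel_le h0 h1
  have := one_le_logb h0 h1
  linarith

theorem two_pow_mul_redLevel_le {ε : ℝ} (h0 : 0 < ε) (h1 : ε < 1 / 2) :
    (2 : ℝ) ^ redLevel ε * 2 ^ redLevel ε * redLevel ε ≤ 48 * scale ε := by
  have hl := one_le_logb h0 h1
  calc _ ≤ 4 / ε * (4 / ε) * (3 * Real.logb 2 (1 / ε)) := by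
        gcongr
        · exact two_pow_le h0 h1
        · exact two_pow_le h0 h1
        · exact redLevel_le_three_mul h0 h1
    _ = _ := by unfold scale; field_simp; norm_num

/-- A sum is at most twice its larger term; the two regimes are separated at `s = scale ε`. -/
theorem le_localityBound {a ε c : ℝ} {s : ℕ} (ha : 0 ≤ a)
    (h : c ≤ a * (s + scale ε)) : ENNReal.ofReal c ≤ localityBound (2 * a) (2 * a) 1 ε s := by
  unfold localityBound
  refine ENNReal.ofReal_le_ofReal ?_
  split_ifs with h'
  · nlinarith
  · nlinarith

theorem one_le_scale {ε : ℝ} (h0 : 0 < ε) (h1 : ε < 1 / 2) : 1 ≤ scale ε := by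
  have hl := one_le_logb h0 h1
  have h2 : 1 ≤ 1 / ε ^ 2 := by
    rw [le_div_iff₀ (by positivity)]
    nlinarith
  unfold scale
  nlinarith

theorem multilevelScheme_performs (p : PMF X) : (multilevelScheme X).Performs p := by
  have hd : (1 : ℝ) ≤ d := by exact_mod_cast Fintype.card_pos (α := X)
  have hH := entropy_nonneg p
  refine ⟨2 * (2 ^ 17 * d ^ 2 * (entropy p + 1)), 2 * (2 ^ 17 * d ^ 2 * (entropy p + 1)), 1,
    2 * (2 ^ 31 * d ^ 3), 2 * (2 ^ 31 * d ^ 3), 1, by positivity, by positivity, one_pos,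
    by positivity, by positivity, one_pos, fun ε h0 h1 => ⟨?_, ?_⟩⟩
  · obtain ⟨c, hc0, hc⟩ := exists_error_exponent d (redLevel ε)
    refine ⟨c, hc0, ?_⟩
    filter_upwards [hc, multilevelScheme_bounds p h0 h1] with n hn hb
    exact hb.1.trans (ENNReal.ofReal_le_ofReal hn)
  · filter_upwards [multilevelScheme_bounds p h0 h1] with n hb s hs _
    have hsc := one_le_scale h0 h1
    have hE : (1 : ℝ) ≤ 2 ^ redLevel ε := one_le_pow₀ (by norm_num)
    have h48 := two_pow_mul_redLevel_le h0 h1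
    have h48' : (2 : ℝ) ^ redLevel ε * redLevel ε ≤ 48 * scale ε := by
      refine le_trans ?_ h48
      gcongr
      exact le_mul_of_one_le_right (by positivity) hE
    have hd2 : (1 : ℝ) ≤ (d : ℝ) ^ 2 := one_le_pow₀ hd
    refine ⟨(hb.2 s hs).1.trans (le_localityBound (by positivity) ?_),
      (hb.2 s hs).2.trans (le_localityBound (by positivity) ?_)⟩
    · calc (s + 2 * (2 ^ 10 * (d : ℝ) ^ 2 * 2 ^ redLevel ε * redLevel ε)) * (entropy p + ε)
          = (s + 2 ^ 11 * (d : ℝ) ^ 2 * (2 ^ redLevel ε * redLevel ε)) * (entropy p + ε) := by ring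
        _ ≤ (s + 2 ^ 11 * (d : ℝ) ^ 2 * (48 * scale ε)) * (entropy p + 1) := by
            gcongr; linarith
        _ ≤ (2 ^ 17 * d ^ 2 * s + 2 ^ 17 * (d : ℝ) ^ 2 * scale ε) * (entropy p + 1) := by
            refine mul_le_mul_of_nonneg_right (add_le_add ?_ ?_) (by positivity)
            · refine le_mul_of_one_le_left (Nat.cast_nonneg _) ?_
              linarith
            · have : 0 ≤ (d : ℝ) ^ 2 * scale ε := by positivity
              linarith
        _ = _ := by ring
    · calc 16 * (d : ℝ) * (s + 2 * (2 ^ 20 * d ^ 2 * 2 ^ redLevel ε * 2 ^ redLevel ε * redLevel ε))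
          = 16 * (d : ℝ) * (s + 2 ^ 21 * d ^ 2 *
              (2 ^ redLevel ε * 2 ^ redLevel ε * redLevel ε)) := by ring
        _ ≤ 16 * (d : ℝ) * (s + 2 ^ 21 * d ^ 2 * (48 * scale ε)) := by gcongr
        _ ≤ 16 * (d : ℝ) * (2 ^ 27 * d ^ 2 * s + 2 ^ 27 * d ^ 2 * scale ε) := by
            refine mul_le_mul_of_nonneg_left (add_le_add ?_ ?_) (by positivity)
            · refine le_mul_of_one_le_left (Nat.cast_nonneg _) ?_
              linarith
            · have : 0 ≤ (d : ℝ) ^ 2 * scale ε := by positivity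
              linarith
        _ = _ := by ring

/-- The surplus of order `ε⁻¹ log (1 / ε)` letters is a vanishing fraction of any `s ≥ ε⁻²`, so the
cost per letter falls below `H + δ` for small `ε`, uniformly in such `s`. -/
theorem multilevelScheme_rAvg_lt (p : PMF X) (hp : ¬ IsDyadic p) :
    ∃ ε₀ : ℝ, 0 < ε₀ ∧ ∀ ε : ℝ, 0 < ε → ε < ε₀ →
      ∀ᶠ n : ℕ in atTop, ∀ s : ℕ, 1 / ε ^ 2 ≤ (s : ℝ) →
        ((multilevelScheme X).at p ε n).decoder.rAvg p s < (s : ℝ≥0∞) * rStar p ε := by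
  obtain ⟨δ, hδ, hr⟩ := exists_lt_rStar p hp
  obtain ⟨ε₀, h0, hhalf, hε₀⟩ := exists_overhead_lt p hδ
  refine ⟨ε₀, h0, fun ε hε hlt => ?_⟩
  have h1 := hlt.trans_le hhalf
  filter_upwards [multilevelScheme_bounds p hε h1] with n hb s hs
  have hs0 : (0 : ℝ) < s := lt_of_lt_of_le (by positivity) hs
  have hs1 : 1 ≤ s := by exact_mod_cast hs0
  have hH := entropy_nonneg p
  have hl := one_le_logb hε h1
  refine ((hb.2 s hs1).1.trans_lt ?_).trans_le (mul_le_mul' le_rfl (hr ε))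
  rw [← ENNReal.ofReal_natCast, ← ENNReal.ofReal_mul (Nat.cast_nonneg _)]
  have hq : 0 < (s : ℝ) * (entropy p + δ) := by positivity
  refine (ENNReal.ofReal_lt_ofReal_iff hq).2 ?_
  refine lt_of_le_of_lt ?_ ((mul_lt_mul_iff_right₀ hs0).2 (hε₀ ε hε hlt))
  have h2 : (2 : ℝ) ^ redLevel ε * redLevel ε ≤ 4 * (s * (ε * (Real.logb 2 (1 / ε) + 2))) := by
    calc _ ≤ 4 / ε * (Real.logb 2 (1 / ε) + 2) := by
          gcongr
          · exact two_pow_le hε h1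
          · exact redLevel_le hε h1
      _ = 4 * (1 / ε ^ 2 * (ε * (Real.logb 2 (1 / ε) + 2))) := by field_simp
      _ ≤ _ := by gcongr
  refine le_trans (mul_le_mul_of_nonneg_right ?_ (by positivity)) (mul_assoc _ _ _).le
  calc (s : ℝ) + 2 * (2 ^ 10 * d ^ 2 * 2 ^ redLevel ε * redLevel ε)
      = s + 2 ^ 11 * (d : ℝ) ^ 2 * (2 ^ redLevel ε * redLevel ε) := by ring
    _ ≤ s + 2 ^ 11 * (d : ℝ) ^ 2 * (4 * (s * (ε * (Real.logb 2 (1 / ε) + 2)))) := by gcongr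
    _ = _ := by ring

end Performance

end LocalCompression

/-- There is a universal constant `αf` and, over every finite alphabet, a universal scheme with the
stated rate, error, local decodability and update guarantees for all i.i.d. sources, such that for
every non-dyadic source, every small enough `ε` and every large enough `n`, decoding any fragment of
length `s ≥ αf / ε²` costs on average fewer probes than `s` times the optimal single-symbol cost. -/
theorem corollary1 :
    ∃ αf : ℝ, 0 < αf ∧
      ∀ (X : Type*) [Fintype X] [Nonempty X],
        ∃ 𝒮 : LocalCompression.UniversalScheme X,
          ∀ p : PMF X,
            𝒮.Performs p ∧
            (¬ LocalCompression.IsDyadic p →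
              ∃ ε₀ : ℝ, 0 < ε₀ ∧ ∀ ε : ℝ, 0 < ε → ε < ε₀ →
                ∀ᶠ n : ℕ in Filter.atTop, ∀ s : ℕ, αf / ε ^ 2 ≤ (s : ℝ) → s ≤ n →
                  (𝒮.at p ε n).decoder.rAvg p s <
                    (s : ENNReal) * LocalCompression.rStar p ε) := by
  refine ⟨1, one_pos, fun X _ _ => ⟨LocalCompression.multilevelScheme X, fun p =>
    ⟨LocalCompression.multilevelScheme_performs p, fun hp => ?_⟩⟩⟩
  obtain ⟨ε₀, h0, h⟩ := LocalCompression.multilevelScheme_rAvg_lt p hp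
  exact ⟨ε₀, h0, fun ε hε hlt => (h ε hε hlt).mono fun n hn s hs _ => hn s hs⟩
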